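/- Let $K$ be an algebraically closed field of characteristic $p \ne 2, 3$ (possibly $p=0$). Let $C \subset \mathbb{P}^2$ be an irreducible plane curve of degree four over $K$ that is rational, with normalization $\varphi : \mathbb{P}^1 \to C$. A point $P \in C$ is called (inner) Galois if the field extension $K(C)/\pi_P^*K(\mathbb{P}^1)$ induced by the projection $\pi_P : C \dashrightarrow \mathbb{P}^1$ from $P$ is Galois. Let $\delta(C)$ be the number of Galois points that are smooth points of $C$, and let $\delta_0(C)$ be the number of those among them for which the tangent line $T_PC$ satisfies $I_P(C, T_PC)=2$, where $I_P$ is the intersection multiplicity at $P$. Two plane curves are projectively equivalent if a projective linear transformation of $\mathbb{P}^2$ maps one onto the other. (1) We have $\delta_0(C) \ge 2$ if and only if there is $\beta \in K$ with $\beta(\beta-1)(\beta^2+\beta+1) \ne 0$ such that $C$ is projectively equivalent to the image of the morphism $$\mathbb{P}^1 \to \mathbb{P}^2, \quad (s:t) \mapsto (s(t+\alpha s)^3 : t(t+\beta s)^3 : t(t+s)^3), \qquad \alpha = \frac{\beta^2+\beta+1}{3}.$$ (2) If $\delta_0(C) \ge 2$ and the differential of $\varphi$ is zero at some point of $\mathbb{P}^1$,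 then $C$ is projectively equivalent to the image of the morphism $$\mathbb{P}^1 \to \mathbb{P}^2, \quad (s:t) \mapsto (s^4 : ts^3 : t(t+s)^3).$$ (3) If $C$ is projectively equivalent to the image of the morphism in (2), then $\delta(C)=\delta_0(C)=2$. -/

import Mathlib

open scoped LinearAlgebra.Projectivization

noncomputable section

/-- The projective line over `K`, with homogeneous coordinates `(s : t) = (v 0 : v 1)`. -/
abbrev PLine (K : Type*) [Field K] : Type _ := ℙ K (Fin 2 → K)

/-- The projective plane over `K`, with homogeneous coordinates `(v 0 : v 1 : v 2)`. -/
abbrev PPlane (K : Type*) [Field K] : Type _ := ℙ K (Fin 3 → K)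

/-- A morphism from the projective line to the projective plane: three binary forms of the same
degree without common zero. -/
structure PLineMorphism (K : Type*) [Field K] where
  /-- the common degree of the forms -/
  degree : ℕ
  /-- the three forms, in the variables `s = X 0` and `t = X 1` -/
  form : Fin 3 → MvPolynomial (Fin 2) K
  homogeneous : ∀ i, (form i).IsHomogeneous degree
  no_common_zero : ∀ v : Fin 2 → K, v ≠ 0 → ∃ i, MvPolynomial.eval v (form i) ≠ 0

namespace PLineMorphism

variable {K : Type*} [Field K] (φ : PLineMorphism K)

/-- The map on vectors. -/
def evalVec (v : Fin 2 → K) : Fin 3 → K := fun i => MvPolynomial.eval v (φ.form i)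

theorem evalVec_ne_zero {v : Fin 2 → K} (hv : v ≠ 0) : φ.evalVec v ≠ 0 := by
  obtain ⟨i, hi⟩ := φ.no_common_zero v hv
  exact fun h => hi (congrFun h i)

/-- The map on points. -/
def toFun (Q : PLine K) : PPlane K :=
  Projectivization.mk K (φ.evalVec Q.rep) (φ.evalVec_ne_zero Q.rep_nonzero)

/-- The image of the morphism. -/
def image : Set (PPlane K) := Set.range φ.toFun

/-- The rational function `φ_i / φ_j` on the projective line, written in the affine coordinate
`t = t / s`. -/
def ratio (i j : Fin 3) : RatFunc K :=
  algebraMap (Polynomial K) (RatFunc K) (MvPolynomial.aeval ![1, Polynomial.X] (φ.form i)) /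
    algebraMap (Polynomial K) (RatFunc K) (MvPolynomial.aeval ![1, Polynomial.X] (φ.form j))

/-- The Jacobian at `v` of the map on vectors. -/
def jacobian (v : Fin 2 → K) : (Fin 2 → K) →ₗ[K] (Fin 3 → K) :=
  Matrix.toLin' (Matrix.of fun i j => MvPolynomial.eval v (MvPolynomial.pderiv j (φ.form i)))

theorem jacobian_self (v : Fin 2 → K) : φ.jacobian v v = (φ.degree : K) • φ.evalVec v := by
  funext i
  have h := congrArg (MvPolynomial.eval v) (φ.homogeneous i).sum_X_mul_pderiv
  simp only [map_sum, map_mul, MvPolynomial.eval_X, map_nsmul] at h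
  simp only [jacobian, evalVec, Matrix.toLin'_apply, Matrix.mulVec, dotProduct, Matrix.of_apply,
    Pi.smul_apply, smul_eq_mul]
  rw [nsmul_eq_mul] at h
  rw [← h]
  exact Finset.sum_congr rfl fun j _ => mul_comm _ _

theorem span_le_comap_jacobian (v : Fin 2 → K) :
    Submodule.span K {v} ≤ (Submodule.span K {φ.evalVec v}).comap (φ.jacobian v) := by
  rw [Submodule.span_singleton_le_iff_mem, Submodule.mem_comap, jacobian_self]
  exact Submodule.smul_mem _ _ (Submodule.mem_span_singleton_self _)

/-- The differential of the morphism at the point `[v]`. The tangent space of a projective space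
`ℙ(V)` at `[v]` is `V / ⟨v⟩` (after the choice of the representative `v`), and the differential is
induced by the Jacobian. -/
def differential (v : Fin 2 → K) :
    ((Fin 2 → K) ⧸ Submodule.span K {v}) →ₗ[K] ((Fin 3 → K) ⧸ Submodule.span K {φ.evalVec v}) :=
  Submodule.mapQ _ _ (φ.jacobian v) (φ.span_le_comap_jacobian v)

/-- The differential at the point `Q` is the zero map. -/
def DifferentialVanishesAt (Q : PLine K) : Prop := φ.differential Q.rep = 0

end PLineMorphism

/-- An irreducible plane curve, given by an equation. -/
structure PlaneCurve (K : Type*) [Field K] where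
  /-- the degree -/
  degree : ℕ
  /-- the equation -/
  eqn : MvPolynomial (Fin 3) K
  homogeneous : eqn.IsHomogeneous degree
  irreducible : Irreducible eqn

namespace PlaneCurve

variable {K : Type*} [Field K] (C : PlaneCurve K)

/-- The points of the curve. -/
def points : Set (PPlane K) := {P | MvPolynomial.eval P.rep C.eqn = 0}

/-- The homogeneous coordinate ring. -/
abbrev coordRing : Type _ := MvPolynomial (Fin 3) K ⧸ Ideal.span {C.eqn}

instance isPrime_span_eqn : (Ideal.span {C.eqn}).IsPrime :=
  (Ideal.span_singleton_prime C.irreducible.ne_zero).mpr C.irreducible.prime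

/-- The linear form `∑ aᵢ xᵢ`, in the fraction field of the homogeneous coordinate ring. -/
def linForm (a : Fin 3 → K) : FractionRing C.coordRing :=
  algebraMap C.coordRing (FractionRing C.coordRing)
    (Ideal.Quotient.mk _ (∑ i, MvPolynomial.C (a i) * MvPolynomial.X i))

/-- The coordinate `xᵢ`, in the fraction field of the homogeneous coordinate ring. -/
def coord (i : Fin 3) : FractionRing C.coordRing :=
  algebraMap C.coordRing (FractionRing C.coordRing) (Ideal.Quotient.mk _ (MvPolynomial.X i))

/-- The function field `K(C)`, generated over `K` by the quotients `xᵢ / xⱼ`. -/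
def functionField : IntermediateField K (FractionRing C.coordRing) :=
  IntermediateField.adjoin K {z | ∃ i j, z = C.coord i / C.coord j}

/-- The rational function `xᵢ / xⱼ` on the curve. -/
def ratio (i j : Fin 3) : C.functionField :=
  ⟨C.coord i / C.coord j, IntermediateField.subset_adjoin K _ ⟨i, j, rfl⟩⟩

/-- The subfield `π_P^* K(ℙ¹)` of `K(C)`, where `π_P` is the projection from `P`: it is generated
over `K` by the quotients of linear forms that vanish at `P`. -/
def projectionField (P : PPlane K) : IntermediateField K C.functionField :=
  IntermediateField.adjoin K {z | ∃ a b : Fin 3 → K,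
    ∑ i, a i * P.rep i = 0 ∧ ∑ i, b i * P.rep i = 0 ∧
      (z : FractionRing C.coordRing) = C.linForm a / C.linForm b}

/-- The point `P` is an inner Galois point: it lies on the curve, and `K(C) / π_P^* K(ℙ¹)` is a
Galois extension. -/
def IsGaloisPoint (P : PPlane K) : Prop :=
  P ∈ C.points ∧ IsGalois (C.projectionField P) C.functionField

/-- The point `P` is a smooth point of the curve. -/
def IsSmoothPoint (P : PPlane K) : Prop :=
  P ∈ C.points ∧ ∃ i, MvPolynomial.eval P.rep (MvPolynomial.pderiv i C.eqn) ≠ 0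

/-- The intersection multiplicity at `[p]` of the curve and the line through `[p]` and `[q]`: the
order of vanishing at `u = 0` of the equation of the curve along `p + u q`. -/
def lineMultiplicity (p q : Fin 3 → K) : ℕ :=
  (MvPolynomial.aeval (fun i => Polynomial.C (p i) + Polynomial.X * Polynomial.C (q i))
    C.eqn : Polynomial K).rootMultiplicity 0

/-- For a smooth point `P`: the tangent line `T_P C` meets the curve at `P` with multiplicity `m`.
The line is spanned by `P` and any other point `[q]` of it. -/
def TangentMultiplicityEq (P : PPlane K) (m : ℕ) : Prop :=
  ∀ q : Fin 3 → K, LinearIndependent K ![P.rep, q] →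
    ∑ i, MvPolynomial.eval P.rep (MvPolynomial.pderiv i C.eqn) * q i = 0 →
      C.lineMultiplicity P.rep q = m

/-- The number of Galois points that are smooth points of the curve. -/
def delta : ℕ∞ := {P | C.IsSmoothPoint P ∧ C.IsGaloisPoint P}.encard

/-- The number of Galois points `P` that are smooth points of the curve, with
`I_P(C, T_P C) = 2`. -/
def deltaZero : ℕ∞ :=
  {P | C.IsSmoothPoint P ∧ C.IsGaloisPoint P ∧ C.TangentMultiplicityEq P 2}.encard

/-- The morphism `φ` from the projective line is the normalization of the curve: it maps onto the
curve and is birational, that is, pulling back functions along `φ` is an isomorphism from `K(C)`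
to `K(ℙ¹) = K(t)`. A curve that has such a normalization is a rational curve. -/
def IsNormalization (φ : PLineMorphism K) : Prop :=
  φ.image = C.points ∧
    ∃ e : C.functionField ≃ₐ[K] RatFunc K, ∀ i j, e (C.ratio i j) = φ.ratio i j

end PlaneCurve

/-- Two subsets of the projective plane are projectively equivalent. -/
def ProjectivelyEquivalent {K : Type*} [Field K] (S T : Set (PPlane K)) : Prop :=
  ∃ A : (Fin 3 → K) ≃ₗ[K] (Fin 3 → K),
    Projectivization.map (A : (Fin 3 → K) →ₗ[K] (Fin 3 → K)) A.injective '' S = T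

open MvPolynomial in
/-- The morphism `(s : t) ↦ (s (t + α s)³ : t (t + β s)³ : t (t + s)³)` with
`α = (β² + β + 1) / 3`. -/
def familyMorphism {K : Type*} [Field K] (h3 : (3 : K) ≠ 0) (β : K)
    (hβ : β * (β - 1) * (β ^ 2 + β + 1) ≠ 0) : PLineMorphism K where
  degree := 4
  form := ![X 0 * (X 1 + C ((β ^ 2 + β + 1) / 3) * X 0) ^ 3,
    X 1 * (X 1 + C β * X 0) ^ 3,
    X 1 * (X 1 + X 0) ^ 3]
  homogeneous := by
    have key : ∀ (k : Fin 2) (c : K),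
        (X k * (X 1 + C c * X 0) ^ 3 : MvPolynomial (Fin 2) K).IsHomogeneous 4 := by
      intro k c
      have h : (X 1 + C c * X 0 : MvPolynomial (Fin 2) K).IsHomogeneous 1 :=
        (isHomogeneous_X K 1).add
          (by simpa using (isHomogeneous_C (Fin 2) c).mul (isHomogeneous_X K 0))
      simpa using (isHomogeneous_X K k).mul (h.pow 3)
    intro i
    fin_cases i
    · exact key 0 _
    · exact key 1 _
    · simpa using key 1 1
  no_common_zero := by
    intro v hv
    by_contra! hcon
    obtain ⟨h12, hq⟩ := mul_ne_zero_iff.mp hβ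
    obtain ⟨_, h1⟩ := mul_ne_zero_iff.mp h12
    have e0 := hcon 0
    have e1 := hcon 1
    have e2 := hcon 2
    simp at e0 e1 e2
    apply hv
    have hs : v 0 = 0 := by
      by_contra hs
      by_cases ht : v 1 = 0
      · simp [hs, ht, hq, h3] at e0
      · simp only [ht, false_or] at e1 e2
        exact mul_ne_zero h1 hs (by linear_combination e1 - e2)
    have ht : v 1 = 0 := by simpa [hs] using e2
    funext i
    fin_cases i
    · exact hs
    · exact ht

open MvPolynomial in
/-- The morphism `(s : t) ↦ (s⁴ : t s³ : t (t + s)³)`. -/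
def cuspMorphism (K : Type*) [Field K] : PLineMorphism K where
  degree := 4
  form := ![X 0 ^ 4, X 1 * X 0 ^ 3, X 1 * (X 1 + X 0) ^ 3]
  homogeneous := by
    intro i
    fin_cases i
    · simpa using (isHomogeneous_X K (0 : Fin 2)).pow 4
    · simpa using (isHomogeneous_X K (1 : Fin 2)).mul ((isHomogeneous_X K (0 : Fin 2)).pow 3)
    · simpa using (isHomogeneous_X K (1 : Fin 2)).mul
        (((isHomogeneous_X K (1 : Fin 2)).add (isHomogeneous_X K 0)).pow 3)
  no_common_zero := by
    intro v hv
    by_contra! hcon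
    have e0 := hcon 0
    have e2 := hcon 2
    simp at e0 e2
    apply hv
    have ht : v 1 = 0 := by simpa [e0] using e2
    funext i
    fin_cases i
    · exact e0
    · exact ht

end

/-! Everything is translated into binary quartics. The linear forms pulled back along `φ` make up a
three-dimensional net of quartics in `s, t`, and those vanishing at a point `P` make up a pencil. If
`P` is a smooth point of `C`, projection from `P` has degree 3, so the pencil is a linear form `l`
times a pencil of cubics without common zero. The projection is Galois exactly when this pencil of
cubics is spanned by two cubes `a³, b³`. Indeed a cubic Galois extension has a generator of order
three, which acts on `K(t)` by a Möbius transformation, and in suitable coordinates this multiplies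
a function of degree one by a constant whose cube is 1. Conversely, `K(t)` over the field of the
cube is a Kummer extension. Thus smooth Galois points correspond to pencils `l a³, l b³`
(`exists_hasCubicPencil`, `smooth_and_galois_of_hasCubicPencil`). A local expansion shows that the
tangent line has contact 2 exactly when the zero of `l` is a zero of neither `a` nor `b`
(`tangentMultiplicityEq_two_iff`).

Two pencils in a net have a common member. In coordinates with `l = t` and `l' = s` up to scalars,
comparing coefficients in this relation determines the second pencil from the first. With the first
normalized to `t (t + β s)³, t (t + s)³`, the roots of `β T² - α (β + 1) T + α² = (β T - α)(T - α)`
are the parameters of the second, so `s (t + α s)³` belongs to it (`eq_of_common_member`,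
`exists_family_of_pencils`).

If the differential vanishes at `Q`, then in each pencil one of the two cubes vanishes at `Q`
(`HasCubicPencil.eval_lin_eq_zero_or`). So both pencils contain the cube of the same linear form
`a`. Then `l a³` and `l' a³` lie in the net, hence so does `a⁴`, and the net is that of the cuspidal
quartic.

For the converse directions the explicit parametrization, moved by a projective transformation, has
to be recognized as a normalization. The index of the image of `K(C)` in `K(t)` divides 4
(projection from a point off the curve) and 3 (projection from a point with a pencil of cubes), so
it is 1 (`isNormalization_of_hasCubicPencil`). For the cuspidal quartic, solving for all members `l
a³` of the net leaves only two possible zeros of `l`. -/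

open scoped LinearAlgebra.Projectivization

noncomputable section

/-! ### Binary forms, dehomogenization and linear polynomials -/

namespace BinaryForm

open MvPolynomial

variable {K : Type*} [Field K]

/-- The linear form `ℓ₀ s + ℓ₁ t`. -/
def lin (l : Fin 2 → K) : MvPolynomial (Fin 2) K := C (l 0) * X 0 + C (l 1) * X 1

/-- Dehomogenization, `s = 1`. -/
def dehom : MvPolynomial (Fin 2) K →ₐ[K] Polynomial K := aeval ![1, Polynomial.X]

/-- The determinant of a pair of vectors. -/
def wedge (a b : Fin 2 → K) : K := a 0 * b 1 - a 1 * b 0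

/-- The polynomial `ℓ₀ + ℓ₁ t`. -/
def linPoly (l : Fin 2 → K) : Polynomial K :=
  Polynomial.C (l 0) + Polynomial.C (l 1) * Polynomial.X

@[simp] theorem eval_lin (l v : Fin 2 → K) : eval v (lin l) = l 0 * v 0 + l 1 * v 1 := by
  simp [lin]

@[simp] theorem dehom_lin (l : Fin 2 → K) : dehom (lin l) = linPoly l := by
  simp [lin, linPoly, dehom, Polynomial.C_eq_algebraMap]

theorem isHomogeneous_lin (l : Fin 2 → K) : (lin l).IsHomogeneous 1 :=
  (by simpa using (isHomogeneous_C (Fin 2) (l 0)).mul (isHomogeneous_X K 0) :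
    (C (l 0) * X 0 : MvPolynomial (Fin 2) K).IsHomogeneous 1).add
    (by simpa using (isHomogeneous_C (Fin 2) (l 1)).mul (isHomogeneous_X K 1))

theorem isHomogeneous_lin_mul_cube (l a : Fin 2 → K) :
    (lin l * lin a ^ 3).IsHomogeneous 4 := by
  simpa using (isHomogeneous_lin l).mul ((isHomogeneous_lin a).pow 3)

theorem eval_dehom (f : MvPolynomial (Fin 2) K) (t : K) :
    (dehom f).eval t = eval ![1, t] f := by
  have : (Polynomial.evalRingHom t).comp (dehom (K := K)).toRingHom = eval ![1, t] := by
    apply MvPolynomial.ringHom_ext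
    · intro r; simp [dehom]
    · intro i; fin_cases i <;> simp [dehom]
  exact congrArg (fun g => g f) this

theorem eval_smul_of_isHomogeneous {σ : Type*} {f : MvPolynomial σ K} {n : ℕ}
    (hf : f.IsHomogeneous n) (c : K) (v : σ → K) : eval (c • v) f = c ^ n * eval v f := by
  rw [eval_eq, eval_eq, Finset.mul_sum]
  refine Finset.sum_congr rfl fun d hd => ?_
  have h := hf (mem_support_iff.mp hd)
  simp only [Pi.smul_apply, smul_eq_mul, mul_pow, Finset.prod_mul_distrib]
  rw [Finset.prod_pow_eq_pow_sum]
  have : ∑ i ∈ d.support, d i = n := by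
    rw [← h, Finsupp.weight_apply]; simp [Finsupp.sum]
  rw [this]; ring

theorem eval_eq_of_ne_zero {f : MvPolynomial (Fin 2) K} {n : ℕ} (hf : f.IsHomogeneous n)
    (v : Fin 2 → K) (hv : v 0 ≠ 0) :
    eval v f = v 0 ^ n * (dehom f).eval (v 1 / v 0) := by
  rw [eval_dehom, ← eval_smul_of_isHomogeneous hf]
  congr 2
  funext i
  fin_cases i
  · simp
  · simp; field_simp

theorem natDegree_dehom_le {f : MvPolynomial (Fin 2) K} {n : ℕ} (hf : f.IsHomogeneous n) :
    (dehom f).natDegree ≤ n := by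
  conv_lhs => rw [f.as_sum, map_sum]
  refine Polynomial.natDegree_sum_le_of_forall_le _ _ fun d hd => ?_
  have h := hf (mem_support_iff.mp hd)
  rw [Finsupp.weight_apply, Finsupp.sum_fintype _ _ (by simp), Fin.sum_univ_two] at h
  simp only [dehom, aeval_monomial, Finsupp.prod_fintype _ _ (fun i => pow_zero _),
    Fin.prod_univ_two]
  simp only [Matrix.cons_val_zero, Matrix.cons_val_one, one_pow, one_mul]
  refine (Polynomial.natDegree_C_mul_X_pow_le _ _).trans ?_
  simp at h; omega

/-- Setting `s = 1` sees only the points with `s ≠ 0`. Multiplication by `s` makes both sides vanish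
at the others, and over an infinite field values determine a polynomial. -/
theorem dehom_injective [Infinite K] {f g : MvPolynomial (Fin 2) K} {n : ℕ}
    (hf : f.IsHomogeneous n) (hg : g.IsHomogeneous n) (h : dehom f = dehom g) : f = g := by
  have key : X 0 * f = X 0 * g := by
    apply MvPolynomial.funext
    intro v
    by_cases hv : v 0 = 0
    · simp [hv]
    · simp [eval_eq_of_ne_zero hf v hv, eval_eq_of_ne_zero hg v hv, h]
  exact mul_left_cancel₀ (X_ne_zero 0) key

theorem exists_linPoly_of_natDegree_le {p : Polynomial K} (hp : p.natDegree ≤ 1) :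
    ∃ l : Fin 2 → K, p = linPoly l :=
  ⟨![p.coeff 0, p.coeff 1], by
    conv_lhs => rw [Polynomial.eq_X_add_C_of_natDegree_le_one hp]
    simp [linPoly, add_comm]⟩

theorem natDegree_linPoly_le (l : Fin 2 → K) : (linPoly l).natDegree ≤ 1 := by
  unfold linPoly; compute_degree

theorem linPoly_ne_zero {l : Fin 2 → K} (hl : l ≠ 0) : linPoly l ≠ 0 := by
  intro h
  apply hl
  have h0 := congrArg (fun p => Polynomial.coeff p 0) h
  have h1 := congrArg (fun p => Polynomial.coeff p 1) h
  simp [linPoly, Polynomial.coeff_C] at h0 h1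
  funext i; fin_cases i <;> simp [h0, h1]

theorem isCoprime_linPoly {a b : Fin 2 → K} (h : wedge a b ≠ 0) :
    IsCoprime (linPoly a) (linPoly b) := by
  -- Eliminating `t` by Cramer's rule gives `b₁ · a - a₁ · b = wedge a b`.
  refine ⟨Polynomial.C (b 1 / wedge a b), Polynomial.C (- a 1 / wedge a b), ?_⟩
  have h' : Polynomial.C (wedge a b)⁻¹ * Polynomial.C (a 0 * b 1 - a 1 * b 0) = 1 := by
    rw [← Polynomial.C_mul, show a 0 * b 1 - a 1 * b 0 = wedge a b from rfl,
      inv_mul_cancel₀ h, Polynomial.C_1]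
  rw [← h']
  simp only [linPoly, div_eq_mul_inv, Polynomial.C_mul, Polynomial.C_sub, Polynomial.C_neg]
  ring

theorem left_ne_zero_of_wedge {a b : Fin 2 → K} (h : wedge a b ≠ 0) : a ≠ 0 := by
  rintro rfl; simp [wedge] at h

theorem right_ne_zero_of_wedge {a b : Fin 2 → K} (h : wedge a b ≠ 0) : b ≠ 0 := by
  rintro rfl; simp [wedge] at h

theorem max_natDegree_linPoly {a b : Fin 2 → K} (h : wedge a b ≠ 0) :
    max (linPoly a).natDegree (linPoly b).natDegree = 1 := by
  apply le_antisymm (max_le (natDegree_linPoly_le a) (natDegree_linPoly_le b))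
  by_cases h1 : a 1 = 0
  · have : b 1 ≠ 0 := by rintro hb; simp [wedge, h1, hb] at h
    refine le_max_of_le_right (Polynomial.le_natDegree_of_ne_zero ?_)
    simpa [linPoly, Polynomial.coeff_C]
  · refine le_max_of_le_left (Polynomial.le_natDegree_of_ne_zero ?_)
    simpa [linPoly, Polynomial.coeff_C]

end BinaryForm

/-! ### Pullbacks of linear forms and pencils of cubes -/

namespace PLineMorphism

open MvPolynomial BinaryForm

variable {K : Type*} [Field K] (φ : PLineMorphism K)

/-- The pullback of the linear form `∑ cᵢ xᵢ`. -/
def pull (c : Fin 3 → K) : MvPolynomial (Fin 2) K := ∑ i, C (c i) * φ.form i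

theorem eval_pull (c : Fin 3 → K) (v : Fin 2 → K) :
    eval v (φ.pull c) = ∑ i, c i * φ.evalVec v i := by
  simp [pull, evalVec]

theorem isHomogeneous_pull (c : Fin 3 → K) : (φ.pull c).IsHomogeneous φ.degree := by
  refine IsHomogeneous.sum _ _ _ fun i _ => ?_
  simpa using (isHomogeneous_C (Fin 2) (c i)).mul (φ.homogeneous i)

theorem pull_add (c d : Fin 3 → K) : φ.pull (c + d) = φ.pull c + φ.pull d := by
  simp [pull, add_mul, Finset.sum_add_distrib]

theorem pull_smul (x : K) (c : Fin 3 → K) : φ.pull (x • c) = C x * φ.pull c := by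
  simp [pull, Finset.mul_sum, mul_assoc]

theorem evalVec_smul (x : K) (v : Fin 2 → K) :
    φ.evalVec (x • v) = x ^ φ.degree • φ.evalVec v := by
  funext i
  simp [evalVec, eval_smul_of_isHomogeneous (φ.homogeneous i)]

/-- The linear forms that vanish at `P` pull back to the pencil spanned by `ℓ a³` and `ℓ b³`. -/
def HasCubicPencil (P : PPlane K) (l a b : Fin 2 → K) : Prop :=
  l ≠ 0 ∧ wedge a b ≠ 0 ∧ ∃ c d : Fin 3 → K, LinearIndependent K ![c, d] ∧
    ∑ i, c i * P.rep i = 0 ∧ ∑ i, d i * P.rep i = 0 ∧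
    φ.pull c = lin l * lin a ^ 3 ∧ φ.pull d = lin l * lin b ^ 3

end PLineMorphism

end

/-! ### Simple subfields of `K(t)` and their generators -/

open scoped LinearAlgebra.Projectivization

noncomputable section

namespace RatFunc

open Polynomial _root_.IntermediateField _root_.IntermediateField.algebraAdjoinAdjoin
  BinaryForm

variable {K : Type*} [Field K]

/-- `num` and `denom` are normalized by a scalar, so a coprime representation agrees with them only
up to a common constant. -/
theorem exists_num_denom_div {A B : K[X]} (hB : B ≠ 0) (h : IsCoprime A B) :
    ∃ c : K, c ≠ 0 ∧
      (algebraMap K[X] (RatFunc K) A / algebraMap K[X] (RatFunc K) B).num = Polynomial.C c * A ∧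
      (algebraMap K[X] (RatFunc K) A / algebraMap K[X] (RatFunc K) B).denom =
        Polynomial.C c * B := by
  set f := algebraMap K[X] (RatFunc K) A / algebraMap K[X] (RatFunc K) B
  have hcross : f.num * B = A * f.denom := (num_mul_eq_mul_denom_iff hB).mpr rfl
  obtain ⟨q, hq⟩ : B ∣ f.denom := h.symm.dvd_of_dvd_mul_left ⟨f.num, by rw [← hcross, mul_comm]⟩
  obtain ⟨r, hr⟩ : f.denom ∣ B := denom_div_dvd A B
  have hu : IsUnit q := by
    have : B * (q * r) = B * 1 := by rw [← mul_assoc, ← hq, ← hr, mul_one]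
    exact IsUnit.of_mul_eq_one _ (mul_left_cancel₀ hB this)
  obtain ⟨c, hc, rfl⟩ := Polynomial.isUnit_iff.mp hu
  refine ⟨c, hc.ne_zero, ?_, by rw [hq, mul_comm]⟩
  apply mul_right_cancel₀ hB
  rw [hcross, hq]; ring

theorem finrank_adjoin_div {A B : K[X]} (hB : B ≠ 0) (h : IsCoprime A B) :
    Module.finrank K⟮algebraMap K[X] (RatFunc K) A / algebraMap K[X] (RatFunc K) B⟯ (RatFunc K) =
      max A.natDegree B.natDegree := by
  obtain ⟨c, hc, h1, h2⟩ := exists_num_denom_div hB h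
  rw [finrank_eq_max_natDegree, h1, h2, natDegree_C_mul hc, natDegree_C_mul hc]

/-- The polynomial `num(T) - f · denom(T)` is irreducible over `K(f)` and has the root `X`, so it is
the minimal polynomial up to its leading coefficient. The field `E` is kept apart from `f` in order
to compare two generators of one field. -/
theorem map_minpoly_X {f : RatFunc K} (hf : ¬∃ c, f = C c) {E : IntermediateField K (RatFunc K)}
    (hE : E = K⟮f⟯) : ∃ k : RatFunc K, k ≠ 0 ∧
      f.num.map (algebraMap K (RatFunc K)) -
        Polynomial.C f * f.denom.map (algebraMap K (RatFunc K)) =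
      Polynomial.C k * (minpoly E (X : RatFunc K)).map (algebraMap E (RatFunc K)) := by
  subst hE
  have h := minpoly.eq_of_irreducible (f.irreducible_minpolyX hf) f.minpolyX_aeval_X
  have h0 : (f.minpolyX K⟮f⟯).leadingCoeff ≠ 0 := by
    simpa using (f.irreducible_minpolyX hf).ne_zero
  refine ⟨algebraMap _ _ (f.minpolyX K⟮f⟯).leadingCoeff, by simpa using h0, ?_⟩
  rw [← h, Polynomial.map_mul, map_C, mul_left_comm, ← C_mul, ← map_mul, mul_inv_cancel₀ h0]
  simp only [map_one, mul_one]
  have := f.minpolyX_map K⟮f⟯ (RatFunc K)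
  rw [this, minpolyX]
  congr 2

/-- If `K(A/B) = K(A'/B')`, the pencils spanned by `A, B` and by `A', B'` are equal. -/
theorem mem_span_of_adjoin_eq {A B A' B' : K[X]} (hB : B ≠ 0) (hB' : B' ≠ 0)
    (h : IsCoprime A B) (h' : IsCoprime A' B')
    (hf : ¬∃ c, algebraMap K[X] (RatFunc K) A / algebraMap K[X] (RatFunc K) B = C c)
    (hf' : ¬∃ c, algebraMap K[X] (RatFunc K) A' / algebraMap K[X] (RatFunc K) B' = C c)
    (hE : K⟮algebraMap K[X] (RatFunc K) A / algebraMap K[X] (RatFunc K) B⟯ =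
      K⟮algebraMap K[X] (RatFunc K) A' / algebraMap K[X] (RatFunc K) B'⟯) :
    A ∈ Submodule.span K {A', B'} ∧ B ∈ Submodule.span K {A', B'} := by
  obtain ⟨c, hc, hn, hd⟩ := exists_num_denom_div hB h
  obtain ⟨c', hc', hn', hd'⟩ := exists_num_denom_div hB' h'
  set f := algebraMap K[X] (RatFunc K) A / algebraMap K[X] (RatFunc K) B with hfd
  set f' := algebraMap K[X] (RatFunc K) A' / algebraMap K[X] (RatFunc K) B' with hfd'
  obtain ⟨k, hk, e⟩ := map_minpoly_X hf rfl
  obtain ⟨k', hk', e'⟩ := map_minpoly_X hf' hE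
  -- Both polynomials are multiples of the same minimal polynomial, hence proportional over `K(t)`.
  have key : ∃ m : RatFunc K, ∀ i, algebraMap K (RatFunc K) (A.coeff i) -
      f * algebraMap K (RatFunc K) (B.coeff i) =
      m * (algebraMap K (RatFunc K) (A'.coeff i) - f' * algebraMap K (RatFunc K) (B'.coeff i)) := by
    have hcc : algebraMap K (RatFunc K) c ≠ 0 := by simpa using hc
    refine ⟨k / k' * algebraMap K (RatFunc K) c' / algebraMap K (RatFunc K) c, fun i => ?_⟩
    have e1 := congrArg (fun p => p.coeff i) e
    have e2 := congrArg (fun p => p.coeff i) e'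
    rw [hn, hd] at e1
    rw [hn', hd'] at e2
    simp only [coeff_sub, coeff_C_mul, coeff_map, map_mul] at e1 e2
    field_simp
    linear_combination k' * e1 - k * e2
  obtain ⟨m, hm⟩ := key
  -- Proportionality of the coefficients is carried over to every `K`-linear functional on `K[X]`,
  -- each polynomial being a combination of the powers of `X`.
  have hF : ∀ F : K[X] →ₗ[K] K, algebraMap K (RatFunc K) (F A) -
      f * algebraMap K (RatFunc K) (F B) =
      m * (algebraMap K (RatFunc K) (F A') - f' * algebraMap K (RatFunc K) (F B')) := by
    intro F
    have ex : ∀ p N, p.natDegree < N →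
        algebraMap K (RatFunc K) (F p) = ∑ i ∈ Finset.range N,
          algebraMap K (RatFunc K) (p.coeff i) * algebraMap K (RatFunc K) (F (Polynomial.X ^ i)) := by
      intro p N hp
      conv_lhs => rw [p.as_sum_range' N hp]
      simp only [map_sum, ← map_mul]
      refine Finset.sum_congr rfl fun i _ => ?_
      rw [← C_mul_X_pow_eq_monomial, ← Polynomial.smul_eq_C_mul, map_smul, smul_eq_mul]
    set N := A.natDegree + B.natDegree + A'.natDegree + B'.natDegree + 1 with hN
    rw [ex A N (by omega), ex B N (by omega), ex A' N (by omega), ex B' N (by omega)]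
    simp only [Finset.mul_sum, ← Finset.sum_sub_distrib]
    refine Finset.sum_congr rfl fun i _ => ?_
    linear_combination algebraMap K (RatFunc K) (F (Polynomial.X ^ i)) * hm i
  -- Such a functional satisfies `F A = f · F B` with scalars `F A, F B`. Since `f` is not constant,
  -- both vanish. A polynomial outside the span would be detected by such a functional.
  have hz : ∀ F : K[X] →ₗ[K] K, F A' = 0 → F B' = 0 → F A = 0 ∧ F B = 0 := by
    intro F h1 h2
    have e := hF F
    rw [h1, h2] at e
    simp only [map_zero, mul_zero, sub_zero] at e
    by_cases hFB : F B = 0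
    · refine ⟨?_, hFB⟩
      simpa [hFB] using e
    · exfalso
      apply hf
      refine ⟨F A / F B, ?_⟩
      have : algebraMap K (RatFunc K) (F B) ≠ 0 := by simpa using hFB
      change f = algebraMap K (RatFunc K) _
      rw [map_div₀, eq_div_iff this]
      linear_combination -e
  constructor
  · by_contra hA
    obtain ⟨F, hFA, hle⟩ := Submodule.exists_le_ker_of_notMem hA
    exact hFA (hz F (hle (Submodule.subset_span (by simp)))
      (hle (Submodule.subset_span (by simp)))).1
  · by_contra hA
    obtain ⟨F, hFA, hle⟩ := Submodule.exists_le_ker_of_notMem hA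
    exact hFA (hz F (hle (Submodule.subset_span (by simp)))
      (hle (Submodule.subset_span (by simp)))).2

/-- The rational function `b / a` of degree one. -/
def moebius (a b : Fin 2 → K) : RatFunc K :=
  algebraMap K[X] (RatFunc K) (linPoly b) / algebraMap K[X] (RatFunc K) (linPoly a)

theorem finrank_adjoin_moebius_cube {a b : Fin 2 → K} (h : wedge a b ≠ 0) :
    Module.finrank K⟮moebius a b ^ 3⟯ (RatFunc K) = 3 := by
  have ha : linPoly a ≠ 0 := linPoly_ne_zero (left_ne_zero_of_wedge h)
  rw [moebius, div_pow, ← map_pow, ← map_pow, finrank_adjoin_div (pow_ne_zero 3 ha)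
    ((isCoprime_linPoly h).symm.pow), natDegree_pow, natDegree_pow, max_comm]
  have := max_natDegree_linPoly h
  omega

theorem adjoin_moebius {a b : Fin 2 → K} (h : wedge a b ≠ 0) : K⟮moebius a b⟯ = ⊤ := by
  have ha : linPoly a ≠ 0 := linPoly_ne_zero (left_ne_zero_of_wedge h)
  have h1 : Module.finrank K⟮moebius a b⟯ (RatFunc K) = 1 := by
    rw [moebius, finrank_adjoin_div ha (isCoprime_linPoly h).symm, max_comm,
      max_natDegree_linPoly h]
  have : FiniteDimensional K⟮moebius a b⟯ (RatFunc K) :=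
    Module.finite_of_finrank_pos (by rw [h1]; exact one_pos)
  exact IntermediateField.eq_of_le_of_finrank_le' le_top (by simp [h1])

/-- For a constant `f` the extension `K(t) / K` is infinite, and `finrank` takes its default value
0. -/
theorem not_const_of_finrank {f : RatFunc K} (h : Module.finrank K⟮f⟯ (RatFunc K) ≠ 0) :
    ¬∃ c, f = C c := by
  rintro ⟨c, rfl⟩
  rw [finrank_eq_max_natDegree] at h
  simp at h

end RatFunc

end

/-! ### Cubic Galois subfields of `K(t)` -/

open scoped LinearAlgebra.Projectivization

noncomputable section

namespace RatFunc

open Polynomial _root_.IntermediateField BinaryForm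

variable {K : Type*} [Field K]

/-- Kummer theory: `K` contains the cube roots of unity, `u = b/a` generates `K(t)`, and `T³ - u³`
is separable because `3 ≠ 0`. -/
theorem isGalois_adjoin_moebius_cube [IsAlgClosed K] (h3 : (3 : K) ≠ 0) {a b : Fin 2 → K}
    (h : wedge a b ≠ 0) : IsGalois K⟮moebius a b ^ 3⟯ (RatFunc K) := by
  have ha : linPoly a ≠ 0 := linPoly_ne_zero (left_ne_zero_of_wedge h)
  have hb : linPoly b ≠ 0 := linPoly_ne_zero (right_ne_zero_of_wedge h)
  have hu : moebius a b ≠ 0 := by simp [moebius, ha, hb]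
  have hfr := finrank_adjoin_moebius_cube h
  have hfd : FiniteDimensional K⟮moebius a b ^ 3⟯ (RatFunc K) :=
    Module.finite_of_finrank_pos (by rw [hfr]; norm_num)
  set E := K⟮moebius a b ^ 3⟯ with hE
  have hNZ : NeZero (3 : K) := ⟨h3⟩
  have : NeZero ((3 : ℕ) : K) := ⟨by exact_mod_cast h3⟩
  obtain ⟨ζ, hζ⟩ := HasEnoughRootsOfUnity.exists_primitiveRoot K 3
  have hprim : (primitiveRoots (Module.finrank E (RatFunc K)) E).Nonempty := by
    refine ⟨algebraMap K E ζ, ?_⟩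
    rw [hfr, mem_primitiveRoots (by norm_num)]
    exact hζ.map_of_injective (algebraMap K E).injective
  have htop : E⟮moebius a b⟯ = ⊤ := by
    rw [← restrictScalars_eq_top_iff (K := K), IntermediateField.restrictScalars_adjoin,
      _root_.eq_top_iff, ← adjoin_moebius h]
    exact adjoin.mono _ _ _ (by simp)
  let x : E := ⟨moebius a b ^ 3, mem_adjoin_simple_self K _⟩
  have hx : moebius a b ^ (Module.finrank E (RatFunc K)) = algebraMap E (RatFunc K) x := by
    rw [hfr]; rfl
  have hsplit := isSplittingField_X_pow_sub_C_of_root_adjoin_eq_top hprim hx htop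
  refine IsGalois.of_separable_splitting_field
    (p := Polynomial.X ^ Module.finrank E (RatFunc K) - Polynomial.C x)
    (separable_X_pow_sub_C x ?_ ?_)
  · rw [hfr]
    intro h0
    apply h3
    have : algebraMap K E 3 = 0 := by rw [map_ofNat]; exact_mod_cast h0
    exact (map_eq_zero (algebraMap K E)).mp this
  · intro h0
    have := congrArg (algebraMap E (RatFunc K)) h0
    rw [map_zero] at this
    exact pow_ne_zero 3 hu this

/-- The image of `X` generates `K(t)`, so its numerator and denominator have degree at most one:
automorphisms are Möbius transformations. -/
theorem exists_linPoly_aut (σ : RatFunc K ≃ₐ[K] RatFunc K) :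
    ∃ (n d : Fin 2 → K), linPoly d ≠ 0 ∧
      σ X = algebraMap K[X] (RatFunc K) (linPoly n) / algebraMap K[X] (RatFunc K) (linPoly d) := by
  have htop : K⟮σ X⟯ = ⊤ := by
    have := congrArg (IntermediateField.map σ.toAlgHom) (RatFunc.adjoin_X (K := K))
    rw [adjoin_map] at this
    simp only [Set.image_singleton] at this
    rw [← AlgHom.fieldRange_eq_map] at this
    rw [show K⟮σ X⟯ = K⟮σ.toAlgHom X⟯ from rfl, this]
    exact AlgHom.fieldRange_eq_top.mpr σ.surjective
  have hfr := finrank_eq_max_natDegree (σ X)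
  rw [htop, IntermediateField.finrank_top] at hfr
  obtain ⟨n, hn⟩ := exists_linPoly_of_natDegree_le (K := K) (p := (σ X).num) (by omega)
  obtain ⟨d, hd⟩ := exists_linPoly_of_natDegree_le (K := K) (p := (σ X).denom) (by omega)
  exact ⟨n, d, hd ▸ denom_ne_zero _, by rw [← hn, ← hd, num_div_denom]⟩

/-- An automorphism of order three of `K(t)` multiplies some function of degree one by a constant,
or fixes it. -/
theorem exists_moebius_eigen [IsAlgClosed K] (h3 : (3 : K) ≠ 0) (σ : RatFunc K ≃ₐ[K] RatFunc K)
    (hσ : ∀ f, σ (σ (σ f)) = f) :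
    ∃ a b : Fin 2 → K, wedge a b ≠ 0 ∧ σ (moebius a b ^ 3) = moebius a b ^ 3 := by
  obtain ⟨n, d, hd, hX⟩ := exists_linPoly_aut σ
  set D := algebraMap K[X] (RatFunc K) (linPoly d) with hD
  have hD0 : D ≠ 0 := by simpa [hD] using hd
  -- On linear polynomials `σ` is the linear map `T` followed by division by `D`. The denominator
  -- `D` cancels in quotients, so an eigenvector `a` of `T` makes `σ` affine on the functions `w /
  -- a`.
  let T : (Fin 2 → K) →ₗ[K] (Fin 2 → K) :=
    { toFun := fun u => u 0 • d + u 1 • n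
      map_add' := fun u v => by simp only [Pi.add_apply]; module
      map_smul' := fun c u => by simp only [Pi.smul_apply, smul_eq_mul, RingHom.id_apply]; module }
  let p : (Fin 2 → K) → RatFunc K := fun u => algebraMap K[X] (RatFunc K) (linPoly u)
  have hp : ∀ u, p u = C (u 0) + C (u 1) * X := by
    intro u; simp [p, linPoly]
  have padd : ∀ u v, p (u + v) = p u + p v := by
    intro u v; simp only [hp, Pi.add_apply, map_add]; ring
  have psmul : ∀ c u, p (c • u) = C c * p u := by
    intro c u; simp only [hp, Pi.smul_apply, smul_eq_mul, map_mul]; ring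
  have p0 : ∀ u, u ≠ 0 → p u ≠ 0 := fun u hu => by
    simpa [p] using linPoly_ne_zero hu
  have hσC : ∀ c, σ (C c) = C c := fun c => σ.commutes c
  have hσp : ∀ u, σ (p u) = p (T u) / D := by
    intro u
    rw [hp u, map_add, map_mul, hσC, hσC, hX]
    change _ = p (u 0 • d + u 1 • n) / D
    rw [padd, psmul, psmul]
    change _ = (C (u 0) * D + _ * p n) / D
    field_simp
    rfl
  obtain ⟨lam, hlam⟩ := Module.End.exists_eigenvalue T
  obtain ⟨a, ha⟩ := hlam.exists_hasEigenvector
  have ha0 : a ≠ 0 := ha.2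
  have hTa : T a = lam • a := ha.apply_eq_smul
  have hlam0 : lam ≠ 0 := by
    rintro rfl
    have : σ (p a) = 0 := by rw [hσp, hTa, psmul]; simp
    exact p0 a ha0 (by simpa using this)
  obtain ⟨w, hw⟩ : ∃ w : Fin 2 → K, wedge a w ≠ 0 := by
    by_cases h0 : a 0 = 0
    · refine ⟨![1, 0], ?_⟩
      have h1 : a 1 ≠ 0 := by
        intro h1; apply ha0; funext i; fin_cases i <;> simp [h0, h1]
      simpa [wedge]
    · exact ⟨![0, 1], by simpa [wedge]⟩
  obtain ⟨mu, nu, hTw⟩ : ∃ mu nu : K, T w = mu • w + nu • a := by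
    refine ⟨wedge a (T w) / wedge a w, wedge (T w) w / wedge a w, ?_⟩
    funext i
    simp only [Pi.add_apply, Pi.smul_apply, smul_eq_mul]
    field_simp
    fin_cases i <;> simp [wedge] <;> ring
  set x := mu / lam with hx
  set y := nu / lam with hy
  have pa0 := p0 a ha0
  have hv : ∀ c : K, σ (p (w + c • a) / p a) = C x * (p w / p a) + C (y + c) := by
    intro c
    have hT : T (w + c • a) = mu • w + (nu + c * lam) • a := by
      rw [map_add, map_smul, hTw, hTa]; module
    have hl : C lam ≠ 0 := by simpa using hlam0
    rw [map_div₀, hσp, hσp, hT, hTa, padd, psmul, psmul, psmul, hx, hy]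
    simp only [map_add, map_div₀, map_mul]
    field_simp
  have hv0 : σ (p w / p a) = C x * (p w / p a) + C y := by
    simpa using hv 0
  set v := p w / p a with hvd
  -- The third iterate of the affine map `v ↦ x v + y` is the identity.
  have hcube : C (x ^ 3 - 1) * v + C ((x ^ 2 + x + 1) * y) = 0 := by
    have := hσ v
    rw [hv0, map_add, map_mul, hσC, hσC, hv0, map_add, map_mul, map_add, map_mul, hσC, hσC,
      hv0] at this
    simp only [map_sub, map_pow, map_one, map_mul, map_add]
    linear_combination this
  have hindep : ∀ r s : K, C r * v + C s = 0 → r = 0 ∧ s = 0 := by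
    intro r s hrs
    have h1 : p (r • w + s • a) = 0 := by
      rw [padd, psmul, psmul]
      rw [hvd] at hrs
      field_simp at hrs
      linear_combination hrs
    have h2 : r • w + s • a = 0 := by
      by_contra hne
      exact p0 _ hne h1
    have e0 : r * w 0 + s * a 0 = 0 := by simpa using congrFun h2 0
    have e1 : r * w 1 + s * a 1 = 0 := by simpa using congrFun h2 1
    constructor
    · have : r * wedge a w = 0 := by
        unfold wedge; linear_combination a 0 * e1 - a 1 * e0
      exact (mul_eq_zero.mp this).resolve_right hw
    · have : s * wedge a w = 0 := by
        unfold wedge; linear_combination w 1 * e0 - w 0 * e1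
      exact (mul_eq_zero.mp this).resolve_right hw
  obtain ⟨hx3, hxy⟩ := hindep _ _ hcube
  -- Shifting `v` by `c` removes the translation. If `x = 1`, order three gives `3 y = 0`, so
  -- nothing has to be removed.
  obtain ⟨c, hc⟩ : ∃ c : K, y + c = x * c := by
    by_cases hx1 : x = 1
    · refine ⟨0, ?_⟩
      rw [hx1] at hxy
      have : 3 * y = 0 := by linear_combination hxy
      simpa [h3] using this
    · have hx1' : x - 1 ≠ 0 := sub_ne_zero.mpr hx1
      exact ⟨y / (x - 1), by field_simp; ring⟩
  refine ⟨a, w + c • a, ?_, ?_⟩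
  · have : wedge a (w + c • a) = wedge a w := by simp [wedge]; ring
    rwa [this]
  · have hm : σ (moebius a (w + c • a)) = C x * moebius a (w + c • a) := by
      change σ (p (w + c • a) / p a) = C x * (p (w + c • a) / p a)
      rw [hv, hc, padd, psmul, hvd]
      simp only [map_mul]
      field_simp
    have hx3' : C x ^ 3 = 1 := by
      rw [← map_pow, sub_eq_zero.mp hx3, map_one]
    rw [map_pow, hm, mul_pow, hx3', one_mul]

/-- A Galois extension `K(t) / K(A/B)` of degree three is `K(t) / K((b/a)³)`. -/
theorem exists_cubes_of_isGalois [IsAlgClosed K] (h3 : (3 : K) ≠ 0) {A B : K[X]} (hB : B ≠ 0)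
    (h : IsCoprime A B) (hdeg : max A.natDegree B.natDegree = 3)
    (hG : IsGalois K⟮algebraMap K[X] (RatFunc K) A / algebraMap K[X] (RatFunc K) B⟯ (RatFunc K)) :
    ∃ a b : Fin 2 → K, wedge a b ≠ 0 ∧
      linPoly a ^ 3 ∈ Submodule.span K {A, B} ∧ linPoly b ^ 3 ∈ Submodule.span K {A, B} := by
  have hfr := finrank_adjoin_div hB h
  rw [hdeg] at hfr
  set g := algebraMap K[X] (RatFunc K) A / algebraMap K[X] (RatFunc K) B with hg
  have hfd : FiniteDimensional K⟮g⟯ (RatFunc K) :=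
    Module.finite_of_finrank_pos (by rw [hfr]; norm_num)
  have hcard : Nat.card Gal(RatFunc K/K⟮g⟯) = 3 := by
    rw [IsGalois.card_aut_eq_finrank, hfr]
  have : Fact (Nat.Prime 3) := ⟨Nat.prime_three⟩
  have hcyc : IsCyclic Gal(RatFunc K/K⟮g⟯) := isCyclic_of_prime_card hcard
  obtain ⟨τ, hτ⟩ := hcyc.exists_generator
  have hτ3 : τ ^ 3 = 1 := by rw [← hcard]; exact pow_card_eq_one'
  obtain ⟨a, b, hab, hfix⟩ := exists_moebius_eigen h3 (τ.restrictScalars K) (fun f => by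
    have := congrArg (fun s => s f) hτ3
    simpa [pow_succ] using this)
  -- The cube is fixed by a generator, hence by the whole Galois group. Both fields have index 3, so
  -- the inclusion is an equality.
  have hmem : moebius a b ^ 3 ∈ K⟮g⟯ := by
    have : moebius a b ^ 3 ∈ Set.range (algebraMap K⟮g⟯ (RatFunc K)) := by
      rw [IsGalois.mem_range_algebraMap_iff_fixed]
      intro s
      obtain ⟨k, rfl⟩ := Subgroup.mem_zpowers_iff.mp (hτ s)
      have hst : τ ∈ MulAction.stabilizer Gal(RatFunc K/K⟮g⟯) (moebius a b ^ 3) := hfix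
      exact Subgroup.zpow_mem _ hst k
    obtain ⟨z, hz⟩ := this
    rw [← hz]; exact z.2
  have hfr' := finrank_adjoin_moebius_cube hab
  have hfd' : FiniteDimensional K⟮moebius a b ^ 3⟯ (RatFunc K) :=
    Module.finite_of_finrank_pos (by rw [hfr']; norm_num)
  have hEq : K⟮moebius a b ^ 3⟯ = K⟮g⟯ :=
    IntermediateField.eq_of_le_of_finrank_eq' (adjoin_simple_le_iff.mpr hmem) (by rw [hfr, hfr'])
  have hexp : moebius a b ^ 3 = algebraMap K[X] (RatFunc K) (linPoly b ^ 3) /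
      algebraMap K[X] (RatFunc K) (linPoly a ^ 3) := by
    rw [moebius, div_pow, map_pow, map_pow]
  have ha : linPoly a ≠ 0 := linPoly_ne_zero (left_ne_zero_of_wedge hab)
  rw [hexp] at hEq hfr'
  obtain ⟨h1, h2⟩ := mem_span_of_adjoin_eq (pow_ne_zero 3 ha) hB (isCoprime_linPoly hab).symm.pow h
    (not_const_of_finrank (by rw [hfr']; norm_num)) (not_const_of_finrank (by rw [hfr]; norm_num))
    hEq
  exact ⟨a, b, hab, h2, h1⟩

end RatFunc

end

/-! ### The degree of a projection, read off from the equation -/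

open scoped LinearAlgebra.Projectivization

noncomputable section

section DegreeOfProjection

open MvPolynomial IntermediateField

variable {K : Type*} [Field K]

theorem aeval_mul_of_isHomogeneous {σ A : Type*} [CommRing A] [Algebra K A]
    {f : MvPolynomial σ K} {n : ℕ} (hf : f.IsHomogeneous n) (c : A) (v : σ → A) :
    aeval (fun i => c * v i) f = c ^ n * aeval v f := by
  rw [aeval_def, aeval_def, eval₂_eq, eval₂_eq, Finset.mul_sum]
  refine Finset.sum_congr rfl fun d hd => ?_
  have h := hf (mem_support_iff.mp hd)
  simp only [mul_pow, Finset.prod_mul_distrib]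
  rw [Finset.prod_pow_eq_pow_sum]
  have : ∑ i ∈ d.support, d i = n := by
    rw [← h, Finsupp.weight_apply]; simp [Finsupp.sum]
  rw [this]; ring

theorem aeval_finSuccEquiv {A : Type*} [CommRing A] [Algebra K A] (G : MvPolynomial (Fin 3) K)
    (x : A) (v : Fin 2 → A) :
    ((finSuccEquiv K 2 G).eval₂ (aeval v : MvPolynomial (Fin 2) K →ₐ[K] A).toRingHom x) =
      aeval (Fin.cons x v : Fin 3 → A) G := by
  have : (Polynomial.eval₂RingHom (aeval v : MvPolynomial (Fin 2) K →ₐ[K] A).toRingHom x).comp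
      (finSuccEquiv K 2).toRingEquiv.toRingHom =
      (aeval (Fin.cons x v : Fin 3 → A) : MvPolynomial (Fin 3) K →ₐ[K] A).toRingHom := by
    apply MvPolynomial.ringHom_ext
    · intro r
      simp [finSuccEquiv_apply]
    · intro i
      refine Fin.cases ?_ (fun j => ?_) i
      · simp [finSuccEquiv_X_zero]
      · simp [finSuccEquiv_X_succ]
  exact congrArg (fun g => g G) this

theorem finSuccEquiv_rename_succ (H : MvPolynomial (Fin 2) K) :
    finSuccEquiv K 2 (rename Fin.succ H) = Polynomial.C H := by
  have : (finSuccEquiv K 2).toRingEquiv.toRingHom.comp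
      (rename Fin.succ : MvPolynomial (Fin 2) K →ₐ[K] _).toRingHom = Polynomial.C := by
    apply MvPolynomial.ringHom_ext
    · intro r; simp [finSuccEquiv_apply]
    · intro i; simp [finSuccEquiv_X_succ]
  exact congrArg (fun g => g H) this

variable {F L : Type*} [Field F] [Field L] [Algebra K F] [Algebra K L]

/-- Let `(x : y : z)` be a generic point of the plane curve `G = 0`. The function field is of
degree `deg_X G` over the field generated by `y / z`. -/
theorem finrank_adjoin_eq_natDegree (i : F →ₐ[K] L) {v w : F} {x y z : L} (hz : z ≠ 0)
    (hv : i v * z = y) (hw : i w * z = x) (htop : K⟮v⟯⟮w⟯ = ⊤)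
    {G : MvPolynomial (Fin 3) K} {d : ℕ} (hG : G.IsHomogeneous d) (hirr : Irreducible G)
    (hker : ∀ H : MvPolynomial (Fin 3) K, aeval ![x, y, z] H = 0 ↔ G ∣ H)
    (hn : 0 < (finSuccEquiv K 2 G).natDegree) :
    Module.finrank K⟮v⟯ F = (finSuccEquiv K 2 G).natDegree := by
  set G' := finSuccEquiv K 2 G with hG'
  set n := G'.natDegree with hnd
  have hirr' : Irreducible G' := (MulEquiv.irreducible_iff (finSuccEquiv K 2)).mpr hirr
  let j : MvPolynomial (Fin 2) K →ₐ[K] L := aeval ![y, z]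
  -- `y` and `z` are algebraically independent: a relation between them would be a multiple of `G`,
  -- which has positive degree in the first variable.
  have hj : Function.Injective j := by
    rw [injective_iff_map_eq_zero]
    intro H hH
    have h1 : aeval ![x, y, z] (rename Fin.succ H) = 0 := by
      rw [aeval_rename]; exact hH
    have h2 : G' ∣ Polynomial.C H := by
      rw [← finSuccEquiv_rename_succ H]
      exact map_dvd _ ((hker _).mp h1)
    by_contra hne
    have := Polynomial.natDegree_le_of_dvd h2 (by simpa using hne)
    simp at this
    omega
  have hj' : Function.Injective j.toRingHom := hj
  let J : FractionRing (MvPolynomial (Fin 2) K) →+* L := IsFractionRing.lift hj'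
  have hJ : ∀ s, J (algebraMap _ _ s) = j s := fun s => IsFractionRing.lift_algebraMap hj' s
  have hGx : G'.eval₂ j.toRingHom x = 0 := by
    rw [hG', aeval_finSuccEquiv]
    exact (hker G).mpr dvd_rfl
  -- an upper bound
  let y' : K⟮v⟯ := ⟨v, mem_adjoin_simple_self K v⟩
  let θ : MvPolynomial (Fin 2) K →ₐ[K] K⟮v⟯ := aeval ![y', 1]
  have hθ : ∀ (s : MvPolynomial (Fin 2) K) (k : ℕ), s.IsHomogeneous k →
      z ^ k * i (algebraMap K⟮v⟯ F (θ s)) = j s := by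
    intro s k hs
    let ψ : K⟮v⟯ →ₐ[K] L := i.comp (IsScalarTower.toAlgHom K K⟮v⟯ F)
    have h1 : i (algebraMap K⟮v⟯ F (θ s)) = aeval (fun k => ψ (![y', 1] k)) s := by
      change ψ (aeval _ s) = _
      rw [← AlgHom.comp_apply, MvPolynomial.comp_aeval]
    rw [h1, ← aeval_mul_of_isHomogeneous hs]
    congr 2
    funext k
    fin_cases k
    · simp only [← hv]; exact mul_comm _ _
    · change z * ψ 1 = z; simp
  -- On forms, `θ` agrees with the injective `j` up to a power of `z`. So specializing `(y, z)` to
  -- `(v, 1)` keeps the leading coefficient.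
  have hlead : θ (G'.coeff n) ≠ 0 := by
    intro h0
    have hnd' : n ≤ d := by
      rw [hnd, hG', natDegree_finSuccEquiv]
      exact (degreeOf_le_totalDegree _ _).trans hG.totalDegree_le
    have := hθ _ _ (hG.finSuccEquiv_coeff_isHomogeneous n (d - n) (by omega))
    rw [h0] at this
    simp only [map_zero, mul_zero] at this
    have hc : G'.coeff n = 0 := hj (by rw [map_zero]; exact this.symm)
    exact hirr'.ne_zero (Polynomial.leadingCoeff_eq_zero.mp hc)
  have hmw : Polynomial.aeval w (G'.map θ.toRingHom) = 0 := by
    have h1 : i (Polynomial.aeval w (G'.map θ.toRingHom)) =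
        aeval (Fin.cons (i w) ![i v, 1] : Fin 3 → L) G := by
      rw [Polynomial.aeval_def, Polynomial.eval₂_map, ← aeval_finSuccEquiv, ← hG']
      change i.toRingHom _ = _
      rw [Polynomial.hom_eval₂]
      congr 1
      apply MvPolynomial.ringHom_ext
      · intro r
        simp only [RingHom.comp_apply, AlgHom.toRingHom_eq_coe, RingHom.coe_coe, algHom_C]
        rw [← IsScalarTower.algebraMap_apply, AlgHom.commutes]
      · intro k
        fin_cases k
        · simp [θ, y']
        · simp [θ]
    refine (map_eq_zero i).mp ?_
    rw [h1]
    have h2 := aeval_mul_of_isHomogeneous hG z (Fin.cons (i w) ![i v, 1] : Fin 3 → L)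
    have h3 : (fun k => z * (Fin.cons (i w) ![i v, 1] : Fin 3 → L) k) = ![x, y, z] := by
      funext k
      fin_cases k
      · simp [← hw, mul_comm]
      · simp [← hv, mul_comm]
      · simp
    rw [h3, (hker G).mpr dvd_rfl] at h2
    exact (mul_eq_zero.mp h2.symm).resolve_left (pow_ne_zero _ hz)
  have hne : G'.map θ.toRingHom ≠ 0 := by
    intro h0
    apply hlead
    have := congrArg (fun p => Polynomial.coeff p n) h0
    simpa using this
  have hint : IsIntegral K⟮v⟯ w := IsAlgebraic.isIntegral ⟨_, hne, hmw⟩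
  have hup : (minpoly K⟮v⟯ w).natDegree ≤ n := by
    refine (Polynomial.natDegree_le_of_dvd (minpoly.dvd _ _ hmw) hne).trans ?_
    exact Polynomial.natDegree_map_le
  -- a lower bound
  have hrange : ∀ s : K⟮v⟯, ∃ r, J r = i (algebraMap K⟮v⟯ F s) := by
    have hle : K⟮v⟯ ≤ (IntermediateField.comap i
        (⟨⟨J.fieldRange.toSubring.toSubsemiring, fun k => ⟨algebraMap _ _ (C k), by
          rw [hJ]; simp [j]⟩⟩, J.fieldRange.inv_mem'⟩ : IntermediateField K L)) := by
      rw [adjoin_simple_le_iff]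
      let a : Fin 2 → FractionRing (MvPolynomial (Fin 2) K) := fun k =>
        algebraMap (MvPolynomial (Fin 2) K) _ (X k)
      refine ⟨a 0 / a 1, ?_⟩
      rw [map_div₀, hJ, hJ]
      simp only [j, aeval_X]
      change y / z = i v
      rw [← hv]; field_simp
    intro s
    exact hle s.2
  have hlow : n ≤ (minpoly K⟮v⟯ w).natDegree := by
    set m := minpoly K⟮v⟯ w with hm
    have hmon : m.Monic := minpoly.monic hint
    let ψ : K⟮v⟯ →+* L := i.toRingHom.comp (algebraMap K⟮v⟯ F)
    have hlift : m.map ψ ∈ Polynomial.lifts J := by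
      rw [Polynomial.lifts_iff_coeff_lifts]
      intro k
      rw [Polynomial.coeff_map]
      exact hrange _
    obtain ⟨q, hq, hqd, hqm⟩ := Polynomial.lifts_and_natDegree_eq_and_monic hlift (hmon.map ψ)
    have hq0 : q.eval₂ J (i w) = 0 := by
      rw [← Polynomial.eval_map, hq, Polynomial.eval_map]
      change m.eval₂ (i.toRingHom.comp _) (i.toRingHom w) = 0
      rw [← Polynomial.hom_eval₂]
      have : Polynomial.eval₂ (algebraMap K⟮v⟯ F) w m = 0 := minpoly.aeval _ _
      rw [this, map_zero]
    have hJz : J (algebraMap (MvPolynomial (Fin 2) K) _ (X 1)) = z := by rw [hJ]; simp [j]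
    -- Scaling the roots by `z` replaces the root `w = x / z` by `x`.
    have hs := Polynomial.scaleRoots_eval₂_eq_zero (s := algebraMap (MvPolynomial (Fin 2) K) _ (X 1)) J hq0
    rw [hJz, mul_comm, hw] at hs
    set s := q.scaleRoots (algebraMap (MvPolynomial (Fin 2) K) _ (X 1))
    -- By Gauss's lemma `G'` stays irreducible over `K(y, z)`. As it has a common root with `s`, it
    -- divides `s`.
    have hprim : G'.IsPrimitive := hirr'.isPrimitive (by omega)
    have hirrF := (hprim.irreducible_iff_irreducible_map_fraction_map
      (K := FractionRing (MvPolynomial (Fin 2) K))).mp hirr'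
    have hGF : (G'.map (algebraMap _ (FractionRing (MvPolynomial (Fin 2) K)))).eval₂ J x = 0 := by
      rw [Polynomial.eval₂_map, ← hGx]
      congr 1
      ext s <;> simp [hJ]
    have hdvd : G'.map (algebraMap _ (FractionRing (MvPolynomial (Fin 2) K))) ∣ s := by
      rcases (EuclideanDomain.dvd_or_coprime _ s hirrF).symm with h | h
      · exfalso
        obtain ⟨a, b, hab⟩ := h
        have := congrArg (Polynomial.eval₂ J x) hab
        rw [Polynomial.eval₂_add, Polynomial.eval₂_mul, Polynomial.eval₂_mul, hGF, hs] at this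
        simp at this
      · exact h
    have hsm : s.Monic := (Polynomial.monic_scaleRoots_iff _).mpr hqm
    have h1 := Polynomial.natDegree_le_of_dvd hdvd hsm.ne_zero
    rw [Polynomial.natDegree_map_eq_of_injective (IsFractionRing.injective _ _),
      Polynomial.natDegree_scaleRoots, hqd, Polynomial.natDegree_map] at h1
    exact h1
  rw [← IntermediateField.finrank_top' (F := K⟮v⟯) (E := F), ← htop, adjoin.finrank hint]
  exact le_antisymm hup hlow

end DegreeOfProjection

end

/-! ### Frames of the plane and linear substitutions -/

open scoped LinearAlgebra.Projectivization

noncomputable section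

open MvPolynomial BinaryForm

variable {K : Type*} [Field K]

theorem Projectivization.exists_rep_eq_smul {ι : Type*} {v : ι → K} (hv : v ≠ 0) :
    ∃ c : K, c ≠ 0 ∧ (Projectivization.mk K v hv).rep = c • v := by
  obtain ⟨a, ha⟩ := Projectivization.exists_smul_eq_mk_rep K v hv
  exact ⟨a, a.ne_zero, ha.symm⟩

namespace PLineMorphism

variable (φ : PLineMorphism K)

theorem toFun_mk {v : Fin 2 → K} (hv : v ≠ 0) :
    φ.toFun (Projectivization.mk K v hv) =
      Projectivization.mk K (φ.evalVec v) (φ.evalVec_ne_zero hv) := by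
  obtain ⟨c, hc, h⟩ := Projectivization.exists_rep_eq_smul hv
  unfold toFun
  rw [Projectivization.mk_eq_mk_iff']
  exact ⟨c ^ φ.degree, by rw [h, evalVec_smul]⟩

theorem mk_mem_image {v : Fin 2 → K} (hv : v ≠ 0) :
    Projectivization.mk K (φ.evalVec v) (φ.evalVec_ne_zero hv) ∈ φ.image :=
  ⟨_, φ.toFun_mk hv⟩

end PLineMorphism

namespace PlaneCurve

variable (C : PlaneCurve K)

theorem mk_mem_points {v : Fin 3 → K} (hv : v ≠ 0) :
    Projectivization.mk K v hv ∈ C.points ↔ eval v C.eqn = 0 := by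
  obtain ⟨c, hc, h⟩ := Projectivization.exists_rep_eq_smul hv
  change eval (Projectivization.mk K v hv).rep C.eqn = 0 ↔ _
  rw [h, eval_smul_of_isHomogeneous C.homogeneous]
  simp [hc]

theorem exists_notMem_points [Infinite K] (hC : C.degree ≠ 0) : ∃ P, P ∉ C.points := by
  obtain ⟨v, hv⟩ : ∃ v, eval v C.eqn ≠ 0 := by
    by_contra! h
    exact C.irreducible.ne_zero (MvPolynomial.funext fun v => by simpa using h v)
  have hv0 : v ≠ 0 := by
    rintro rfl
    apply hv
    have := eval_smul_of_isHomogeneous C.homogeneous (0 : K) 0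
    rwa [zero_smul, zero_pow hC, zero_mul] at this
  exact ⟨Projectivization.mk K v hv0, by rwa [mk_mem_points]⟩

end PlaneCurve

/-- Two functionals that span the annihilator of `p` are part of a frame. -/
theorem exists_frame {p c d : Fin 3 → K} (hp : p ≠ 0) (hcd : LinearIndependent K ![c, d])
    (hc : ∑ i, c i * p i = 0) (hd : ∑ i, d i * p i = 0) :
    ∃ N M : Matrix (Fin 3) (Fin 3) K, N * M = 1 ∧ M * N = 1 ∧ (∀ i, M i 0 = p i) ∧
      N 1 = c ∧ N 2 = d := by
  obtain ⟨k, hk⟩ : ∃ k, p k ≠ 0 := by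
    by_contra! h
    exact hp (funext h)
  -- A functional with value 1 at `p` is independent of `c` and `d`. The first column of the inverse
  -- of the matrix with rows `e, c, d` is then `p`.
  let e : Fin 3 → K := Pi.single k (p k)⁻¹
  have he : ∑ i, e i * p i = 1 := by
    rw [Finset.sum_eq_single k]
    · simp [e, hk]
    · intro b _ hb; simp [e, hb]
    · simp
  let N : Matrix (Fin 3) (Fin 3) K := Matrix.of ![e, c, d]
  have hli : LinearIndependent K (fun i => N i) := by
    change LinearIndependent K (![e, c, d])
    refine linearIndependent_finCons.mpr ⟨hcd, fun hmem => ?_⟩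
    have hle : Submodule.span K (Set.range ![c, d]) ≤ LinearMap.ker
        (Fintype.linearCombination K p) := by
      rw [Submodule.span_le]
      rintro _ ⟨i, rfl⟩
      fin_cases i
      · simpa [Fintype.linearCombination_apply] using hc
      · simpa [Fintype.linearCombination_apply] using hd
    have := hle hmem
    rw [LinearMap.mem_ker, Fintype.linearCombination_apply] at this
    simp only [smul_eq_mul] at this
    rw [he] at this
    exact one_ne_zero this
  have hu : IsUnit N := Matrix.linearIndependent_rows_iff_isUnit.mp hli
  have hdet : IsUnit N.det := (Matrix.isUnit_iff_isUnit_det N).mp hu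
  have hNp : N.mulVec p = Pi.single 0 1 := by
    funext i
    fin_cases i
    · simpa [N, Matrix.mulVec, dotProduct] using he
    · simpa [N, Matrix.mulVec, dotProduct] using hc
    · simpa [N, Matrix.mulVec, dotProduct] using hd
  refine ⟨N, N⁻¹, Matrix.mul_nonsing_inv N hdet, Matrix.nonsing_inv_mul N hdet, fun i => ?_, rfl,
    rfl⟩
  have : p = N⁻¹.mulVec (Pi.single 0 1) := by
    rw [← hNp, Matrix.mulVec_mulVec, Matrix.nonsing_inv_mul N hdet, Matrix.one_mulVec]
  conv_rhs => rw [this]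
  simp

theorem exists_annihilators {p : Fin 3 → K} (hp : p ≠ 0) :
    ∃ c d : Fin 3 → K, LinearIndependent K ![c, d] ∧ ∑ i, c i * p i = 0 ∧ ∑ i, d i * p i = 0 := by
  obtain ⟨k, hk⟩ : ∃ k, p k ≠ 0 := by
    by_contra! h
    exact hp (funext h)
  simp only [LinearIndependent.pair_iff, Fin.sum_univ_three]
  fin_cases k
  · refine ⟨![-p 1, p 0, 0], ![-p 2, 0, p 0], fun s t h => ?_, by simp; ring, by simp; ring⟩
    have h1 := congrFun h 1
    have h2 := congrFun h 2
    simp at hk h1 h2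
    exact ⟨by simpa [hk] using h1, by simpa [hk] using h2⟩
  · refine ⟨![p 1, -p 0, 0], ![0, -p 2, p 1], fun s t h => ?_, by simp; ring, by simp; ring⟩
    have h1 := congrFun h 0
    have h2 := congrFun h 2
    simp at hk h1 h2
    exact ⟨by simpa [hk] using h1, by simpa [hk] using h2⟩
  · refine ⟨![p 2, 0, -p 0], ![0, p 2, -p 1], fun s t h => ?_, by simp; ring, by simp; ring⟩
    have h1 := congrFun h 0
    have h2 := congrFun h 1
    simp at hk h1 h2
    exact ⟨by simpa [hk] using h1, by simpa [hk] using h2⟩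

/-- The linear substitution with matrix `M`. -/
def linSubst (M : Matrix (Fin 3) (Fin 3) K) : MvPolynomial (Fin 3) K →ₐ[K] MvPolynomial (Fin 3) K :=
  aeval fun i => ∑ j, C (M i j) * X j

theorem aeval_linSubst {A : Type*} [CommRing A] [Algebra K A] (M : Matrix (Fin 3) (Fin 3) K)
    (v : Fin 3 → A) (H : MvPolynomial (Fin 3) K) :
    aeval v (linSubst M H) = aeval (fun i => ∑ j, algebraMap K A (M i j) * v j) H := by
  unfold linSubst
  rw [← AlgHom.comp_apply, comp_aeval]
  congr 2
  funext i
  simp [algHom_C]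

theorem linSubst_linSubst {M N : Matrix (Fin 3) (Fin 3) K} (h : M * N = 1)
    (H : MvPolynomial (Fin 3) K) : linSubst N (linSubst M H) = H := by
  conv_lhs => rw [linSubst]
  rw [aeval_linSubst]
  conv_rhs => rw [← aeval_X_left_apply H]
  congr 2
  funext i
  have : ∀ k, (M * N) i k = if i = k then 1 else 0 := by
    intro k; rw [h, Matrix.one_apply]
  simp only [Finset.mul_sum]
  rw [Finset.sum_comm]
  have h2 : ∀ k, ∑ j, algebraMap K (MvPolynomial (Fin 3) K) (M i j) * (C (N j k) * X k) =
      C ((M * N) i k) * X k := by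
    intro k
    rw [Matrix.mul_apply, map_sum, Finset.sum_mul]
    refine Finset.sum_congr rfl fun j _ => ?_
    rw [algebraMap_eq, map_mul, mul_assoc]
  simp only [h2, this]
  simp

theorem isHomogeneous_linSubst (M : Matrix (Fin 3) (Fin 3) K) {H : MvPolynomial (Fin 3) K} {n : ℕ}
    (hH : H.IsHomogeneous n) : (linSubst M H).IsHomogeneous n := by
  have := hH.aeval (fun i => ∑ j, C (M i j) * X j) (n := 1) (fun i =>
    IsHomogeneous.sum _ _ _ fun j _ => by
      simpa using (isHomogeneous_C (Fin 3) (M i j)).mul (isHomogeneous_X K j))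
  simpa [linSubst] using this

theorem irreducible_linSubst {M N : Matrix (Fin 3) (Fin 3) K} (h : M * N = 1) (h' : N * M = 1)
    {H : MvPolynomial (Fin 3) K} (hH : Irreducible H) : Irreducible (linSubst M H) := by
  let e : MvPolynomial (Fin 3) K ≃ₐ[K] MvPolynomial (Fin 3) K :=
    AlgEquiv.ofAlgHom (linSubst M) (linSubst N)
      (AlgHom.ext fun H => linSubst_linSubst h' H) (AlgHom.ext fun H => linSubst_linSubst h H)
  exact (MulEquiv.irreducible_iff e).mpr hH

/-- A homogeneous quartic is expanded in powers of the first variable. -/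
theorem aeval_eq_sum_coeff {A : Type*} [CommRing A] [Algebra K A] {G : MvPolynomial (Fin 3) K}
    (hG : G.IsHomogeneous 4) (x : A) (v : Fin 2 → A) :
    aeval (Fin.cons x v : Fin 3 → A) G = ∑ k ∈ Finset.range 5,
      aeval v ((finSuccEquiv K 2 G).coeff k) * x ^ k := by
  rw [← aeval_finSuccEquiv, Polynomial.eval₂_eq_sum_range' _ (n := 5)]
  · rfl
  · rw [natDegree_finSuccEquiv]
    have := (degreeOf_le_totalDegree G 0).trans hG.totalDegree_le
    omega

theorem natDegree_finSuccEquiv_le {G : MvPolynomial (Fin 3) K} (hG : G.IsHomogeneous 4) :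
    (finSuccEquiv K 2 G).natDegree ≤ 4 := by
  rw [natDegree_finSuccEquiv]
  exact (degreeOf_le_totalDegree G 0).trans hG.totalDegree_le

/-- First-order Taylor expansion along `p + u q`. The two coefficients are treated in one induction
because the product rule for the linear one needs the constant one. -/
theorem coeff_one_aeval_line {σ : Type*} [Fintype σ] (F : MvPolynomial σ K) (p q : σ → K) :
    (aeval (fun i => Polynomial.C (p i) + Polynomial.X * Polynomial.C (q i)) F :
      Polynomial K).coeff 1 = ∑ i, eval p (pderiv i F) * q i ∧
    (aeval (fun i => Polynomial.C (p i) + Polynomial.X * Polynomial.C (q i)) F :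
      Polynomial K).coeff 0 = eval p F := by
  classical
  induction F using MvPolynomial.induction_on with
  | C a => simp [algHom_C, Polynomial.coeff_C]
  | add f g hf hg =>
    simp only [map_add, Polynomial.coeff_add, hf.1, hg.1, hf.2, hg.2, add_mul,
      Finset.sum_add_distrib, and_self]
  | mul_X f i hf =>
    simp only [map_mul, aeval_X, mul_add, Polynomial.coeff_add, Polynomial.coeff_mul_C,
      eval_X, Derivation.leibniz, pderiv_X, map_add, smul_eq_mul, add_mul,
      Finset.sum_add_distrib]
    constructor
    · rw [← mul_assoc, Polynomial.coeff_mul_C, Polynomial.coeff_mul_X, hf.1, hf.2]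
      rw [add_comm, Finset.sum_mul]
      congr 1
      · rw [Finset.sum_eq_single i]
        · simp
        · intro b _ hb; simp [Pi.single_eq_of_ne hb.symm]
        · simp
      · exact Finset.sum_congr rfl fun j _ => by ring
    · rw [← mul_assoc, Polynomial.coeff_mul_C, Polynomial.coeff_mul_X_zero, hf.2]
      simp

end

/-! ### The equation of the curve in a frame: multiplicity and tangent line -/

open scoped LinearAlgebra.Projectivization

noncomputable section

open MvPolynomial BinaryForm

variable {K : Type*} [Field K]

namespace PlaneCurve

variable (C : PlaneCurve K)

theorem aeval_coord (H : MvPolynomial (Fin 3) K) :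
    aeval C.coord H =
      algebraMap C.coordRing (FractionRing C.coordRing) (Ideal.Quotient.mk _ H) := by
  have : (aeval C.coord : MvPolynomial (Fin 3) K →ₐ[K] FractionRing C.coordRing).toRingHom =
      (algebraMap C.coordRing (FractionRing C.coordRing)).comp (Ideal.Quotient.mk _) := by
    apply MvPolynomial.ringHom_ext
    · intro r
      simp only [AlgHom.toRingHom_eq_coe, RingHom.coe_coe, algHom_C, RingHom.comp_apply]
      rw [IsScalarTower.algebraMap_apply K C.coordRing (FractionRing C.coordRing)]
      rfl
    · intro i; simp [coord]
  exact congrArg (fun g => g H) this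

theorem aeval_coord_eq_zero_iff (H : MvPolynomial (Fin 3) K) :
    aeval C.coord H = 0 ↔ C.eqn ∣ H := by
  rw [aeval_coord, map_eq_zero_iff _ (IsFractionRing.injective _ _), Ideal.Quotient.eq_zero_iff_mem,
    Ideal.mem_span_singleton]

theorem linForm_eq_sum (c : Fin 3 → K) :
    C.linForm c = ∑ i, algebraMap K (FractionRing C.coordRing) (c i) * C.coord i := by
  rw [linForm, ← aeval_coord]
  simp [algHom_C]

variable {C}

theorem not_dvd_linear (hC : C.degree = 4) {c : Fin 3 → K} (hc : c ≠ 0) :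
    ¬ C.eqn ∣ ∑ i, MvPolynomial.C (c i) * X i := by
  intro h
  have hne : (∑ i, MvPolynomial.C (c i) * X i : MvPolynomial (Fin 3) K) ≠ 0 := by
    intro h0
    apply hc
    funext k
    have := congrArg (eval (Pi.single k 1 : Fin 3 → K)) h0
    simpa [Pi.single_apply] using this
  have h1 : (∑ i, MvPolynomial.C (c i) * X i : MvPolynomial (Fin 3) K).totalDegree ≤ 1 := by
    refine (totalDegree_finsetSum _ _).trans (Finset.sup_le fun i _ => ?_)
    refine (totalDegree_mul _ _).trans ?_
    simp
  have h2 := totalDegree_le_of_dvd_of_isDomain h hne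
  rw [C.homogeneous.totalDegree C.irreducible.ne_zero, hC] at h2
  omega

theorem linForm_ne_zero (hC : C.degree = 4) {c : Fin 3 → K} (hc : c ≠ 0) : C.linForm c ≠ 0 := by
  intro h
  apply not_dvd_linear hC hc
  rw [← aeval_coord_eq_zero_iff, aeval_coord]
  exact h

theorem linForm_single (i : Fin 3) : C.linForm (Pi.single i 1) = C.coord i := by
  rw [linForm_eq_sum, Finset.sum_eq_single i]
  · simp
  · intro b _ hb; simp [hb]
  · simp

theorem coord_ne_zero (hC : C.degree = 4) (i : Fin 3) : C.coord i ≠ 0 := by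
  rw [← linForm_single]
  exact linForm_ne_zero hC (by simp)

theorem coord_eq_sum_linForm {N M : Matrix (Fin 3) (Fin 3) K} (h : M * N = 1) (i : Fin 3) :
    C.coord i = ∑ j, algebraMap K (FractionRing C.coordRing) (M i j) * C.linForm (N j) := by
  simp only [linForm_eq_sum, Finset.mul_sum]
  rw [Finset.sum_comm]
  have : ∀ k, ∑ j, algebraMap K (FractionRing C.coordRing) (M i j) *
      (algebraMap K (FractionRing C.coordRing) (N j k) * C.coord k) =
      algebraMap K (FractionRing C.coordRing) ((M * N) i k) * C.coord k := by
    intro k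
    rw [Matrix.mul_apply, map_sum, Finset.sum_mul]
    exact Finset.sum_congr rfl fun j _ => by rw [map_mul, mul_assoc]
  simp only [this, h, Matrix.one_apply]
  simp

/-- The relations between the frame coordinates on the curve are the multiples of the substituted
equation. This is the kernel hypothesis of `finrank_adjoin_eq_natDegree`. -/
theorem aeval_linForm_eq_zero_iff {N M : Matrix (Fin 3) (Fin 3) K} (h : M * N = 1) (h' : N * M = 1)
    (H : MvPolynomial (Fin 3) K) :
    aeval ![C.linForm (N 0), C.linForm (N 1), C.linForm (N 2)] H = 0 ↔
      linSubst M C.eqn ∣ H := by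
  have h1 : aeval ![C.linForm (N 0), C.linForm (N 1), C.linForm (N 2)] H =
      aeval C.coord (linSubst N H) := by
    rw [aeval_linSubst]
    congr 2
    funext i
    rw [← linForm_eq_sum]
    fin_cases i <;> rfl
  rw [h1, aeval_coord_eq_zero_iff]
  constructor
  · intro hd
    have := map_dvd (linSubst M) hd
    rwa [linSubst_linSubst h'] at this
  · intro hd
    have := map_dvd (linSubst N) hd
    rwa [linSubst_linSubst h] at this

variable (C)

/-- The equation of the curve in the frame `M` is `∑ₖ x₀ᵏ · layer k (x₁, x₂)`. -/
def layer (M : Matrix (Fin 3) (Fin 3) K) (k : ℕ) : MvPolynomial (Fin 2) K :=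
  (finSuccEquiv K 2 (linSubst M C.eqn)).coeff k

variable {C}

theorem isHomogeneous_layer (hC : C.degree = 4) (M : Matrix (Fin 3) (Fin 3) K) {j k : ℕ}
    (h : k + j = 4) : (C.layer M k).IsHomogeneous j :=
  (isHomogeneous_linSubst M (hC ▸ C.homogeneous)).finSuccEquiv_coeff_isHomogeneous k j h

/-- At the frame point `(1 : 0 : 0)` the lower layers vanish, being forms of positive degree in the
other two coordinates. The top layer is the value of the equation there. -/
theorem layer_four (hC : C.degree = 4) {M : Matrix (Fin 3) (Fin 3) K} {p : Fin 3 → K}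
    (hp : ∀ i, M i 0 = p i) : C.layer M 4 = MvPolynomial.C (eval p C.eqn) := by
  have h0 : C.layer M 4 = MvPolynomial.C ((C.layer M 4).coeff 0) := by
    have := isHomogeneous_layer hC M (j := 0) (k := 4) rfl
    rw [← totalDegree_eq_zero_iff_eq_C]
    exact Nat.le_zero.mp this.totalDegree_le
  rw [h0]
  congr 1
  have h1 := aeval_eq_sum_coeff (isHomogeneous_linSubst M (hC ▸ C.homogeneous)) (1 : K) 0
  have hz : ∀ k < 4, aeval (0 : Fin 2 → K) (C.layer M k) = 0 := by
    intro k hk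
    have := aeval_mul_of_isHomogeneous (isHomogeneous_layer hC M (j := 4 - k) (k := k) (by omega))
      (0 : K) (0 : Fin 2 → K)
    rw [zero_pow (by omega), zero_mul] at this
    simpa using this
  simp only [Finset.sum_range_succ, Finset.sum_range_zero, one_pow, mul_one] at h1
  change _ = 0 + aeval 0 (C.layer M 0) + aeval 0 (C.layer M 1) + aeval 0 (C.layer M 2) +
    aeval 0 (C.layer M 3) + aeval 0 (C.layer M 4) at h1
  rw [hz 0 (by norm_num), hz 1 (by norm_num), hz 2 (by norm_num), hz 3 (by norm_num),
    aeval_linSubst, h0] at h1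
  simp only [algHom_C] at h1
  have h2 : (fun i => ∑ j, algebraMap K K (M i j) * (Fin.cons 1 0 : Fin 3 → K) j) = p := by
    funext i
    rw [← hp i, Fin.sum_univ_succ]
    simp
  rw [h2] at h1
  simpa [coe_aeval_eq_eval] using h1.symm

/-- The restriction of the equation of the curve to a curve through the frame point. -/
theorem aeval_frame (hC : C.degree = 4) (M : Matrix (Fin 3) (Fin 3) K) {A : Type*} [CommRing A]
    [Algebra K A] (x y z : A) :
    aeval (fun i => algebraMap K A (M i 0) * x + algebraMap K A (M i 1) * y +
      algebraMap K A (M i 2) * z) C.eqn =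
    aeval ![y, z] (C.layer M 0) + aeval ![y, z] (C.layer M 1) * x +
      aeval ![y, z] (C.layer M 2) * x ^ 2 + aeval ![y, z] (C.layer M 3) * x ^ 3 +
      aeval ![y, z] (C.layer M 4) * x ^ 4 := by
  have h1 := aeval_eq_sum_coeff (isHomogeneous_linSubst M (hC ▸ C.homogeneous)) x ![y, z]
  rw [aeval_linSubst] at h1
  simp only [Finset.sum_range_succ, Finset.sum_range_zero, zero_add, pow_zero, mul_one,
    pow_one] at h1
  unfold layer
  rw [← h1]
  congr 2
  funext i
  rw [Fin.sum_univ_three]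
  rfl

/-- The point `p + u q` has frame coordinates `(1 + x u, y u, z u)`, and layer `k`, of degree `4 -
k`, contributes the factor `u ^ (4 - k)`. -/
theorem aeval_line (hC : C.degree = 4) {M : Matrix (Fin 3) (Fin 3) K} {p : Fin 3 → K}
    (hp : ∀ i, M i 0 = p i) (x y z : K) :
    (aeval (fun i => Polynomial.C (p i) + Polynomial.X *
      Polynomial.C (M i 0 * x + M i 1 * y + M i 2 * z)) C.eqn : Polynomial K) =
    Polynomial.X ^ 4 * Polynomial.C (eval ![y, z] (C.layer M 0)) +
    Polynomial.X ^ 3 * Polynomial.C (eval ![y, z] (C.layer M 1)) *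
      (1 + Polynomial.C x * Polynomial.X) +
    Polynomial.X ^ 2 * Polynomial.C (eval ![y, z] (C.layer M 2)) *
      (1 + Polynomial.C x * Polynomial.X) ^ 2 +
    Polynomial.X * Polynomial.C (eval ![y, z] (C.layer M 3)) *
      (1 + Polynomial.C x * Polynomial.X) ^ 3 +
    Polynomial.C (eval p C.eqn) * (1 + Polynomial.C x * Polynomial.X) ^ 4 := by
  have h := aeval_frame hC M (A := Polynomial K) (1 + Polynomial.C x * Polynomial.X)
    (Polynomial.X * Polynomial.C y) (Polynomial.X * Polynomial.C z)
  have hk : ∀ k j, k + j = 4 → (aeval ![Polynomial.X * Polynomial.C y,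
      Polynomial.X * Polynomial.C z] (C.layer M k) : Polynomial K) =
      Polynomial.X ^ j * Polynomial.C (eval ![y, z] (C.layer M k)) := by
    intro k j hkj
    have h1 := aeval_mul_of_isHomogeneous (isHomogeneous_layer hC M hkj)
      (Polynomial.X : Polynomial K) ![Polynomial.C y, Polynomial.C z]
    have h2 : (fun i => (Polynomial.X : Polynomial K) * ![Polynomial.C y, Polynomial.C z] i) =
        ![Polynomial.X * Polynomial.C y, Polynomial.X * Polynomial.C z] := by
      funext i; fin_cases i <;> rfl
    rw [h2] at h1
    rw [h1]
    congr 1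
    have h3 : (![Polynomial.C y, Polynomial.C z] : Fin 2 → Polynomial K) =
        fun i => Polynomial.C (![y, z] i) := by
      funext i; fin_cases i <;> rfl
    rw [h3]
    have := MvPolynomial.aeval_algebraMap_apply (Polynomial K) ![y, z] (C.layer M k)
    exact this
  have h4 : (aeval ![Polynomial.X * Polynomial.C y, Polynomial.X * Polynomial.C z] (C.layer M 4) :
      Polynomial K) = Polynomial.C (eval p C.eqn) := by
    rw [layer_four hC hp, algHom_C]; rfl
  rw [hk 0 4 rfl, hk 1 3 rfl, hk 2 2 rfl, hk 3 1 rfl, h4] at h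
  rw [show (fun i => Polynomial.C (p i) + Polynomial.X *
      Polynomial.C (M i 0 * x + M i 1 * y + M i 2 * z)) = (fun i =>
      algebraMap K (Polynomial K) (M i 0) * (1 + Polynomial.C x * Polynomial.X) +
      algebraMap K (Polynomial K) (M i 1) * (Polynomial.X * Polynomial.C y) +
      algebraMap K (Polynomial K) (M i 2) * (Polynomial.X * Polynomial.C z)) from ?_, h]
  · ring
  · funext i
    rw [← hp i]
    simp only [Polynomial.algebraMap_eq, Polynomial.C_add, Polynomial.C_mul]
    ring

theorem exists_frame_coords {N M : Matrix (Fin 3) (Fin 3) K} (h : M * N = 1) (q : Fin 3 → K) :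
    q = fun i => M i 0 * (N.mulVec q) 0 + M i 1 * (N.mulVec q) 1 + M i 2 * (N.mulVec q) 2 := by
  have : q = M.mulVec (N.mulVec q) := by rw [Matrix.mulVec_mulVec, h, Matrix.one_mulVec]
  conv_lhs => rw [this]
  funext i
  simp only [Matrix.mulVec, dotProduct, Fin.sum_univ_three]

/-- Comparing the coefficients of `u` shows that layer 3 is the equation of the tangent line. -/
theorem sum_pderiv_mul (hC : C.degree = 4) {M : Matrix (Fin 3) (Fin 3) K} {p : Fin 3 → K}
    (hp : ∀ i, M i 0 = p i) (hpC : eval p C.eqn = 0) (x y z : K) :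
    ∑ i, eval p (pderiv i C.eqn) * (M i 0 * x + M i 1 * y + M i 2 * z) =
      eval ![y, z] (C.layer M 3) := by
  rw [← (coeff_one_aeval_line C.eqn p _).1, aeval_line hC hp, hpC]
  simp [mul_assoc, pow_succ, Polynomial.coeff_X_mul, Polynomial.mul_coeff_zero]

theorem isSmoothPoint_iff (hC : C.degree = 4) [Infinite K] {N M : Matrix (Fin 3) (Fin 3) K}
    (h : M * N = 1) {P : PPlane K} (hp : ∀ i, M i 0 = P.rep i) :
    C.IsSmoothPoint P ↔ P ∈ C.points ∧ C.layer M 3 ≠ 0 := by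
  refine and_congr_right fun hP => ⟨?_, ?_⟩
  · rintro ⟨i, hi⟩ h0
    apply hi
    have h1 := sum_pderiv_mul hC hp hP (N.mulVec (Pi.single i 1) 0) (N.mulVec (Pi.single i 1) 1)
      (N.mulVec (Pi.single i 1) 2)
    have h2 := exists_frame_coords h (Pi.single i 1)
    rw [h0, map_zero] at h1
    rw [← h1, Finset.sum_eq_single i]
    · rw [← congrFun h2 i]; simp
    · intro b _ hb
      rw [← congrFun h2 b]; simp [hb]
    · simp
  · intro hne
    by_contra! hz
    apply hne
    apply MvPolynomial.funext
    intro v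
    have h1 := sum_pderiv_mul hC hp hP 0 (v 0) (v 1)
    have h2 : (![v 0, v 1] : Fin 2 → K) = v := by funext i; fin_cases i <;> rfl
    rw [h2] at h1
    rw [← h1, map_zero]
    exact Finset.sum_eq_zero fun i _ => by rw [hz i, zero_mul]

theorem natDegree_frame_eq_four_iff (hC : C.degree = 4) {M : Matrix (Fin 3) (Fin 3) K}
    {P : PPlane K} (hp : ∀ i, M i 0 = P.rep i) :
    (finSuccEquiv K 2 (linSubst M C.eqn)).natDegree = 4 ↔ P ∉ C.points := by
  have hle := natDegree_finSuccEquiv_le (isHomogeneous_linSubst M (hC ▸ C.homogeneous))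
  have h4 := layer_four hC hp
  have hiff : C.layer M 4 = 0 ↔ P ∈ C.points := by
    rw [h4, map_eq_zero_iff _ (C_injective _ _)]; rfl
  rw [← hiff]
  constructor
  · intro h h0
    have hne : finSuccEquiv K 2 (linSubst M C.eqn) ≠ 0 := by
      intro h0; rw [h0] at h; simp at h
    apply hne
    rw [← Polynomial.leadingCoeff_eq_zero, Polynomial.leadingCoeff, h]
    exact h0
  · intro h
    exact le_antisymm hle (Polynomial.le_natDegree_of_ne_zero h)

/-- The degree in the first variable is 4 minus the multiplicity of `P`: layer 4 vanishes when `P`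
lies on the curve, and layer 3 when in addition all partial derivatives vanish. -/
theorem natDegree_frame_eq_three_iff (hC : C.degree = 4) [Infinite K]
    {N M : Matrix (Fin 3) (Fin 3) K} (h : M * N = 1) {P : PPlane K} (hp : ∀ i, M i 0 = P.rep i) :
    (finSuccEquiv K 2 (linSubst M C.eqn)).natDegree = 3 ↔ C.IsSmoothPoint P := by
  have hle := natDegree_finSuccEquiv_le (isHomogeneous_linSubst M (hC ▸ C.homogeneous))
  have h4 := natDegree_frame_eq_four_iff hC hp
  rw [isSmoothPoint_iff hC h hp]
  constructor
  · intro h3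
    refine ⟨?_, fun h0 => ?_⟩
    · by_contra hP
      rw [h4.mpr hP] at h3; omega
    · have hne : finSuccEquiv K 2 (linSubst M C.eqn) ≠ 0 := by
        intro h0; rw [h0] at h3; simp at h3
      apply hne
      rw [← Polynomial.leadingCoeff_eq_zero, Polynomial.leadingCoeff, h3]
      exact h0
  · rintro ⟨hP, hne⟩
    have h1 := Polynomial.le_natDegree_of_ne_zero hne
    have h2 : (finSuccEquiv K 2 (linSubst M C.eqn)).natDegree ≠ 4 := fun h => h4.mp h hP
    omega

end PlaneCurve

end

/-! ### Projection fields inside `K(t)` -/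

open scoped LinearAlgebra.Projectivization

noncomputable section

open MvPolynomial BinaryForm IntermediateField

variable {K : Type*} [Field K]

namespace PLineMorphism

variable (φ : PLineMorphism K)

/-- The pullback of the linear form `∑ cᵢ xᵢ`, as a function of the affine coordinate. -/
def fn (c : Fin 3 → K) : RatFunc K := algebraMap (Polynomial K) (RatFunc K) (dehom (φ.pull c))

theorem fn_eq_sum (c : Fin 3 → K) : φ.fn c = ∑ i, algebraMap K (RatFunc K) (c i) *
    algebraMap (Polynomial K) (RatFunc K) (dehom (φ.form i)) := by
  simp only [fn, pull, map_sum, map_mul]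
  refine Finset.sum_congr rfl fun i _ => ?_
  rw [dehom, algHom_C, ← IsScalarTower.algebraMap_apply]

theorem fn_single (j : Fin 3) :
    φ.fn (Pi.single j 1) = algebraMap (Polynomial K) (RatFunc K) (dehom (φ.form j)) := by
  rw [fn_eq_sum, Finset.sum_eq_single j]
  · simp
  · intro b _ hb; simp [hb]
  · simp

theorem ratio_eq (i j : Fin 3) : φ.ratio i j =
    φ.fn (Pi.single i 1) / φ.fn (Pi.single j 1) := by
  rw [fn_single, fn_single]; rfl

theorem fn_add (c d : Fin 3 → K) : φ.fn (c + d) = φ.fn c + φ.fn d := by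
  simp [fn, pull_add]

theorem fn_smul (x : K) (c : Fin 3 → K) : φ.fn (x • c) = algebraMap K (RatFunc K) x * φ.fn c := by
  simp only [fn, pull_smul, map_mul]
  rw [dehom, algHom_C, ← IsScalarTower.algebraMap_apply]

end PLineMorphism

namespace PlaneCurve

variable {C : PlaneCurve K} {φ : PLineMorphism K}

/-- The embedding of the function field of the line into the fraction field of the coordinate
ring that an isomorphism with the function field of the curve defines. -/
def embed (e : C.functionField ≃ₐ[K] RatFunc K) : RatFunc K →ₐ[K] FractionRing C.coordRing :=
  C.functionField.val.comp e.symm.toAlgHom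

section

variable (hC : C.degree = 4) (e : C.functionField ≃ₐ[K] RatFunc K)
  (he : ∀ i j, e (C.ratio i j) = φ.ratio i j)

include hC he

omit hC in
theorem embed_ratio (i j : Fin 3) : embed e (φ.ratio i j) = C.coord i / C.coord j := by
  rw [← he]
  simp [embed, ratio]

omit hC in
theorem fn_single_ne_zero (hC : C.degree = 4) (j : Fin 3) : φ.fn (Pi.single j 1) ≠ 0 := by
  intro h0
  have h := embed_ratio e he j j
  rw [PLineMorphism.ratio_eq, h0, div_zero, map_zero, div_self (coord_ne_zero hC j)] at h
  exact zero_ne_one h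

omit hC in
theorem embed_div_single (c : Fin 3 → K) (j : Fin 3) :
    embed e (φ.fn c / φ.fn (Pi.single j 1)) = C.linForm c / C.coord j := by
  rw [φ.fn_eq_sum, Finset.sum_div, map_sum, linForm_eq_sum, Finset.sum_div]
  refine Finset.sum_congr rfl fun i _ => ?_
  rw [mul_div_assoc, mul_div_assoc, map_mul, AlgHom.commutes, ← φ.fn_single, ← φ.ratio_eq,
    embed_ratio e he]

theorem embed_div (c d : Fin 3 → K) :
    embed e (φ.fn c / φ.fn d) = C.linForm c / C.linForm d := by
  have h0 := fn_single_ne_zero e he hC 0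
  rw [← div_div_div_cancel_right₀ h0, map_div₀, embed_div_single e he,
    embed_div_single e he, div_div_div_cancel_right₀ (coord_ne_zero hC 0)]

theorem fn_ne_zero {c : Fin 3 → K} (hc : c ≠ 0) : φ.fn c ≠ 0 := by
  intro h
  have := embed_div_single e he c 0
  rw [h, zero_div, map_zero] at this
  exact div_ne_zero (linForm_ne_zero hC hc) (coord_ne_zero hC 0) this.symm

omit hC he in
theorem row_ne_zero {N M : Matrix (Fin 3) (Fin 3) K} (h' : N * M = 1) (i : Fin 3) : N i ≠ 0 := by
  intro h0
  have := congrFun (congrFun h' i) i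
  rw [Matrix.mul_apply, h0] at this
  simp at this

/-- Divided by the last frame coordinate, every coordinate is a combination of the two ratios and 1.
So the ratios generate `K(C)`, which is all of `K(t)` through `e`. -/
theorem adjoin_fn_eq_top {N M : Matrix (Fin 3) (Fin 3) K} (h : M * N = 1) (h' : N * M = 1) :
    K⟮φ.fn (N 1) / φ.fn (N 2)⟯⟮φ.fn (N 0) / φ.fn (N 2)⟯ = ⊤ := by
  set v := φ.fn (N 1) / φ.fn (N 2) with hv
  set w := φ.fn (N 0) / φ.fn (N 2) with hw
  have hz : C.linForm (N 2) ≠ 0 := linForm_ne_zero hC (row_ne_zero h' 2)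
  let E : IntermediateField K (RatFunc K) := (K⟮v⟯⟮w⟯).restrictScalars K
  have hvE : v ∈ E := (K⟮v⟯⟮w⟯).algebraMap_mem ⟨v, mem_adjoin_simple_self K v⟩
  have hwE : w ∈ E := mem_adjoin_simple_self K⟮v⟯ w
  have hle : C.functionField ≤ E.map (embed e) := by
    have hco : ∀ i, ∃ s ∈ E, C.coord i = embed e s * C.linForm (N 2) := by
      intro i
      refine ⟨algebraMap K _ (M i 0) * w + algebraMap K _ (M i 1) * v + algebraMap K _ (M i 2),
        add_mem (add_mem (mul_mem (E.algebraMap_mem _) hwE) (mul_mem (E.algebraMap_mem _) hvE))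
          (E.algebraMap_mem _), ?_⟩
      rw [coord_eq_sum_linForm h, Fin.sum_univ_three]
      simp only [map_add, map_mul, AlgHom.commutes, hv, hw, embed_div hC e he]
      field_simp
    refine adjoin_le_iff.mpr ?_
    rintro _ ⟨i, j, rfl⟩
    obtain ⟨s, hs, hs'⟩ := hco i
    obtain ⟨t, ht, ht'⟩ := hco j
    refine ⟨s / t, E.div_mem hs ht, ?_⟩
    rw [hs', ht', mul_div_mul_right _ _ hz]
    exact map_div₀ (embed e) s t
  rw [← restrictScalars_eq_top_iff (K := K), _root_.eq_top_iff]
  intro f _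
  obtain ⟨g, hg, hgf⟩ := hle (show embed e f ∈ C.functionField from (e.symm f).2)
  have : g = f := (embed e).injective hgf
  exact this ▸ hg

theorem finrank_adjoin_fn {N M : Matrix (Fin 3) (Fin 3) K} (h : M * N = 1) (h' : N * M = 1)
    (hn : 0 < (finSuccEquiv K 2 (linSubst M C.eqn)).natDegree) :
    Module.finrank K⟮φ.fn (N 1) / φ.fn (N 2)⟯ (RatFunc K) =
      (finSuccEquiv K 2 (linSubst M C.eqn)).natDegree := by
  have hz : C.linForm (N 2) ≠ 0 := linForm_ne_zero hC (row_ne_zero h' 2)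
  exact finrank_adjoin_eq_natDegree (embed e) hz
    (by rw [embed_div hC e he]; field_simp) (by rw [embed_div hC e he]; field_simp)
    (adjoin_fn_eq_top hC e he h h') (isHomogeneous_linSubst M C.homogeneous)
    (irreducible_linSubst h h' C.irreducible) (aeval_linForm_eq_zero_iff h h') hn

/-- The last two rows of the frame span the linear forms vanishing at `P`, so a quotient of two such
forms is a fractional linear expression in a single ratio. -/
theorem map_projectionField {N M : Matrix (Fin 3) (Fin 3) K} (h : M * N = 1) (h' : N * M = 1)
    {P : PPlane K} (hp : ∀ i, M i 0 = P.rep i) :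
    (C.projectionField P).map e.toAlgHom = K⟮φ.fn (N 1) / φ.fn (N 2)⟯ := by
  have hN : ∀ j, ∑ i, N j i * P.rep i = (1 : Matrix (Fin 3) (Fin 3) K) j 0 := by
    intro j
    rw [← h', Matrix.mul_apply]
    exact Finset.sum_congr rfl fun i _ => by rw [hp]
  apply le_antisymm
  · rw [projectionField, adjoin_map, adjoin_le_iff]
    rintro _ ⟨z, ⟨a, b, ha, hb, hz⟩, rfl⟩
    have hez : e z = φ.fn a / φ.fn b := by
      have h1 : embed e (e z) = embed e (φ.fn a / φ.fn b) := by
        rw [embed_div hC e he, ← hz]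
        simp [embed]
      exact (embed e).injective h1
    have hfn : ∀ a : Fin 3 → K, ∑ i, a i * P.rep i = 0 →
        ∃ x y : K, φ.fn a = (algebraMap K _ x * (φ.fn (N 1) / φ.fn (N 2)) + algebraMap K _ y) *
          φ.fn (N 2) := by
      intro a ha
      refine ⟨(Matrix.vecMul a M) 1, (Matrix.vecMul a M) 2, ?_⟩
      have h1 : a = (Matrix.vecMul a M) 1 • N 1 + (Matrix.vecMul a M) 2 • N 2 := by
        have h2 : a = Matrix.vecMul (Matrix.vecMul a M) N := by
          rw [Matrix.vecMul_vecMul, h, Matrix.vecMul_one]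
        have h3 : (Matrix.vecMul a M) 0 = 0 := by
          rw [← ha]
          simp only [Matrix.vecMul, dotProduct, hp]
        conv_lhs => rw [h2]
        rw [Matrix.vecMul_eq_sum, Fin.sum_univ_three, h3]
        simp
      have hne := fn_ne_zero hC e he (row_ne_zero h' 2)
      conv_lhs => rw [h1, φ.fn_add, φ.fn_smul, φ.fn_smul]
      field_simp
    obtain ⟨x, y, hxy⟩ := hfn a ha
    obtain ⟨x', y', hxy'⟩ := hfn b hb
    change e z ∈ _
    have hne := fn_ne_zero hC e he (row_ne_zero h' 2)
    rw [hez, hxy, hxy', mul_div_mul_right _ _ hne]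
    have hmem := mem_adjoin_simple_self K (φ.fn (N 1) / φ.fn (N 2))
    exact div_mem
      (add_mem (mul_mem (IntermediateField.algebraMap_mem _ _) hmem)
        (IntermediateField.algebraMap_mem _ _))
      (add_mem (mul_mem (IntermediateField.algebraMap_mem _ _) hmem)
        (IntermediateField.algebraMap_mem _ _))
  · rw [adjoin_simple_le_iff]
    refine ⟨e.symm (φ.fn (N 1) / φ.fn (N 2)), subset_adjoin K _ ⟨N 1, N 2, ?_, ?_, ?_⟩, ?_⟩
    · rw [hN]; rfl
    · rw [hN]; rfl
    · exact embed_div hC e he _ _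
    · exact e.apply_symm_apply _

theorem isGalois_projectionField_iff {N M : Matrix (Fin 3) (Fin 3) K} (h : M * N = 1)
    (h' : N * M = 1) {P : PPlane K} (hp : ∀ i, M i 0 = P.rep i) :
    IsGalois (C.projectionField P) C.functionField ↔
      IsGalois K⟮φ.fn (N 1) / φ.fn (N 2)⟯ (RatFunc K) := by
  rw [← map_projectionField hC e he h h' hp]
  let f := intermediateFieldMap e (C.projectionField P)
  constructor
  · intro hG
    exact IsGalois.of_equiv_equiv (f := f.toRingEquiv) (g := e.toRingEquiv) (by ext; rfl)
  · intro hG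
    refine IsGalois.of_equiv_equiv (f := f.symm.toRingEquiv) (g := e.symm.toRingEquiv) ?_
    ext z
    obtain ⟨y, rfl⟩ := f.surjective z
    change ((C.projectionField P).val (f.symm (f y)) : FractionRing C.coordRing) =
      (e.symm (e y) : C.functionField)
    rw [f.symm_apply_apply, e.symm_apply_apply]
    rfl

end

end PlaneCurve

end

/-! ### From smooth Galois points to pencils of cubes -/

open scoped LinearAlgebra.Projectivization

noncomputable section

open MvPolynomial BinaryForm IntermediateField

variable {K : Type*} [Field K]

namespace BinaryForm

/-- The coefficient in the top degree records the value at `(0 : 1)`, the one point that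
dehomogenization loses. -/
theorem coeff_dehom {f : MvPolynomial (Fin 2) K} {n : ℕ} (hf : f.IsHomogeneous n) :
    (dehom f).coeff n = eval ![0, 1] f := by
  conv_lhs => rw [f.as_sum, map_sum, Polynomial.finsetSum_coeff]
  rw [eval_eq]
  refine Finset.sum_congr rfl fun d hd => ?_
  have h := hf (mem_support_iff.mp hd)
  rw [Finsupp.weight_apply, Finsupp.sum_fintype _ _ (by simp), Fin.sum_univ_two] at h
  simp only [Pi.one_apply, smul_eq_mul, mul_one] at h
  simp only [dehom, aeval_monomial, Finsupp.prod_fintype _ _ (fun i => pow_zero _),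
    Fin.prod_univ_two]
  rw [Finset.prod_subset (Finset.subset_univ d.support)
    (fun i _ hi => by simp [Finsupp.notMem_support_iff.mp hi]), Fin.prod_univ_two]
  simp only [Matrix.cons_val_zero, Matrix.cons_val_one, one_pow, one_mul, mul_one,
    Polynomial.algebraMap_eq, Polynomial.coeff_C_mul, Polynomial.coeff_X_pow]
  congr 1
  by_cases h0 : d 0 = 0
  · simp [h0, show n = d 1 by omega]
  · simp [h0, show n ≠ d 1 by omega]

theorem isCoprime_dehom [IsAlgClosed K] {f g : MvPolynomial (Fin 2) K}
    (h : ∀ v : Fin 2 → K, v ≠ 0 → eval v f ≠ 0 ∨ eval v g ≠ 0) :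
    IsCoprime (dehom f) (dehom g) := by
  rw [Polynomial.isCoprime_iff_aeval_ne_zero_of_isAlgClosed K K]
  intro t
  have := h ![1, t] (fun h0 => by simpa using congrFun h0 0)
  rw [← eval_dehom, ← eval_dehom] at this
  simpa [Polynomial.coe_aeval_eq_eval] using this

theorem max_natDegree_dehom {f g : MvPolynomial (Fin 2) K} {n : ℕ} (hf : f.IsHomogeneous n)
    (hg : g.IsHomogeneous n) (h : eval ![0, 1] f ≠ 0 ∨ eval ![0, 1] g ≠ 0) :
    max (dehom f).natDegree (dehom g).natDegree = n := by
  apply le_antisymm (max_le (natDegree_dehom_le hf) (natDegree_dehom_le hg))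
  rw [← coeff_dehom hf, ← coeff_dehom hg] at h
  rcases h with h | h
  · exact le_max_of_le_left (Polynomial.le_natDegree_of_ne_zero h)
  · exact le_max_of_le_right (Polynomial.le_natDegree_of_ne_zero h)

theorem exists_ne_zero_eval_lin_eq_zero {l : Fin 2 → K} (hl : l ≠ 0) :
    ∃ v : Fin 2 → K, v ≠ 0 ∧ l 0 * v 0 + l 1 * v 1 = 0 := by
  refine ⟨![-l 1, l 0], fun h => hl ?_, by simp; ring⟩
  have h0 := congrFun h 0
  have h1 := congrFun h 1
  simp at h0 h1
  funext i; fin_cases i <;> simp [h0, h1]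

end BinaryForm

/-- The vectors killed by the last two rows of a frame are multiples of the frame point. -/
theorem eq_smul_of_frame {N M : Matrix (Fin 3) (Fin 3) K} (h : M * N = 1) {p q : Fin 3 → K}
    (hp : ∀ i, M i 0 = p i) (h1 : ∑ i, N 1 i * q i = 0) (h2 : ∑ i, N 2 i * q i = 0) :
    q = (∑ i, N 0 i * q i) • p := by
  have hq : q = M.mulVec (N.mulVec q) := by rw [Matrix.mulVec_mulVec, h, Matrix.one_mulVec]
  have e1 : N.mulVec q 1 = 0 := h1
  have e2 : N.mulVec q 2 = 0 := h2
  have e0 : N.mulVec q 0 = ∑ i, N 0 i * q i := rfl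
  conv_lhs => rw [hq]
  funext i
  simp only [Matrix.mulVec, dotProduct, Fin.sum_univ_three] at e0 e1 e2 ⊢
  rw [e1, e2, hp]
  simp only [Pi.smul_apply, smul_eq_mul]
  ring

namespace PLineMorphism

variable (φ : PLineMorphism K)

theorem mem_image_of_frame {N M : Matrix (Fin 3) (Fin 3) K} (h : M * N = 1) {P : PPlane K}
    (hp : ∀ i, M i 0 = P.rep i) {v : Fin 2 → K} (hv : v ≠ 0) (h1 : eval v (φ.pull (N 1)) = 0)
    (h2 : eval v (φ.pull (N 2)) = 0) :
    φ.toFun (Projectivization.mk K v hv) = P := by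
  rw [eval_pull] at h1 h2
  have := eq_smul_of_frame h hp h1 h2
  rw [toFun_mk, ← P.mk_rep, Projectivization.mk_eq_mk_iff']
  exact ⟨_, this.symm⟩

/-- The projection from a point off the image has the same degree as the morphism. -/
theorem finrank_adjoin_fn_of_notMem_image [IsAlgClosed K] {N M : Matrix (Fin 3) (Fin 3) K}
    (h : M * N = 1) {P : PPlane K} (hp : ∀ i, M i 0 = P.rep i) (hP : P ∉ φ.image)
    (hne : φ.fn (N 2) ≠ 0) :
    Module.finrank K⟮φ.fn (N 1) / φ.fn (N 2)⟯ (RatFunc K) = φ.degree := by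
  have key : ∀ v : Fin 2 → K, v ≠ 0 → eval v (φ.pull (N 1)) ≠ 0 ∨ eval v (φ.pull (N 2)) ≠ 0 := by
    intro v hv
    by_contra! hcon
    exact hP ⟨_, φ.mem_image_of_frame h hp hv hcon.1 hcon.2⟩
  have hne' : dehom (φ.pull (N 2)) ≠ 0 := fun h0 => hne (by simp [fn, h0])
  rw [fn, fn, RatFunc.finrank_adjoin_div hne' (isCoprime_dehom key)]
  exact max_natDegree_dehom (φ.isHomogeneous_pull _) (φ.isHomogeneous_pull _)
    (key ![0, 1] fun h0 => by simpa using congrFun h0 1)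

end PLineMorphism

theorem exists_frame_of_point (P : PPlane K) :
    ∃ N M : Matrix (Fin 3) (Fin 3) K, N * M = 1 ∧ M * N = 1 ∧ ∀ i, M i 0 = P.rep i := by
  obtain ⟨c, d, hcd, hc, hd⟩ := exists_annihilators P.rep_nonzero
  obtain ⟨N, M, h', h, hp, -, -⟩ := exists_frame P.rep_nonzero hcd hc hd
  exact ⟨N, M, h', h, hp⟩

theorem frame_rows {N M : Matrix (Fin 3) (Fin 3) K} (h' : N * M = 1) {P : PPlane K}
    (hp : ∀ i, M i 0 = P.rep i) (j : Fin 3) :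
    ∑ i, N j i * P.rep i = (1 : Matrix (Fin 3) (Fin 3) K) j 0 := by
  rw [← h', Matrix.mul_apply]
  exact Finset.sum_congr rfl fun i _ => by rw [hp]

theorem frame_linearIndependent {N M : Matrix (Fin 3) (Fin 3) K} (h' : N * M = 1) {x y z w : K} (hdet : x * w - y * z ≠ 0) :
    LinearIndependent K ![x • N 1 + y • N 2, z • N 1 + w • N 2] := by
  rw [LinearIndependent.pair_iff]
  intro s t hst
  have h1 : ∀ j, ∑ i, (s • (x • N 1 + y • N 2) + t • (z • N 1 + w • N 2)) i * M i j =
      (s * x + t * z) * (1 : Matrix (Fin 3) (Fin 3) K) 1 j +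
      (s * y + t * w) * (1 : Matrix (Fin 3) (Fin 3) K) 2 j := by
    intro j
    rw [← h', Matrix.mul_apply, Matrix.mul_apply, Finset.mul_sum, Finset.mul_sum,
      ← Finset.sum_add_distrib]
    refine Finset.sum_congr rfl fun i _ => ?_
    simp only [Pi.add_apply, Pi.smul_apply, smul_eq_mul]
    ring
  rw [hst] at h1
  have e1 := h1 1
  have e2 := h1 2
  simp at e1 e2
  constructor
  · have : s * (x * w - y * z) = 0 := by linear_combination z * e2 - w * e1
    exact (mul_eq_zero.mp this).resolve_right hdet
  · have : t * (x * w - y * z) = 0 := by linear_combination y * e1 - x * e2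
    exact (mul_eq_zero.mp this).resolve_right hdet

namespace PlaneCurve

variable {C : PlaneCurve K} {φ : PLineMorphism K}

/-- Projection from a point off the curve has degree 4 by the equation of the curve and degree
`φ.degree` by the parametrization. -/
theorem IsNormalization.degree_eq [IsAlgClosed K] (hC : C.degree = 4) (hφ : C.IsNormalization φ) :
    φ.degree = 4 := by
  obtain ⟨himg, e, he⟩ := hφ
  have : Infinite K := IsAlgClosed.instInfinite
  obtain ⟨P, hP⟩ := C.exists_notMem_points (by omega)
  obtain ⟨N, M, h', h, hp⟩ := exists_frame_of_point P
  have h4 := (natDegree_frame_eq_four_iff hC hp).mpr hP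
  have h1 := finrank_adjoin_fn hC e he h h' (by omega)
  rw [φ.finrank_adjoin_fn_of_notMem_image h hp (himg ▸ hP)
    (fn_ne_zero hC e he (row_ne_zero h' 2)), h4] at h1
  exact h1

/-- A Galois point that is a smooth point of the curve gives a pencil of cubes. -/
theorem exists_hasCubicPencil [IsAlgClosed K] (h3 : (3 : K) ≠ 0) (hC : C.degree = 4)
    (hφ : C.IsNormalization φ) {P : PPlane K} (hs : C.IsSmoothPoint P) (hG : C.IsGaloisPoint P) :
    ∃ l a b, φ.HasCubicPencil P l a b := by
  have hd4 := hφ.degree_eq hC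
  obtain ⟨himg, e, he⟩ := hφ
  have : Infinite K := IsAlgClosed.instInfinite
  obtain ⟨N, M, h', h, hp⟩ := exists_frame_of_point P
  have hn := (natDegree_frame_eq_three_iff hC h hp).mpr hs
  have hfr := finrank_adjoin_fn hC e he h h' (by omega)
  rw [hn] at hfr
  have hgal := (isGalois_projectionField_iff hC e he h h' hp).mp hG.2
  set f := dehom (φ.pull (N 1)) with hf
  set g := dehom (φ.pull (N 2)) with hg
  have hg0 : g ≠ 0 := by
    intro h0
    apply fn_ne_zero hC e he (row_ne_zero h' 2)
    rw [PLineMorphism.fn, ← hg, h0, map_zero]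
  -- The common factor `m` is the future `l`. The quotient pencil `A, B` is coprime with maximal
  -- degree 3.
  obtain ⟨m, A, B, hcop, hfA, hgB⟩ : ∃ m A B, IsCoprime A B ∧ f = m * A ∧ g = m * B := by
    classical
    obtain ⟨A, hA⟩ := EuclideanDomain.gcd_dvd_left f g
    obtain ⟨B, hB⟩ := EuclideanDomain.gcd_dvd_right f g
    refine ⟨_, A, B, ?_, hA, hB⟩
    have hne : EuclideanDomain.gcd f g ≠ 0 := by
      intro h0; rw [h0, zero_mul] at hB; exact hg0 hB
    refine ⟨EuclideanDomain.gcdA f g, EuclideanDomain.gcdB f g, ?_⟩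
    apply mul_left_cancel₀ hne
    have := EuclideanDomain.gcd_eq_gcd_ab f g
    linear_combination -this - EuclideanDomain.gcdA f g * hA - EuclideanDomain.gcdB f g * hB
  have hm0 : m ≠ 0 := by rintro h0; rw [h0, zero_mul] at hgB; exact hg0 hgB
  have hB0 : B ≠ 0 := by rintro h0; rw [h0, mul_zero] at hgB; exact hg0 hgB
  have hquot : φ.fn (N 1) / φ.fn (N 2) = algebraMap (Polynomial K) (RatFunc K) A /
      algebraMap (Polynomial K) (RatFunc K) B := by
    rw [PLineMorphism.fn, PLineMorphism.fn, ← hf, ← hg, hfA, hgB, map_mul, map_mul]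
    exact mul_div_mul_left _ _ (by simpa using hm0)
  rw [hquot] at hfr hgal
  rw [RatFunc.finrank_adjoin_div hB0 hcop] at hfr
  obtain ⟨a, b, hab, ha, hb⟩ := RatFunc.exists_cubes_of_isGalois h3 hB0 hcop hfr hgal
  rw [Submodule.mem_span_pair] at ha hb
  obtain ⟨x, y, hxy⟩ := ha
  obtain ⟨z, w, hzw⟩ := hb
  -- Two quartics whose coprime parts reach degree 3 have a common factor of degree at most one. If
  -- `m` is constant, the zero of `l` is the point `(0 : 1)`.
  have hmdeg : m.natDegree ≤ 1 := by
    have e1 : f.natDegree ≤ 4 := by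
      rw [← hd4]; exact natDegree_dehom_le (φ.isHomogeneous_pull _)
    have e2 : g.natDegree ≤ 4 := by
      rw [← hd4]; exact natDegree_dehom_le (φ.isHomogeneous_pull _)
    rw [hgB, Polynomial.natDegree_mul hm0 hB0] at e2
    by_cases hA0 : A = 0
    · rw [hA0] at hfr; simp at hfr; omega
    · rw [hfA, Polynomial.natDegree_mul hm0 hA0] at e1
      omega
  obtain ⟨l, hl⟩ := exists_linPoly_of_natDegree_le hmdeg
  have hpull : ∀ (x y : K) (a : Fin 2 → K), x • A + y • B = linPoly a ^ 3 →
      φ.pull (x • N 1 + y • N 2) = lin l * lin a ^ 3 := by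
    intro x y a hxy
    apply dehom_injective (n := 4) (hd4 ▸ φ.isHomogeneous_pull _) (isHomogeneous_lin_mul_cube _ _)
    rw [φ.pull_add, φ.pull_smul, φ.pull_smul, map_add, map_mul, map_mul, map_mul, map_pow,
      dehom_lin, dehom_lin, ← hxy, ← hl, ← hf, ← hg]
    conv_lhs => rw [hfA, hgB]
    simp only [dehom, algHom_C, Polynomial.smul_eq_C_mul, Polynomial.algebraMap_eq]
    ring
  -- Otherwise `a³` and `b³` would be proportional, although they are coprime and not both constant.
  have hdet : x * w - y * z ≠ 0 := by
    intro h0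
    have hrel : Polynomial.C z * linPoly a ^ 3 = Polynomial.C x * linPoly b ^ 3 := by
      rw [← hxy, ← hzw]
      simp only [Polynomial.smul_eq_C_mul]
      have : Polynomial.C (x * w - y * z) = (0 : Polynomial K) := by rw [h0, map_zero]
      simp only [Polynomial.C_sub, Polynomial.C_mul] at this
      linear_combination -B * this
    have hrel' : Polynomial.C w * linPoly a ^ 3 = Polynomial.C y * linPoly b ^ 3 := by
      rw [← hxy, ← hzw]
      simp only [Polynomial.smul_eq_C_mul]
      have : Polynomial.C (x * w - y * z) = (0 : Polynomial K) := by rw [h0, map_zero]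
      simp only [Polynomial.C_sub, Polynomial.C_mul] at this
      linear_combination A * this
    have hcub : IsCoprime (linPoly a ^ 3) (linPoly b ^ 3) := (isCoprime_linPoly hab).pow
    have hbunit : ∀ s t : K, Polynomial.C s * linPoly a ^ 3 = Polynomial.C t * linPoly b ^ 3 →
        s = 0 := by
      intro s t hst
      by_contra hs0
      have hsu : IsUnit (Polynomial.C s) := Polynomial.isUnit_C.mpr (isUnit_iff_ne_zero.mpr hs0)
      have hdvd : linPoly b ^ 3 ∣ linPoly a ^ 3 := by
        rw [← hsu.dvd_mul_left, hst]; exact dvd_mul_left _ _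
      have hub := hcub.symm.isUnit_of_dvd' dvd_rfl hdvd
      have hdb := Polynomial.natDegree_eq_zero_of_isUnit hub
      have hbb : (Polynomial.C s * linPoly a ^ 3).natDegree ≤ 0 := by
        rw [hst]
        exact (Polynomial.natDegree_C_mul_le _ _).trans hdb.le
      rw [Polynomial.natDegree_C_mul hs0, Polynomial.natDegree_pow] at hbb
      rw [Polynomial.natDegree_pow] at hdb
      have := max_natDegree_linPoly hab
      omega
    have hz := hbunit _ _ hrel
    have hw := hbunit _ _ hrel'
    rw [hz, hw, zero_smul, zero_smul, add_zero] at hzw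
    exact pow_ne_zero 3 (linPoly_ne_zero (right_ne_zero_of_wedge hab)) hzw.symm
  have hrow : ∀ x y : K, ∑ i, (x • N 1 + y • N 2) i * P.rep i = 0 := by
    intro x y
    have e1 := frame_rows h' hp 1
    have e2 := frame_rows h' hp 2
    simp only [Fin.sum_univ_three, Matrix.one_apply] at e1 e2 ⊢
    simp only [Pi.add_apply, Pi.smul_apply, smul_eq_mul]
    simp at e1 e2
    linear_combination x * e1 + y * e2
  exact ⟨l, a, b, by rintro rfl; exact hm0 (by rw [hl]; simp [linPoly]), hab,
    x • N 1 + y • N 2, z • N 1 + w • N 2, frame_linearIndependent h' hdet, hrow x y, hrow z w,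
    hpull x y a hxy, hpull z w b hzw⟩

end PlaneCurve

end

/-! ### From pencils of cubes to smooth Galois points -/

open scoped LinearAlgebra.Projectivization

noncomputable section

open MvPolynomial BinaryForm IntermediateField

variable {K : Type*} [Field K]

namespace PLineMorphism

variable {φ : PLineMorphism K} {P : PPlane K} {l a b : Fin 2 → K}

/-- At the zero of `l` every linear form through `P` pulls back to zero, and `P` is the only common
zero of these forms. -/
theorem HasCubicPencil.toFun_eq (h : φ.HasCubicPencil P l a b) {v : Fin 2 → K} (hv : v ≠ 0)
    (hl : l 0 * v 0 + l 1 * v 1 = 0) : φ.toFun (Projectivization.mk K v hv) = P := by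
  obtain ⟨-, -, c, d, hcd, hc, hd, hpc, hpd⟩ := h
  obtain ⟨N, M, -, hMN, hp, rfl, rfl⟩ := exists_frame P.rep_nonzero hcd hc hd
  exact φ.mem_image_of_frame hMN hp hv (by rw [hpc]; simp [hl]) (by rw [hpd]; simp [hl])

theorem HasCubicPencil.mem_image (h : φ.HasCubicPencil P l a b) : P ∈ φ.image := by
  obtain ⟨v, hv, hlv⟩ := exists_ne_zero_eval_lin_eq_zero h.1
  exact ⟨_, h.toFun_eq hv hlv⟩

theorem fn_div_fn_eq {c d : Fin 3 → K} (hl : l ≠ 0)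
    (hc : φ.pull c = lin l * lin a ^ 3) (hd : φ.pull d = lin l * lin b ^ 3) :
    φ.fn c / φ.fn d = RatFunc.moebius b a ^ 3 := by
  have hl' := linPoly_ne_zero hl
  rw [fn, fn, hc, hd, RatFunc.moebius]
  simp only [map_mul, map_pow, dehom_lin, div_pow]
  exact mul_div_mul_left _ _ (by simpa using hl')

end PLineMorphism

theorem BinaryForm.wedge_comm (a b : Fin 2 → K) : wedge b a = -wedge a b := by
  unfold wedge; ring

namespace PlaneCurve

variable {C : PlaneCurve K} {φ : PLineMorphism K} {P : PPlane K} {l a b : Fin 2 → K}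

/-- A curve that is not a cone has positive degree in the first frame variable. -/
theorem natDegree_frame_pos [Infinite K] (hC : C.degree = 4) (e : C.functionField ≃ₐ[K] RatFunc K)
    (he : ∀ i j, e (C.ratio i j) = φ.ratio i j) {N M : Matrix (Fin 3) (Fin 3) K} (h : M * N = 1)
    (h' : N * M = 1) (hnc : ¬∃ c, φ.fn (N 2) / φ.fn (N 1) = RatFunc.C c) :
    0 < (finSuccEquiv K 2 (linSubst M C.eqn)).natDegree := by
  rw [Nat.pos_iff_ne_zero]
  intro h0
  have hG := irreducible_linSubst h h' C.irreducible
  -- In degree zero the equation would be a form in the last two coordinates alone. Its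
  -- dehomogenization would then be an algebraic relation for their nonconstant ratio, which is
  -- transcendental over `K`.
  have hG0 : finSuccEquiv K 2 (linSubst M C.eqn) = Polynomial.C (C.layer M 0) :=
    Polynomial.eq_C_of_natDegree_eq_zero h0
  have hG1 : linSubst M C.eqn = rename Fin.succ (C.layer M 0) := by
    apply (finSuccEquiv K 2).injective
    rw [hG0, finSuccEquiv_rename_succ]
  have hz := (aeval_linForm_eq_zero_iff (C := C) h h' (linSubst M C.eqn)).mpr dvd_rfl
  rw [hG1, aeval_rename] at hz
  have hy : C.linForm (N 1) ≠ 0 := linForm_ne_zero hC (row_ne_zero h' 1)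
  have hv : (![C.linForm (N 0), C.linForm (N 1), C.linForm (N 2)] ∘ Fin.succ) =
      fun i => C.linForm (N 1) * embed e (![1, φ.fn (N 2) / φ.fn (N 1)] i) := by
    funext i
    fin_cases i
    · simp
    · simp only [Function.comp_apply]
      simp [embed_div hC e he]
      field_simp
  have hhom := isHomogeneous_layer hC M (k := 0) (j := 4) rfl
  rw [hv, aeval_mul_of_isHomogeneous hhom] at hz
  have hz1 := (mul_eq_zero.mp hz).resolve_left (pow_ne_zero 4 hy)
  change aeval (embed e ∘ ![1, φ.fn (N 2) / φ.fn (N 1)]) (C.layer M 0) = 0 at hz1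
  have hz2 : embed e (aeval ![1, φ.fn (N 2) / φ.fn (N 1)] (C.layer M 0)) = 0 := by
    rw [← hz1, ← AlgHom.comp_apply, comp_aeval]; rfl
  rw [map_eq_zero] at hz2
  have hz3 : Polynomial.aeval (φ.fn (N 2) / φ.fn (N 1)) (dehom (C.layer M 0)) = 0 := by
    rw [← hz2, dehom, ← AlgHom.comp_apply, comp_aeval]
    congr 2
    funext i
    fin_cases i <;> simp
  have htr := RatFunc.transcendental_of_ne_C _ hnc
  have hz4 := (transcendental_iff.mp htr) _ hz3
  have hz5 : C.layer M 0 = 0 :=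
    dehom_injective hhom (isHomogeneous_zero _ _ _) (by rw [hz4, map_zero])
  rw [hG1, hz5, map_zero] at hG
  exact hG.ne_zero rfl

/-- The ratio of the two members is the cube of a function of degree one. So the projection has
degree 3, which means smoothness, and is Galois by Kummer theory. -/
theorem smooth_and_galois_of_hasCubicPencil [IsAlgClosed K] (h3 : (3 : K) ≠ 0) (hC : C.degree = 4)
    (hφ : C.IsNormalization φ) (h : φ.HasCubicPencil P l a b) :
    C.IsSmoothPoint P ∧ C.IsGaloisPoint P := by
  have : Infinite K := IsAlgClosed.instInfinite
  have hPi := h.mem_image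
  obtain ⟨himg, e, he⟩ := hφ
  obtain ⟨hl, hab, c, d, hcd, hc, hd, hpc, hpd⟩ := h
  obtain ⟨N, M, h', h, hp, rfl, rfl⟩ := exists_frame P.rep_nonzero hcd hc hd
  have hba : wedge b a ≠ 0 := by rw [wedge_comm]; exact neg_ne_zero.mpr hab
  have hq := PLineMorphism.fn_div_fn_eq hl hpc hpd
  have hq' := PLineMorphism.fn_div_fn_eq hl hpd hpc
  have hpos := natDegree_frame_pos hC e he h h' (by
    rw [hq']
    exact RatFunc.not_const_of_finrank (by rw [RatFunc.finrank_adjoin_moebius_cube hab]; norm_num))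
  have hfr := finrank_adjoin_fn hC e he h h' hpos
  rw [hq, RatFunc.finrank_adjoin_moebius_cube hba] at hfr
  refine ⟨(natDegree_frame_eq_three_iff hC h hp).mp hfr.symm, himg ▸ hPi, ?_⟩
  rw [isGalois_projectionField_iff hC e he h h' hp, hq]
  exact RatFunc.isGalois_adjoin_moebius_cube h3 hba

end PlaneCurve

end

/-! ### Contact with the tangent line in terms of the pencil -/

open scoped LinearAlgebra.Projectivization

noncomputable section

open MvPolynomial BinaryForm

variable {K : Type*} [Field K]

namespace BinaryForm

theorem exists_lin_of_isHomogeneous_one [Infinite K] {f : MvPolynomial (Fin 2) K}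
    (hf : f.IsHomogeneous 1) : ∃ l, f = lin l := by
  obtain ⟨l, hl⟩ := exists_linPoly_of_natDegree_le (natDegree_dehom_le hf)
  exact ⟨l, dehom_injective hf (isHomogeneous_lin l) (by rw [hl, dehom_lin])⟩

end BinaryForm

theorem Polynomial.rootMultiplicity_sq_mul {R : Polynomial K} {c : K} :
    (X ^ 2 * (C c + X * R)).rootMultiplicity 0 = 2 ↔ c ≠ 0 := by
  constructor
  · rintro h rfl
    have hne : X ^ 2 * (C 0 + X * R) ≠ 0 := by
      intro h0; rw [h0] at h; simp at h
    have : 3 ≤ (X ^ 2 * (C 0 + X * R)).rootMultiplicity 0 := by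
      rw [le_rootMultiplicity_iff hne]
      exact ⟨R, by simp; ring⟩
    omega
  · intro hc
    have hne' : C c + X * R ≠ 0 := by
      intro h0
      apply hc
      simpa using congrArg (eval 0) h0
    have hne : X ^ 2 * (C c + X * R) ≠ 0 := mul_ne_zero (pow_ne_zero 2 X_ne_zero) hne'
    rw [rootMultiplicity_mul hne]
    have h1 : (X ^ 2 : Polynomial K).rootMultiplicity 0 = 2 := by
      have := rootMultiplicity_X_sub_C_pow (0 : K) 2
      simpa using this
    rw [h1, rootMultiplicity_eq_zero]
    simpa [IsRoot] using hc

namespace PlaneCurve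

variable {C : PlaneCurve K} {φ : PLineMorphism K} {P : PPlane K} {l a b : Fin 2 → K}

theorem eval_evalVec_eq_zero (himg : φ.image = C.points) {v : Fin 2 → K} (hv : v ≠ 0) :
    eval (φ.evalVec v) C.eqn = 0 := by
  rw [← C.mk_mem_points (φ.evalVec_ne_zero hv), ← himg]
  exact φ.mk_mem_image hv

/-- The local equation of the curve along a parametrized line in the source. -/
theorem aeval_pull_line_eq_zero [Infinite K] (hC : C.degree = 4) (himg : φ.image = C.points)
    {N M : Matrix (Fin 3) (Fin 3) K} (h : M * N = 1) {v w : Fin 2 → K}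
    (hvw : ∀ t : K, v + t • w ≠ 0) (x y z : Polynomial K)
    (hx : aeval (fun i => Polynomial.C (v i) + Polynomial.X * Polynomial.C (w i))
      (φ.pull (N 0)) = x)
    (hy : aeval (fun i => Polynomial.C (v i) + Polynomial.X * Polynomial.C (w i))
      (φ.pull (N 1)) = y)
    (hz : aeval (fun i => Polynomial.C (v i) + Polynomial.X * Polynomial.C (w i))
      (φ.pull (N 2)) = z) :
    aeval ![y, z] (C.layer M 0) + aeval ![y, z] (C.layer M 1) * x +
      aeval ![y, z] (C.layer M 2) * x ^ 2 + aeval ![y, z] (C.layer M 3) * x ^ 3 +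
      aeval ![y, z] (C.layer M 4) * x ^ 4 = 0 := by
  rw [← aeval_frame hC M]
  apply Polynomial.funext
  intro t
  have hev : ∀ (f : MvPolynomial (Fin 2) K),
      (aeval (fun i => Polynomial.C (v i) + Polynomial.X * Polynomial.C (w i)) f :
        Polynomial K).eval t = eval (v + t • w) f := by
    intro f
    have : (Polynomial.aeval t : Polynomial K →ₐ[K] K).comp (aeval (fun i => Polynomial.C (v i) +
        Polynomial.X * Polynomial.C (w i)) : MvPolynomial (Fin 2) K →ₐ[K] Polynomial K) =
        aeval (v + t • w) := by
      apply MvPolynomial.algHom_ext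
      intro i
      simp [Polynomial.coe_aeval_eq_eval]
      ring
    have h1 := congrArg (fun g => g f) this
    simpa [Polynomial.coe_aeval_eq_eval, coe_aeval_eq_eval] using h1
  have h2 : (Polynomial.aeval t : Polynomial K →ₐ[K] K).comp
      (aeval (fun i => algebraMap K (Polynomial K) (M i 0) * x +
        algebraMap K (Polynomial K) (M i 1) * y + algebraMap K (Polynomial K) (M i 2) * z) :
        MvPolynomial (Fin 3) K →ₐ[K] Polynomial K) = aeval (φ.evalVec (v + t • w)) := by
    apply MvPolynomial.algHom_ext
    intro i
    have hN : ∀ j, (N.mulVec (φ.evalVec (v + t • w))) j = eval (v + t • w) (φ.pull (N j)) := by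
      intro j
      rw [φ.eval_pull]; rfl
    rw [AlgHom.comp_apply, aeval_X, aeval_X]
    conv_rhs => rw [exists_frame_coords h (φ.evalVec (v + t • w))]
    simp only [hN, ← hev, hx, hy, hz]
    simp [Polynomial.coe_aeval_eq_eval]
  have h3 := congrArg (fun g => g C.eqn) h2
  simp only [AlgHom.comp_apply] at h3
  rw [Polynomial.coe_aeval_eq_eval] at h3
  rw [h3, Polynomial.eval_zero]
  exact eval_evalVec_eq_zero himg (hvw t)

/-- Near the zero `v` of `l` the curve has frame coordinates `(x, u α, u β)` with `α = (a₀ + a₁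
u)³`, `β = (b₀ + b₁ u)³`, where `a₀ = wedge l a` and `b₀ = wedge l b`. After division of the
equation by `u`, order 0 says that the tangent form `m` vanishes at `(a₀³, b₀³)`. Order 1 expresses
the value `s` of layer 2 in that direction through `m`. Contact 2 means `s ≠ 0`. -/
theorem tangentMultiplicityEq_two_iff [IsAlgClosed K] (h3 : (3 : K) ≠ 0) (hC : C.degree = 4)
    (himg : φ.image = C.points) (hs : C.IsSmoothPoint P) (hpen : φ.HasCubicPencil P l a b) :
    C.TangentMultiplicityEq P 2 ↔ wedge l a ≠ 0 ∧ wedge l b ≠ 0 := by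
  have : Infinite K := IsAlgClosed.instInfinite
  obtain ⟨hl, hab, c, d, hcd, hc, hd, hpc, hpd⟩ := hpen
  obtain ⟨N, M, h', h, hp, rfl, rfl⟩ := exists_frame P.rep_nonzero hcd hc hd
  obtain ⟨hP, hA3⟩ := (isSmoothPoint_iff hC h hp).mp hs
  have hPe : eval P.rep C.eqn = 0 := hP
  obtain ⟨m, hm⟩ := exists_lin_of_isHomogeneous_one (isHomogeneous_layer hC M (k := 3) (j := 1) rfl)
  set v : Fin 2 → K := ![-l 1, l 0] with hv
  -- With `l(v) = 0` and `l(w) = 1`, the form `l` becomes the parameter `u` along `v + u w`.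
  obtain ⟨w, hw⟩ : ∃ w : Fin 2 → K, l 0 * w 0 + l 1 * w 1 = 1 := by
    by_cases h0 : l 0 = 0
    · have h1 : l 1 ≠ 0 := by
        intro h1; apply hl; funext i; fin_cases i <;> simp [h0, h1]
      exact ⟨![0, (l 1)⁻¹], by simp [h1]⟩
    · exact ⟨![(l 0)⁻¹, 0], by simp [h0]⟩
  have hlv : l 0 * v 0 + l 1 * v 1 = 0 := by simp [hv]; ring
  have hv0 : v ≠ 0 := by
    intro h0
    have e0 := congrFun h0 0
    have e1 := congrFun h0 1
    simp [hv] at e0 e1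
    apply hl; funext i; fin_cases i <;> simp [e0, e1]
  have hvw : ∀ t : K, v + t • w ≠ 0 := by
    intro t h0
    have e0 : v 0 + t * w 0 = 0 := by simpa using congrFun h0 0
    have e1 : v 1 + t * w 1 = 0 := by simpa using congrFun h0 1
    have ht : t = 0 := by linear_combination l 0 * e0 + l 1 * e1 - hlv - t * hw
    rw [ht, zero_smul, add_zero] at h0
    exact hv0 h0
  set line : Fin 2 → Polynomial K := fun i =>
    Polynomial.C (v i) + Polynomial.X * Polynomial.C (w i) with hline
  have hlin : ∀ k : Fin 2 → K, aeval line (lin k) = Polynomial.C (k 0 * v 0 + k 1 * v 1) +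
      Polynomial.X * Polynomial.C (k 0 * w 0 + k 1 * w 1) := by
    intro k
    simp only [lin, map_add, map_mul, algHom_C, aeval_X, hline, Polynomial.algebraMap_eq]
    ring
  have hlin_l : aeval line (lin l) = Polynomial.X := by rw [hlin, hlv, hw]; simp
  set α := (aeval line (lin a)) ^ 3 with hα
  set β := (aeval line (lin b)) ^ 3 with hβ
  set x := aeval line (φ.pull (N 0)) with hx
  have heq := aeval_pull_line_eq_zero hC himg h hvw x (Polynomial.X * α) (Polynomial.X * β) rfl
    (by rw [hpc, map_mul, map_pow, hlin_l]) (by rw [hpd, map_mul, map_pow, hlin_l])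
  have hk : ∀ k j, k + j = 4 → (aeval ![Polynomial.X * α, Polynomial.X * β] (C.layer M k) :
      Polynomial K) = Polynomial.X ^ j * aeval ![α, β] (C.layer M k) := by
    intro k j hkj
    rw [← aeval_mul_of_isHomogeneous (isHomogeneous_layer hC M hkj)]
    congr 2
    funext i; fin_cases i <;> rfl
  rw [hk 0 4 rfl, hk 1 3 rfl, hk 2 2 rfl, hk 3 1 rfl, layer_four hC hp, hPe] at heq
  have heq2 : Polynomial.X ^ 2 * (Polynomial.X * aeval ![α, β] (C.layer M 0) +
      aeval ![α, β] (C.layer M 1) * x) + Polynomial.X * (aeval ![α, β] (C.layer M 2) * x ^ 2) +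
      (Polynomial.C (m 0) * α + Polynomial.C (m 1) * β) * x ^ 3 = 0 := by
    apply mul_left_cancel₀ (Polynomial.X_ne_zero (R := K))
    rw [mul_zero, ← heq, hm]
    simp only [lin, map_add, map_mul, algHom_C, aeval_X, Polynomial.algebraMap_eq, map_zero]
    simp only [Matrix.cons_val_zero, Matrix.cons_val_one]
    ring
  set a0 := wedge l a with ha0
  set b0 := wedge l b with hb0
  set a1 := a 0 * w 0 + a 1 * w 1 with ha1
  set b1 := b 0 * w 0 + b 1 * w 1 with hb1
  have hα' : α = (Polynomial.C a0 + Polynomial.X * Polynomial.C a1) ^ 3 := by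
    rw [hα, hlin]
    congr 3
    simp [ha0, wedge, hv]; ring
  have hβ' : β = (Polynomial.C b0 + Polynomial.X * Polynomial.C b1) ^ 3 := by
    rw [hβ, hlin]
    congr 3
    simp [hb0, wedge, hv]; ring
  have hdet : a0 * b1 - a1 * b0 = - wedge a b := by
    simp only [ha0, hb0, ha1, hb1, wedge]
    linear_combination (a 1 * b 0 - a 0 * b 1) * hw
  have hx0 : x.eval 0 ≠ 0 := by
    intro h0
    have hev : x.eval 0 = eval v (φ.pull (N 0)) := by
      rw [← Polynomial.coeff_zero_eq_eval_zero]
      exact (coeff_one_aeval_line (φ.pull (N 0)) v w).2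
    rw [hev, φ.eval_pull] at h0
    have := eq_smul_of_frame h (p := P.rep) (q := φ.evalVec v) hp
      (by rw [← φ.eval_pull, hpc, map_mul, eval_lin, hlv, zero_mul])
      (by rw [← φ.eval_pull, hpd, map_mul, eval_lin, hlv, zero_mul])
    rw [h0, zero_smul] at this
    exact φ.evalVec_ne_zero hv0 this
  have hA2 : (aeval ![α, β] (C.layer M 2) : Polynomial K).eval 0 =
      eval ![a0 ^ 3, b0 ^ 3] (C.layer M 2) := by
    have : (Polynomial.aeval (0 : K) : Polynomial K →ₐ[K] K).comp
        (aeval ![α, β] : MvPolynomial (Fin 2) K →ₐ[K] Polynomial K) =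
        aeval ![a0 ^ 3, b0 ^ 3] := by
      apply MvPolynomial.algHom_ext
      intro i
      fin_cases i <;> simp [Polynomial.coe_aeval_eq_eval, hα', hβ']
    have h1 := congrArg (fun g => g (C.layer M 2)) this
    simpa [Polynomial.coe_aeval_eq_eval, coe_aeval_eq_eval] using h1
  have hord0 : m 0 * a0 ^ 3 + m 1 * b0 ^ 3 = 0 := by
    have := congrArg (Polynomial.eval 0) heq2
    simp [hα', hβ'] at this
    exact this.resolve_right (by simpa [Polynomial.coeff_zero_eq_eval_zero] using hx0)
  generalize (aeval ![α, β] (C.layer M 2) : Polynomial K) = B2 at heq2 hA2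
  set s := eval ![a0 ^ 3, b0 ^ 3] (C.layer M 2) with hsdef
  -- The derivative at `u = 0`; the derivative of `x` drops out by `hord0`.
  have hord1 : s + (m 0 * (3 * a0 ^ 2 * a1) + m 1 * (3 * b0 ^ 2 * b1)) * x.eval 0 = 0 := by
    have := congrArg (fun p => (Polynomial.derivative p).eval 0) heq2
    simp only [Polynomial.derivative_add, Polynomial.derivative_mul,
      Polynomial.derivative_X, Polynomial.derivative_C, Polynomial.eval_add, Polynomial.eval_mul,
      Polynomial.eval_X, Polynomial.eval_pow, Polynomial.eval_C, hA2, hα', hβ',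
      Polynomial.derivative_pow, Polynomial.derivative_zero, Polynomial.eval_zero] at this
    apply (mul_eq_zero.mp (?_ : x.eval 0 ^ 2 * _ = 0)).resolve_left (pow_ne_zero 2 hx0)
    simp at this
    linear_combination this - 3 * x.eval 0 ^ 2 * (Polynomial.derivative x).eval 0 * hord0
  have hm0 : m ≠ 0 := by
    rintro rfl
    apply hA3
    rw [hm]; simp [lin]
  have hab0 : a0 ≠ 0 ∨ b0 ≠ 0 := by
    by_contra! hcon
    rw [hcon.1, hcon.2] at hdet
    apply hab
    linear_combination hdet
  have hs_iff : s ≠ 0 ↔ a0 ≠ 0 ∧ b0 ≠ 0 := by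
    constructor
    · intro hs0
      constructor
      · intro ha
        apply hs0
        rw [ha] at hord0 hord1 hab0
        have hb : b0 ≠ 0 := by simpa using hab0
        have : m 1 = 0 := by simpa [hb] using hord0
        rw [this] at hord1
        linear_combination hord1
      · intro hb
        apply hs0
        rw [hb] at hord0 hord1 hab0
        have ha : a0 ≠ 0 := by simpa using hab0
        have : m 0 = 0 := by simpa [ha] using hord0
        rw [this] at hord1
        linear_combination hord1
    -- If `s = 0`, then `m` satisfies two linear equations whose determinant is, up to sign, `a₀²
    -- b₀² · wedge a b`, so `m = 0`, against smoothness.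
    · rintro ⟨ha, hb⟩ hs0
      rw [hs0, zero_add] at hord1
      have h1 := (mul_eq_zero.mp hord1).resolve_right hx0
      have h2 : m 0 * (a0 ^ 2 * a1) + m 1 * (b0 ^ 2 * b1) = 0 := by
        apply mul_left_cancel₀ h3
        linear_combination h1
      have h4 : m 0 * (a0 ^ 2 * wedge a b) = 0 := by
        linear_combination (-b1) * hord0 + b0 * h2 + m 0 * a0 ^ 2 * hdet
      have h5 : m 1 * (b0 ^ 2 * wedge a b) = 0 := by
        linear_combination a1 * hord0 - a0 * h2 + m 1 * b0 ^ 2 * hdet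
      apply hm0
      funext i
      fin_cases i
      · simpa [ha, hab] using h4
      · simpa [hb, hab] using h5
  have hmult : ∀ y z x0 : K, m 0 * y + m 1 * z = 0 →
      (C.lineMultiplicity P.rep (fun i => M i 0 * x0 + M i 1 * y + M i 2 * z) = 2 ↔
        eval ![y, z] (C.layer M 2) ≠ 0) := by
    intro y z x0 hyz
    have h3' : eval ![y, z] (C.layer M 3) = 0 := by rw [hm]; simpa using hyz
    rw [lineMultiplicity, aeval_line hC hp, h3', hPe]
    rw [← Polynomial.rootMultiplicity_sq_mul (R := Polynomial.X *
      Polynomial.C (eval ![y, z] (C.layer M 0)) + Polynomial.C (eval ![y, z] (C.layer M 1)) *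
      (1 + Polynomial.C x0 * Polynomial.X) + Polynomial.C (eval ![y, z] (C.layer M 2)) *
      (2 * Polynomial.C x0 + Polynomial.C x0 ^ 2 * Polynomial.X))]
    rw [map_zero]
    ring_nf
  have htan : ∀ x0 y z : K, ∑ i, eval P.rep (pderiv i C.eqn) *
      (M i 0 * x0 + M i 1 * y + M i 2 * z) = m 0 * y + m 1 * z := by
    intro x0 y z
    rw [sum_pderiv_mul hC hp hPe, hm]; simp
  rw [← hs_iff]
  constructor
  · intro hT
    -- The direction `(a₀³, b₀³)` spans the tangent line together with `P`.
    have hq := hT (fun i => M i 0 * 0 + M i 1 * a0 ^ 3 + M i 2 * b0 ^ 3) ?_ (by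
      rw [htan]; exact hord0)
    · exact (hmult _ _ _ hord0).mp hq
    · rw [LinearIndependent.pair_iff]
      intro r t hrt
      have h1 : ∀ j, (N * M) j 0 * r + t * ((N * M) j 1 * a0 ^ 3 + (N * M) j 2 * b0 ^ 3) = 0 := by
        intro j
        have : ∑ i, N j i * (r • P.rep + t • (fun i => M i 0 * 0 + M i 1 * a0 ^ 3 +
            M i 2 * b0 ^ 3) : Fin 3 → K) i = 0 := by rw [hrt]; simp
        rw [← this]
        simp only [Matrix.mul_apply, Fin.sum_univ_three, Pi.add_apply, Pi.smul_apply, smul_eq_mul,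
          ← hp]
        ring
      rw [h'] at h1
      have e0 := h1 0
      have e1 := h1 1
      have e2 := h1 2
      simp at e0 e1 e2
      refine ⟨e0, ?_⟩
      rcases hab0 with ha | hb
      · exact e1.resolve_right ha
      · exact e2.resolve_right hb
  · intro hs0 q hq htq
    have hqe := exists_frame_coords h q
    set y := N.mulVec q 1 with hy
    set z := N.mulVec q 2 with hz
    set x0 := N.mulVec q 0 with hx0d
    have htq' : m 0 * y + m 1 * z = 0 := by
      rw [← htan x0, ← htq]
      refine Finset.sum_congr rfl fun i _ => ?_
      conv_rhs => rw [hqe]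
    rw [hqe]
    refine (hmult y z x0 htq').mpr ?_
    have hyz : ¬ (y = 0 ∧ z = 0) := by
      rintro ⟨hy0, hz0⟩
      rw [LinearIndependent.pair_iff] at hq
      have := hq x0 (-1) (by
        rw [hqe, hy0, hz0]
        funext i
        simp [← hp]; ring)
      simpa using this.2
    -- The nonzero form `m` has only one zero up to scaling, so every tangent direction is a
    -- multiple of `(a₀³, b₀³)`.
    obtain ⟨r, hr, hry, hrz⟩ : ∃ r : K, r ≠ 0 ∧ y = r * a0 ^ 3 ∧ z = r * b0 ^ 3 := by
      obtain ⟨ha, hb⟩ := hs_iff.mp hs0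
      have hcross : y * b0 ^ 3 = z * a0 ^ 3 := by
        have h6 : m 0 * (y * b0 ^ 3 - z * a0 ^ 3) = 0 := by
          linear_combination b0 ^ 3 * htq' - z * hord0
        have h7 : m 1 * (y * b0 ^ 3 - z * a0 ^ 3) = 0 := by
          linear_combination -a0 ^ 3 * htq' + y * hord0
        by_contra hne
        have hne' := sub_ne_zero.mpr hne
        apply hm0
        funext i
        fin_cases i
        · exact (mul_eq_zero.mp h6).resolve_right hne'
        · exact (mul_eq_zero.mp h7).resolve_right hne'
      refine ⟨y / a0 ^ 3, ?_, by field_simp, by field_simp; linear_combination -hcross⟩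
      intro h0
      have hy0 : y = 0 := by simpa [ha] using h0
      refine hyz ⟨hy0, ?_⟩
      rw [hy0, zero_mul] at hcross
      simpa [ha] using hcross.symm
    have hfin : eval ![y, z] (C.layer M 2) = r ^ 2 * s := by
      rw [hsdef, ← eval_smul_of_isHomogeneous (isHomogeneous_layer hC M (k := 2) (j := 2) rfl)]
      congr 2
      rw [hry, hrz]
      funext i; fin_cases i <;> rfl
    rw [hfin]
    exact mul_ne_zero (pow_ne_zero 2 hr) hs0

end PlaneCurve

end

/-! ### Recognizing a parametrization as a normalization -/

open scoped LinearAlgebra.Projectivization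

noncomputable section

open MvPolynomial BinaryForm IntermediateField

variable {K : Type*} [Field K]

namespace PlaneCurve

variable {C : PlaneCurve K} {φ : PLineMorphism K}

/-- Nullstellensatz for the prime ideal of the curve: a polynomial vanishing on the parametrized
cone vanishes on the whole cone over the curve. -/
theorem dvd_of_eval_evalVec_eq_zero [IsAlgClosed K] (hd : φ.degree = 4)
    (himg : φ.image = C.points) {H : MvPolynomial (Fin 3) K}
    (hH : ∀ v, eval (φ.evalVec v) H = 0) : C.eqn ∣ H := by
  have hmem : H ∈ vanishingIdeal K (zeroLocus K (Ideal.span {C.eqn})) := by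
    rw [mem_vanishingIdeal_iff]
    intro x hx
    have hFx : eval x C.eqn = 0 := by
      exact (mem_zeroLocus_iff.mp hx) C.eqn (Ideal.mem_span_singleton_self _)
    change eval x H = 0
    by_cases hx0 : x = 0
    · have h0 := φ.evalVec_smul 0 0
      rw [hd, zero_pow (by norm_num), zero_smul, zero_smul] at h0
      rw [hx0, ← h0]
      exact hH 0
    · have hmk := (C.mk_mem_points hx0).mpr hFx
      rw [← himg] at hmk
      obtain ⟨Q, hQ⟩ := hmk
      rw [PLineMorphism.toFun, Projectivization.mk_eq_mk_iff'] at hQ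
      obtain ⟨c, hc⟩ := hQ
      have hc0 : c ≠ 0 := by
        rintro rfl
        rw [zero_smul] at hc
        exact φ.evalVec_ne_zero Q.rep_nonzero hc.symm
      -- Scaling the source by `r` scales the value by `r⁴`, so fourth roots reach every point of
      -- the affine cone.
      obtain ⟨r, hr⟩ := IsAlgClosed.exists_pow_nat_eq (c⁻¹) (n := 4) (by norm_num)
      have : x = φ.evalVec (r • Q.rep) := by
        rw [φ.evalVec_smul, hd, hr, ← hc, smul_smul, inv_mul_cancel₀ hc0, one_smul]
      rw [this]
      exact hH _
  rw [IsPrime.vanishingIdeal_zeroLocus, Ideal.mem_span_singleton] at hmem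
  exact hmem

/-- The parametrization of the affine cone over the curve. -/
def coneMap (φ : PLineMorphism K) : MvPolynomial (Fin 3) K →ₐ[K] Polynomial (Polynomial K) :=
  aeval fun i => Polynomial.X * Polynomial.C (dehom (φ.form i))

theorem eval_eval_coneMap (H : MvPolynomial (Fin 3) K) (t w : K) :
    ((coneMap φ H).eval (Polynomial.C w)).eval t = eval (w • φ.evalVec ![1, t]) H := by
  have : (Polynomial.evalRingHom t).comp ((Polynomial.evalRingHom (Polynomial.C w)).comp
      (coneMap φ).toRingHom) = eval (w • φ.evalVec ![1, t]) := by
    apply MvPolynomial.ringHom_ext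
    · intro r
      simp [coneMap, algHom_C, Polynomial.algebraMap_apply]
    · intro i
      simp [coneMap, eval_dehom, PLineMorphism.evalVec]
      ring
  exact congrArg (fun g => g H) this

theorem coneMap_eq_zero_iff [IsAlgClosed K] (hd : φ.degree = 4)
    (himg : φ.image = C.points) (H : MvPolynomial (Fin 3) K) :
    coneMap φ H = 0 ↔ C.eqn ∣ H := by
  have : Infinite K := IsAlgClosed.instInfinite
  constructor
  · intro h
    apply dvd_of_eval_evalVec_eq_zero hd himg
    -- The cone map only sees the parameters with `s ≠ 0`; the factor `s` covers the rest.
    have hpoly : aeval φ.form H = 0 := by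
      apply mul_left_cancel₀ (X_ne_zero (R := K) (0 : Fin 2))
      rw [mul_zero]
      apply MvPolynomial.funext
      intro v
      rw [map_mul, eval_X, map_zero]
      by_cases hv : v 0 = 0
      · rw [hv, zero_mul]
      · have h1 : eval v (aeval φ.form H) = eval (φ.evalVec v) H := by
          rw [← coe_aeval_eq_eval, ← coe_aeval_eq_eval]
          change aeval v (aeval φ.form H) = aeval (φ.evalVec v) H
          rw [← AlgHom.comp_apply, comp_aeval]
          rfl
        have h2 : v = v 0 • ![1, v 1 / v 0] := by
          funext i
          fin_cases i
          · simp
          · simp; field_simp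
        rw [h1, h2, φ.evalVec_smul, ← eval_eval_coneMap, h]
        simp
    intro v
    have h1 : eval v (aeval φ.form H) = eval (φ.evalVec v) H := by
      rw [← coe_aeval_eq_eval, ← coe_aeval_eq_eval]
      change aeval v (aeval φ.form H) = aeval (φ.evalVec v) H
      rw [← AlgHom.comp_apply, comp_aeval]
      rfl
    rw [← h1, hpoly, map_zero]
  · rintro ⟨G, rfl⟩
    rw [map_mul]
    have hF : coneMap φ C.eqn = 0 := by
      rw [coneMap, aeval_mul_of_isHomogeneous C.homogeneous]
      have : aeval (fun i => Polynomial.C (dehom (φ.form i))) C.eqn =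
          Polynomial.C (aeval (fun i => dehom (φ.form i)) C.eqn) :=
        MvPolynomial.aeval_algebraMap_apply (Polynomial (Polynomial K))
          (fun i => dehom (φ.form i)) C.eqn
      rw [this]
      have h0 : aeval (fun i => dehom (φ.form i)) C.eqn = 0 := by
        apply Polynomial.funext
        intro t
        have h1 : (aeval (fun i => dehom (φ.form i)) C.eqn).eval t =
            eval (φ.evalVec ![1, t]) C.eqn := by
          have : (Polynomial.evalRingHom t).comp
              (aeval (fun i => dehom (φ.form i)) :
                MvPolynomial (Fin 3) K →ₐ[K] Polynomial K).toRingHom =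
              eval (φ.evalVec ![1, t]) := by
            apply MvPolynomial.ringHom_ext
            · intro r; simp [algHom_C]
            · intro i; simp [eval_dehom, PLineMorphism.evalVec]
          exact congrArg (fun g => g C.eqn) this
        rw [h1, eval_evalVec_eq_zero himg (fun h0 => by simpa using congrFun h0 0),
          Polynomial.eval_zero]
      rw [h0, map_zero, mul_zero]
    rw [hF, zero_mul]

/-- The cone parameter `x` is common to all coordinates and cancels in their ratios, so the function
field lands in the copy of `K(t)` inside `T`. -/
theorem exists_algHom_of_injective {T : Type*} [Field T] [Algebra K T]
    {g : C.coordRing →ₐ[K] T} (hg : Function.Injective g) {c : Polynomial K →ₐ[K] T}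
    (hc : Function.Injective c) {x : T} (hx : x ≠ 0)
    (hgc : ∀ i, g (Ideal.Quotient.mk _ (X i)) = x * c (dehom (φ.form i))) :
    ∃ e : C.functionField →ₐ[K] RatFunc K, ∀ i j, e (C.ratio i j) = φ.ratio i j := by
  obtain ⟨Θ, hΘ⟩ : ∃ Θ : FractionRing C.coordRing →ₐ[K] T, ∀ y, Θ (algebraMap _ _ y) = g y :=
    ⟨IsFractionRing.liftAlgHom (g := g) hg, fun y => IsFractionRing.lift_algebraMap hg y⟩
  obtain ⟨ι, hι⟩ : ∃ ι : RatFunc K →ₐ[K] T, ∀ y, ι (algebraMap _ _ y) = c y :=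
    ⟨IsFractionRing.liftAlgHom (g := c) hc, fun y => IsFractionRing.lift_algebraMap hc y⟩
  have hratio : ∀ i k, Θ (C.coord i / C.coord k) = ι (φ.ratio i k) := by
    intro i k
    have hco : ∀ i, Θ (C.coord i) = x * ι (algebraMap _ _ (dehom (φ.form i))) := by
      intro i
      rw [coord, hΘ, hgc, hι]
    rw [map_div₀, hco, hco, mul_div_mul_left _ _ hx, ← map_div₀]
    rfl
  have hle : C.functionField ≤ ι.fieldRange.comap Θ := by
    refine adjoin_le_iff.mpr ?_
    rintro _ ⟨i, k, rfl⟩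
    exact ⟨φ.ratio i k, (hratio i k).symm⟩
  have hmem : ∀ z : C.functionField, (Θ.comp C.functionField.val) z ∈ ι.range := fun z => hle z.2
  let e₀ : C.functionField →ₐ[K] RatFunc K :=
    (AlgEquiv.ofInjectiveField ι).symm.toAlgHom.comp
      ((Θ.comp C.functionField.val).codRestrict ι.range hmem)
  have he : ∀ z, ι (e₀ z) = Θ z := by
    intro z
    have := (AlgEquiv.ofInjectiveField ι).apply_symm_apply
      ((Θ.comp C.functionField.val).codRestrict ι.range hmem z)
    exact congrArg Subtype.val this
  refine ⟨e₀, fun i k => ι.injective ?_⟩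
  have := he (C.ratio i k)
  rw [ratio, hratio] at this
  exact this

theorem exists_algHom_functionField [IsAlgClosed K] (hd : φ.degree = 4)
    (himg : φ.image = C.points) :
    ∃ e : C.functionField →ₐ[K] RatFunc K, ∀ i j, e (C.ratio i j) = φ.ratio i j := by
  let θ : C.coordRing →ₐ[K] Polynomial (Polynomial K) :=
    Ideal.Quotient.liftₐ _ (coneMap φ) (fun H hH =>
      (coneMap_eq_zero_iff hd himg H).mpr (Ideal.mem_span_singleton.mp hH))
  have hθ : ∀ H, θ (Ideal.Quotient.mk _ H) = coneMap φ H := fun H => rfl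
  have hθi : Function.Injective θ := by
    rw [injective_iff_map_eq_zero]
    intro x hx
    obtain ⟨H, rfl⟩ := Ideal.Quotient.mk_surjective x
    rw [hθ, coneMap_eq_zero_iff hd himg] at hx
    rwa [Ideal.Quotient.eq_zero_iff_mem, Ideal.mem_span_singleton]
  let j : Polynomial (Polynomial K) →ₐ[K] FractionRing (Polynomial (Polynomial K)) :=
    IsScalarTower.toAlgHom K _ _
  have hj : Function.Injective j := IsFractionRing.injective _ _
  let k : Polynomial K →ₐ[K] Polynomial (Polynomial K) := IsScalarTower.toAlgHom K _ _
  refine exists_algHom_of_injective (g := j.comp θ) (c := j.comp k) (x := j Polynomial.X)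
    (by rw [AlgHom.coe_comp]; exact hj.comp hθi)
    (by rw [AlgHom.coe_comp]; exact hj.comp Polynomial.C_injective)
    (by rw [map_ne_zero_iff j hj]; exact Polynomial.X_ne_zero) fun i => ?_
  rw [AlgHom.comp_apply, AlgHom.comp_apply, ← map_mul, hθ, coneMap, aeval_X]
  rfl

/-- A parametrization of degree four with a pencil of cubes is a normalization. -/
theorem isNormalization_of_hasCubicPencil [IsAlgClosed K] (hd : φ.degree = 4) (hC : C.degree = 4)
    (himg : φ.image = C.points) {P : PPlane K} {l a b : Fin 2 → K}
    (hpen : φ.HasCubicPencil P l a b) : C.IsNormalization φ := by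
  have : Infinite K := IsAlgClosed.instInfinite
  obtain ⟨e₀, he⟩ := exists_algHom_functionField hd himg
  refine ⟨himg, ?_⟩
  obtain ⟨k, hk⟩ : ∃ k, φ.fn (Pi.single k 1) ≠ 0 := by
    by_contra! h
    obtain ⟨i, hi⟩ := φ.no_common_zero ![1, 0] (fun h0 => by simpa using congrFun h0 0)
    apply hi
    have h1 := h i
    rw [φ.fn_single, map_eq_zero_iff _ (IsFractionRing.injective _ _)] at h1
    rw [← eval_dehom, h1, Polynomial.eval_zero]
  have hmem : ∀ c d, φ.fn c / φ.fn d ∈ e₀.fieldRange := by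
    have h1 : ∀ c, φ.fn c / φ.fn (Pi.single k 1) ∈ e₀.fieldRange := by
      intro c
      rw [φ.fn_eq_sum, Finset.sum_div]
      refine sum_mem fun i _ => ?_
      rw [mul_div_assoc, ← φ.fn_single, ← φ.ratio_eq]
      exact mul_mem (IntermediateField.algebraMap_mem _ _) ⟨_, he i k⟩
    intro c d
    rw [← div_div_div_cancel_right₀ hk]
    exact IntermediateField.div_mem _ (h1 c) (h1 d)
  -- By the tower law the index of the image of `K(C)` divides the degree of each function in it.
  -- The degree 4 comes from a point off the curve, the degree 3 from the pencil.
  have hdvd : ∀ x ∈ e₀.fieldRange, Module.finrank e₀.fieldRange (RatFunc K) ∣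
      Module.finrank K⟮x⟯ (RatFunc K) := fun x hx =>
    ⟨_, ((mul_comm _ _).trans
      (relfinrank_mul_finrank_top (adjoin_simple_le_iff.mpr hx))).symm⟩
  obtain ⟨Q, hQ⟩ := C.exists_notMem_points (by omega)
  obtain ⟨N, M, h', h, hp⟩ := exists_frame_of_point Q
  have hne : φ.fn (N 2) ≠ 0 := by
    intro h0
    rw [PLineMorphism.fn, map_eq_zero_iff _ (IsFractionRing.injective _ _)] at h0
    have h1 : φ.pull (N 2) = 0 :=
      dehom_injective (φ.isHomogeneous_pull _) (isHomogeneous_zero _ _ _) (by rw [h0, map_zero])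
    refine not_dvd_linear hC (row_ne_zero h' 2) (dvd_of_eval_evalVec_eq_zero hd himg fun v => ?_)
    have h2 := φ.eval_pull (N 2) v
    rw [h1, map_zero] at h2
    simpa using h2.symm
  have h4 := hdvd _ (hmem (N 1) (N 2))
  rw [φ.finrank_adjoin_fn_of_notMem_image h hp (himg ▸ hQ) hne, hd] at h4
  obtain ⟨hl, hab, c, d, -, -, -, hc, hdd⟩ := hpen
  have h3 := hdvd _ (hmem c d)
  rw [PLineMorphism.fn_div_fn_eq hl hc hdd, RatFunc.finrank_adjoin_moebius_cube
    (by rw [wedge_comm]; exact neg_ne_zero.mpr hab)] at h3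
  have h1 : Module.finrank e₀.fieldRange (RatFunc K) = 1 := by
    have := Nat.dvd_gcd h3 h4
    exact Nat.dvd_one.mp this
  have hfd : FiniteDimensional e₀.fieldRange (RatFunc K) :=
    Module.finite_of_finrank_pos (by rw [h1]; exact one_pos)
  have htop : e₀.fieldRange = ⊤ :=
    IntermediateField.eq_of_le_of_finrank_le' le_top (by simp [h1])
  have hsurj : Function.Surjective e₀ := AlgHom.fieldRange_eq_top.mp htop
  exact ⟨AlgEquiv.ofBijective e₀ ⟨e₀.injective, hsurj⟩, he⟩

end PlaneCurve

end

/-! ### Coordinate changes on line and plane, and relations between pencils -/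

open scoped LinearAlgebra.Projectivization

noncomputable section

open MvPolynomial BinaryForm

variable {K : Type*} [Field K]

namespace BinaryForm

/-- A quartic that vanishes at every point is zero. -/
theorem coeffs_eq_zero_of_quartic [Infinite K] {e : Fin 5 → K}
    (h : ∀ t : K, e 0 + e 1 * t + e 2 * t ^ 2 + e 3 * t ^ 3 + e 4 * t ^ 4 = 0) : ∀ i, e i = 0 := by
  have hp : Polynomial.C (e 0) + Polynomial.C (e 1) * Polynomial.X +
      Polynomial.C (e 2) * Polynomial.X ^ 2 + Polynomial.C (e 3) * Polynomial.X ^ 3 +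
      Polynomial.C (e 4) * Polynomial.X ^ 4 = 0 := by
    apply Polynomial.funext
    intro t
    simpa using h t
  intro i
  have hi := congrArg (fun p => Polynomial.coeff p (i : ℕ)) hp
  fin_cases i <;> simpa [Polynomial.coeff_C, Polynomial.coeff_X, Polynomial.coeff_X_pow] using hi

theorem eval_lin_eq_of_wedge_ne_zero {m n : Fin 2 → K} (h : wedge m n ≠ 0) (k v : Fin 2 → K) :
    eval v (lin k) =
      wedge k n / wedge m n * eval v (lin m) + wedge m k / wedge m n * eval v (lin n) := by
  field_simp
  simp only [eval_lin, wedge]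
  ring

theorem exists_eval_lin_eq {m n : Fin 2 → K} (h : wedge m n ≠ 0) (s t : K) :
    ∃ v, eval v (lin m) = s ∧ eval v (lin n) = t := by
  refine ⟨![(n 1 * s - m 1 * t) / wedge m n, (m 0 * t - n 0 * s) / wedge m n], ?_, ?_⟩ <;>
  · simp only [eval_lin, Matrix.cons_val_zero, Matrix.cons_val_one]
    field_simp
    simp only [wedge]
    ring

theorem eq_zero_of_eval_lin_eq_zero {m n v : Fin 2 → K} (h : wedge m n ≠ 0)
    (hm : eval v (lin m) = 0) (hn : eval v (lin n) = 0) : v = 0 := by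
  rw [eval_lin] at hm hn
  funext i
  fin_cases i
  · apply mul_left_cancel₀ h
    simp only [wedge, Pi.zero_apply, Fin.zero_eta]
    linear_combination n 1 * hm - m 1 * hn
  · apply mul_left_cancel₀ h
    simp only [wedge, Pi.zero_apply, Fin.mk_one]
    linear_combination m 0 * hn - n 0 * hm

theorem eval_lin_eq_zero_of_wedge {m n v : Fin 2 → K} (hm : m ≠ 0) (h : wedge m n = 0)
    (hv : eval v (lin m) = 0) : eval v (lin n) = 0 := by
  rw [eval_lin] at *
  simp only [wedge] at h
  obtain ⟨i, hi⟩ := Function.ne_iff.mp hm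
  fin_cases i
  · apply mul_left_cancel₀ hi
    simp only [Fin.zero_eta]
    linear_combination n 0 * hv + v 1 * h
  · apply mul_left_cancel₀ hi
    simp only [Fin.mk_one]
    linear_combination n 1 * hv - v 0 * h

theorem wedge_eq_zero_of_eval_lin {m n v : Fin 2 → K} (hv : v ≠ 0)
    (hm : eval v (lin m) = 0) (hn : eval v (lin n) = 0) : wedge m n = 0 := by
  by_contra h
  exact hv (eq_zero_of_eval_lin_eq_zero h hm hn)

theorem exists_eq_smul_of_wedge {m n : Fin 2 → K} (hm : m ≠ 0) (h : wedge m n = 0) :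
    ∃ r : K, n = r • m := by
  simp only [wedge] at h
  obtain ⟨i, hi⟩ := Function.ne_iff.mp hm
  refine ⟨n i / m i, ?_⟩
  rw [Pi.zero_apply] at hi
  funext j
  simp only [Pi.smul_apply, smul_eq_mul]
  field_simp
  fin_cases i <;> fin_cases j <;> simp <;> first | linear_combination h | linear_combination -h

end BinaryForm

namespace PLineMorphism

variable {φ ψ : PLineMorphism K} {P P' : PPlane K} {l a b l' a' b' : Fin 2 → K}

/-- The forms `m, n` change coordinates on the line and `N` on the plane. Linear independence of the
forms of `ψ` makes `N` invertible. -/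
theorem projectivelyEquivalent_of_pull {m n : Fin 2 → K} (hmn : wedge m n ≠ 0)
    (N : Matrix (Fin 3) (Fin 3) K)
    (hN : ∀ i v, eval v (φ.pull (N i)) = eval ![eval v (lin m), eval v (lin n)] (ψ.form i))
    (hψ : ∀ x : Fin 3 → K, (∀ s t, ∑ i, x i * ψ.evalVec ![s, t] i = 0) → x = 0) :
    ProjectivelyEquivalent φ.image ψ.image := by
  have hNφ : ∀ v, N.mulVec (φ.evalVec v) = ψ.evalVec ![eval v (lin m), eval v (lin n)] := by
    intro v
    funext i
    rw [evalVec, ← hN, φ.eval_pull]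
    rfl
  have hu : IsUnit N := by
    rw [← Matrix.linearIndependent_rows_iff_isUnit, Fintype.linearIndependent_iff]
    intro x hx i
    refine congrFun (hψ x fun s t => ?_) i
    obtain ⟨v, rfl, rfl⟩ := exists_eval_lin_eq hmn s t
    rw [← hNφ]
    have : x ⬝ᵥ N.mulVec (φ.evalVec v) = 0 := by
      rw [Matrix.dotProduct_mulVec]
      have h0 : Matrix.vecMul x N = 0 := by
        rw [← hx]
        funext j
        simp [Matrix.vecMul, dotProduct, Matrix.row]
      rw [h0, zero_dotProduct]
    exact this
  let A : (Fin 3 → K) ≃ₗ[K] (Fin 3 → K) :=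
    LinearEquiv.ofBijective (Matrix.mulVecLin N)
      ⟨Matrix.mulVec_injective_iff_isUnit.mpr hu, Matrix.mulVec_surjective_iff_isUnit.mpr hu⟩
  have hA : ∀ v, A (φ.evalVec v) = ψ.evalVec ![eval v (lin m), eval v (lin n)] := hNφ
  have hne : ∀ {v : Fin 2 → K}, v ≠ 0 → ![eval v (lin m), eval v (lin n)] ≠ 0 := by
    intro v hv h0
    exact hv (eq_zero_of_eval_lin_eq_zero hmn (congrFun h0 0) (congrFun h0 1))
  refine ⟨A, Set.Subset.antisymm ?_ ?_⟩
  · rintro _ ⟨_, ⟨Q, rfl⟩, rfl⟩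
    have h := ψ.mk_mem_image (hne Q.rep_nonzero)
    simp only [← hA] at h
    exact h
  · rintro _ ⟨Q, rfl⟩
    obtain ⟨v, h0, h1⟩ := exists_eval_lin_eq hmn (Q.rep 0) (Q.rep 1)
    have hQ : ![eval v (lin m), eval v (lin n)] = Q.rep := by
      rw [h0, h1]; funext i; fin_cases i <;> rfl
    have hv : v ≠ 0 := by
      rintro rfl
      apply Q.rep_nonzero
      rw [← hQ]; funext i; fin_cases i <;> simp [-eval_zero]
    refine ⟨_, φ.mk_mem_image hv, ?_⟩
    simp only [Projectivization.map_mk, toFun]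
    congr 1
    rw [← hQ]
    exact hA v

/-- The composition of a morphism with an injective linear map. -/
def postcomp (ψ : PLineMorphism K) (B : Matrix (Fin 3) (Fin 3) K)
    (hB : ∀ x, B.mulVec x = 0 → x = 0) : PLineMorphism K where
  degree := ψ.degree
  form i := ψ.pull (B i)
  homogeneous i := ψ.isHomogeneous_pull (B i)
  no_common_zero v hv := by
    by_contra! h0
    refine ψ.evalVec_ne_zero hv (hB _ (funext fun i => ?_))
    rw [Pi.zero_apply, ← h0 i, ψ.eval_pull]
    rfl

theorem evalVec_postcomp (ψ : PLineMorphism K) (B : Matrix (Fin 3) (Fin 3) K)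
    (hB : ∀ x, B.mulVec x = 0 → x = 0) (v : Fin 2 → K) :
    (ψ.postcomp B hB).evalVec v = B.mulVec (ψ.evalVec v) := by
  funext i
  rw [evalVec, postcomp, ψ.eval_pull]
  rfl

theorem pull_postcomp (ψ : PLineMorphism K) (B : Matrix (Fin 3) (Fin 3) K)
    (hB : ∀ x, B.mulVec x = 0 → x = 0) (c : Fin 3 → K) :
    (ψ.postcomp B hB).pull c = ψ.pull (Matrix.vecMul c B) := by
  simp only [pull, postcomp, Matrix.vecMul, dotProduct, Finset.mul_sum, map_sum, Finset.sum_mul,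
    map_mul]
  rw [Finset.sum_comm]
  exact Finset.sum_congr rfl fun i _ => Finset.sum_congr rfl fun j _ => by ring

/-- A set that is projectively equivalent to the image of `ψ` is itself the image of a morphism
with the same linear system. -/
theorem exists_of_projectivelyEquivalent {S : Set (PPlane K)}
    (h : ProjectivelyEquivalent S ψ.image) :
    ∃ φ : PLineMorphism K, φ.degree = ψ.degree ∧ φ.image = S ∧
      (∀ c, ∃ c', φ.pull c' = ψ.pull c) ∧ ∀ c', ∃ c, φ.pull c' = ψ.pull c := by
  obtain ⟨A, hA⟩ := h
  obtain ⟨B, hBv⟩ : ∃ B : Matrix (Fin 3) (Fin 3) K, ∀ v, B.mulVec v = A.symm v :=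
    ⟨LinearMap.toMatrix' (A.symm : (Fin 3 → K) →ₗ[K] (Fin 3 → K)),
      LinearMap.toMatrix'_mulVec _⟩
  obtain ⟨B', hBv'⟩ : ∃ B : Matrix (Fin 3) (Fin 3) K, ∀ v, B.mulVec v = A v :=
    ⟨LinearMap.toMatrix' (A : (Fin 3 → K) →ₗ[K] (Fin 3 → K)), LinearMap.toMatrix'_mulVec _⟩
  have hB : ∀ x, B.mulVec x = 0 → x = 0 := fun x hx => by
    rw [hBv] at hx
    exact A.symm.map_eq_zero_iff.mp hx
  have hBB : B' * B = 1 := by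
    apply Matrix.mulVec_injective
    funext v
    rw [← Matrix.mulVec_mulVec, hBv, hBv', A.apply_symm_apply, Matrix.one_mulVec]
  refine ⟨ψ.postcomp B hB, rfl, ?_, fun c => ⟨Matrix.vecMul c B', ?_⟩,
    fun c => ⟨_, ψ.pull_postcomp B hB c⟩⟩
  · have hinj := Projectivization.map_injective (A : (Fin 3 → K) →ₗ[K] (Fin 3 → K)) A.injective
    apply hinj.image_injective
    rw [hA]
    have hQ : ∀ Q, Projectivization.map (A : (Fin 3 → K) →ₗ[K] (Fin 3 → K)) A.injective
        ((ψ.postcomp B hB).toFun Q) = ψ.toFun Q := by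
      intro Q
      simp only [toFun, Projectivization.map_mk]
      congr 1
      rw [evalVec_postcomp, hBv]
      exact A.apply_symm_apply _
    rw [image, image, ← Set.range_comp]
    exact congrArg Set.range (funext hQ)
  · rw [pull_postcomp, Matrix.vecMul_vecMul, hBB, Matrix.vecMul_one]

theorem HasCubicPencil.symm (h : φ.HasCubicPencil P l a b) : φ.HasCubicPencil P l b a := by
  obtain ⟨hl, hab, c, d, hcd, hc, hd, hpc, hpd⟩ := h
  exact ⟨hl, by rw [wedge_comm]; exact neg_ne_zero.mpr hab, d, c,
    LinearIndependent.pair_symm_iff.mp hcd, hd, hc, hpd, hpc⟩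

theorem hasCubicPencil_mk {v : Fin 2 → K} (hv : v ≠ 0) (hl : l ≠ 0) (hab : wedge a b ≠ 0)
    (hlv : eval v (lin l) = 0) {c d : Fin 3 → K} (hc : φ.pull c = lin l * lin a ^ 3)
    (hd : φ.pull d = lin l * lin b ^ 3) :
    φ.HasCubicPencil (Projectivization.mk K (φ.evalVec v) (φ.evalVec_ne_zero hv)) l a b := by
  have hker : ∀ c : Fin 3 → K, eval v (φ.pull c) = 0 →
      ∑ i, c i * (Projectivization.mk K (φ.evalVec v) (φ.evalVec_ne_zero hv)).rep i = 0 := by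
    intro c hc
    obtain ⟨r, hr⟩ := Projectivization.exists_smul_eq_mk_rep K (φ.evalVec v)
      (φ.evalVec_ne_zero hv)
    rw [← hr]
    rw [φ.eval_pull] at hc
    have : (∑ i, c i * (r • φ.evalVec v) i) = (r : K) * ∑ i, c i * φ.evalVec v i := by
      rw [Finset.mul_sum]
      refine Finset.sum_congr rfl fun i _ => ?_
      rw [Pi.smul_apply, Units.smul_def, smul_eq_mul]; ring
    rw [this, hc, mul_zero]
  have hlin : lin l ≠ 0 := by
    intro h0
    apply linPoly_ne_zero hl
    rw [← dehom_lin, h0, map_zero]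
  refine ⟨hl, hab, c, d, ?_, hker c (by rw [hc, map_mul, hlv, zero_mul]),
    hker d (by rw [hd, map_mul, hlv, zero_mul]), hc, hd⟩
  rw [LinearIndependent.pair_iff]
  intro x y hxy
  have h1 : lin l * (C x * lin a ^ 3 + C y * lin b ^ 3) = 0 := by
    have h2 := congrArg φ.pull hxy
    rw [φ.pull_add, φ.pull_smul, φ.pull_smul, hc, hd] at h2
    rw [show φ.pull 0 = 0 by simp [pull]] at h2
    linear_combination h2
  have h2 := (mul_eq_zero.mp h1).resolve_left hlin
  constructor
  · obtain ⟨w, hw1, hw2⟩ := exists_eval_lin_eq hab 1 0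
    simpa [hw1, hw2, -eval_lin] using congrArg (eval w) h2
  · obtain ⟨w, hw1, hw2⟩ := exists_eval_lin_eq hab 0 1
    simpa [hw1, hw2, -eval_lin] using congrArg (eval w) h2

/-- The zero of `l` is the only preimage of `P`, because `a` and `b` have no common zero. So the
pencil's point and the zero of `l` determine each other. -/
theorem HasCubicPencil.eq_iff (h : φ.HasCubicPencil P l a b) (h' : φ.HasCubicPencil P' l' a' b') :
    P = P' ↔ wedge l l' = 0 := by
  obtain ⟨v, hv, hlv⟩ := exists_ne_zero_eval_lin_eq_zero h.1
  have hP := h.toFun_eq hv hlv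
  rw [← eval_lin] at hlv
  constructor
  · intro hPP
    rw [← hPP] at h'
    obtain ⟨hl', hab', c, d, -, hc, hd, hpc, hpd⟩ := h'
    have hker : ∀ c : Fin 3 → K, ∑ i, c i * P.rep i = 0 → eval v (φ.pull c) = 0 := by
      intro c hc
      rw [φ.toFun_mk hv] at hP
      obtain ⟨r, hr⟩ := Projectivization.exists_smul_eq_mk_rep K (φ.evalVec v)
        (φ.evalVec_ne_zero hv)
      rw [hP] at hr
      rw [← hr] at hc
      rw [φ.eval_pull]
      have : (∑ i, c i * (r • φ.evalVec v) i) = (r : K) * ∑ i, c i * φ.evalVec v i := by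
        rw [Finset.mul_sum]
        refine Finset.sum_congr rfl fun i _ => ?_
        rw [Pi.smul_apply, Units.smul_def, smul_eq_mul]; ring
      rw [this] at hc
      exact (mul_eq_zero.mp hc).resolve_left r.ne_zero
    have h1 := hker c hc
    have h2 := hker d hd
    rw [hpc, map_mul, map_pow] at h1
    rw [hpd, map_mul, map_pow] at h2
    by_cases hl'v : eval v (lin l') = 0
    · exact wedge_eq_zero_of_eval_lin hv hlv hl'v
    · refine absurd (eq_zero_of_eval_lin_eq_zero hab' ?_ ?_) hv
      · exact pow_eq_zero_iff (three_ne_zero) |>.mp ((mul_eq_zero.mp h1).resolve_left hl'v)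
      · exact pow_eq_zero_iff (three_ne_zero) |>.mp ((mul_eq_zero.mp h2).resolve_left hl'v)
  · intro hw
    rw [← hP]
    exact h'.toFun_eq hv (by simpa using eval_lin_eq_zero_of_wedge h.1 hw hlv)

/-- Two pencils of cubes in the same net of quartics have a common member. -/
theorem HasCubicPencil.exists_relation (h : φ.HasCubicPencil P l a b)
    (h' : φ.HasCubicPencil P' l' a' b') :
    ∃ x y z w : K, ¬ (x = 0 ∧ y = 0) ∧ ∀ v,
      eval v (lin l) * (x * eval v (lin a) ^ 3 + y * eval v (lin b) ^ 3) =
        eval v (lin l') * (z * eval v (lin a') ^ 3 + w * eval v (lin b') ^ 3) := by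
  obtain ⟨-, -, c, d, hcd, -, -, hpc, hpd⟩ := h
  obtain ⟨-, -, c', d', hcd', -, -, hpc', hpd'⟩ := h'
  -- Four vectors in a space of dimension three.
  have hdep : ¬ LinearIndependent K ![c, d, c', d'] := by
    intro hli
    have := hli.fintype_card_le_finrank
    simp at this
  obtain ⟨g, hg, i, hi⟩ := Fintype.not_linearIndependent_iff.mp hdep
  rw [Fin.sum_univ_four] at hg
  simp only [Matrix.cons_val] at hg
  refine ⟨g 0, g 1, -g 2, -g 3, ?_, fun v => ?_⟩
  · rintro ⟨h0, h1⟩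
    rw [h0, h1, zero_smul, zero_smul, zero_add, zero_add] at hg
    obtain ⟨h2, h3⟩ := LinearIndependent.pair_iff.mp hcd' _ _ hg
    fin_cases i
    exacts [hi h0, hi h1, hi h2, hi h3]
  · have h1 := congrArg (fun c => eval v (φ.pull c)) hg
    simp only [pull_add, pull_smul, hpc, hpd, hpc', hpd', map_add, map_mul, eval_C, map_pow] at h1
    rw [show φ.pull 0 = 0 by simp [pull], map_zero] at h1
    linear_combination h1

end PLineMorphism

end

/-! ### Normal forms of nets with two pencils of cubes -/

open scoped LinearAlgebra.Projectivization

noncomputable section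

open MvPolynomial BinaryForm

variable {K : Type*} [Field K]

theorem eval_familyMorphism (h3 : (3 : K) ≠ 0) {β : K}
    (hβ : β * (β - 1) * (β ^ 2 + β + 1) ≠ 0) (v : Fin 2 → K) (i : Fin 3) :
    eval v ((familyMorphism h3 β hβ).form i) =
      ![v 0 * (v 1 + (β ^ 2 + β + 1) / 3 * v 0) ^ 3, v 1 * (v 1 + β * v 0) ^ 3,
        v 1 * (v 1 + v 0) ^ 3] i := by
  fin_cases i <;> simp [familyMorphism]

theorem eval_cuspMorphism (v : Fin 2 → K) (i : Fin 3) :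
    eval v ((cuspMorphism K).form i) =
      ![v 0 ^ 4, v 1 * v 0 ^ 3, v 1 * (v 1 + v 0) ^ 3] i := by
  fin_cases i <;> simp [cuspMorphism]

theorem familyMorphism_independent [Infinite K] (h3 : (3 : K) ≠ 0) {β : K}
    (hβ : β * (β - 1) * (β ^ 2 + β + 1) ≠ 0) (x : Fin 3 → K)
    (hx : ∀ s t, ∑ i, x i * (familyMorphism h3 β hβ).evalVec ![s, t] i = 0) : x = 0 := by
  obtain ⟨h12, hq⟩ := mul_ne_zero_iff.mp hβ
  obtain ⟨_, h1⟩ := mul_ne_zero_iff.mp h12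
  simp only [PLineMorphism.evalVec, eval_familyMorphism, Fin.sum_univ_three] at hx
  set α := (β ^ 2 + β + 1) / 3 with hα
  have hα0 : α ≠ 0 := div_ne_zero hq h3
  have key := coeffs_eq_zero_of_quartic (e := ![α ^ 3 * x 0,
    3 * α ^ 2 * x 0 + β ^ 3 * x 1 + x 2, 3 * α * x 0 + 3 * β ^ 2 * x 1 + 3 * x 2,
    x 0 + 3 * β * x 1 + 3 * x 2, x 1 + x 2]) fun t => by
      have := hx 1 t
      simp at this ⊢
      linear_combination this
  have e0 := key 0
  have e3 := key 3
  have e4 := key 4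
  simp only [Matrix.cons_val] at e0 e3 e4
  have x0 : x 0 = 0 := (mul_eq_zero.mp e0).resolve_left (pow_ne_zero 3 hα0)
  have x1 : x 1 = 0 := by
    apply mul_left_cancel₀ (mul_ne_zero h3 h1)
    linear_combination e3 - x0 - 3 * e4
  have x2 : x 2 = 0 := by linear_combination e4 - x1
  funext i
  fin_cases i
  exacts [x0, x1, x2]

theorem cuspMorphism_independent [Infinite K] (x : Fin 3 → K)
    (hx : ∀ s t, ∑ i, x i * (cuspMorphism K).evalVec ![s, t] i = 0) : x = 0 := by
  simp only [PLineMorphism.evalVec, eval_cuspMorphism, Fin.sum_univ_three] at hx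
  have key := coeffs_eq_zero_of_quartic (e := ![x 0, x 1 + x 2, 3 * x 2, 3 * x 2, x 2])
    fun t => by
      have := hx 1 t
      simp at this ⊢
      linear_combination this
  have e0 := key 0
  have e1 := key 1
  have e4 := key 4
  simp only [Matrix.cons_val] at e0 e1 e4
  rw [e4, add_zero] at e1
  funext i
  fin_cases i
  exacts [e0, e1, e4]

/-- The parameters of two pencils of cubes with a common member. -/
theorem eq_of_common_member [Infinite K] (h3 : (3 : K) ≠ 0) {β γ δ x y z w : K} (hβ0 : β ≠ 0)
    (hβ1 : β ≠ 1) (hγδ : γ ≠ δ) (hxy : ¬ (x = 0 ∧ y = 0))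
    (h : ∀ s t, t * (x * (t + β * s) ^ 3 + y * (t + s) ^ 3) =
      s * (z * (t + γ * s) ^ 3 + w * (t + δ * s) ^ 3)) :
    β ^ 2 + β + 1 ≠ 0 ∧ (γ = (β ^ 2 + β + 1) / 3 ∨ δ = (β ^ 2 + β + 1) / 3) := by
  have key := coeffs_eq_zero_of_quartic (e := ![-(γ ^ 3 * z + δ ^ 3 * w),
    β ^ 3 * x + y - 3 * (γ ^ 2 * z + δ ^ 2 * w), 3 * (β ^ 2 * x + y - (γ * z + δ * w)),
    3 * β * x + 3 * y - (z + w), x + y]) fun t => by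
      have := h 1 t
      simp only [Matrix.cons_val]
      linear_combination this
  have e0 := key 0
  have e1 := key 1
  have e2 := (mul_eq_zero.mp (key 2)).resolve_left h3
  have e3 := key 3
  have e4 := key 4
  simp only [Matrix.cons_val] at e0 e1 e3 e4
  have hX : x * (β - 1) ≠ 0 := by
    refine mul_ne_zero (fun hx => hxy ⟨hx, ?_⟩) (sub_ne_zero.mpr hβ1)
    rw [hx, zero_add] at e4
    exact e4
  obtain ⟨α, hα⟩ : ∃ α, α = (β ^ 2 + β + 1) / 3 := ⟨_, rfl⟩
  have h3α : 3 * α = β ^ 2 + β + 1 := by rw [hα]; field_simp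
  have p0 : z + w = 3 * (x * (β - 1)) := by linear_combination -e3 + 3 * e4
  -- With `p0, p2` and `e0`, these are the moments `γⁱ z + δⁱ w` for `i = 0, …, 3`, the last one
  -- being zero.
  have p1 : γ * z + δ * w = x * (β - 1) * (β + 1) := by linear_combination -e2 + e4
  have p2 : γ ^ 2 * z + δ ^ 2 * w = x * (β - 1) * α := by
    apply mul_left_cancel₀ h3
    linear_combination -e1 + e4 - x * (β - 1) * h3α
  -- Moments obey the recurrence with characteristic polynomial `(T - γ)(T - δ)`; `r1` and `r2` are
  -- its two instances, divided by `x (β - 1)`.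
  have r1 : α = (γ + δ) * (β + 1) - 3 * (γ * δ) := by
    apply mul_left_cancel₀ hX
    linear_combination -p2 + (γ + δ) * p1 - γ * δ * p0
  have r2 : (γ + δ) * α = γ * δ * (β + 1) := by
    apply mul_left_cancel₀ hX
    linear_combination -(γ + δ) * p2 + γ * δ * p1 - e0
  -- Hence `γ, δ` are the roots of `β T² - α (β + 1) T + α² = (β T - α)(T - α)`.
  have hE2 : β * (γ * δ) = α ^ 2 := by
    linear_combination -α * r1 - (β + 1) * r2 + γ * δ * h3α
  have hE1 : β * (γ + δ) = α * (β + 1) := by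
    linear_combination -(β + 1) * r1 - 3 * r2 + (γ + δ) * h3α
  rw [← hα, ← h3α]
  have hα0 : α ≠ 0 := by
    intro h0
    rw [h0, zero_mul] at hE1
    have h4 : γ + δ = 0 := (mul_eq_zero.mp hE1).resolve_left hβ0
    rw [h0, zero_pow two_ne_zero] at hE2
    have h5 : γ * δ = 0 := (mul_eq_zero.mp hE2).resolve_left hβ0
    apply hγδ
    rcases mul_eq_zero.mp h5 with h6 | h6 <;> simp_all
  refine ⟨mul_ne_zero h3 hα0, ?_⟩
  have hprod : (β * γ - α) * (γ - α) = 0 := by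
    linear_combination -γ * -hE1 - hE2
  rcases mul_eq_zero.mp hprod with h6 | h6
  · right
    apply mul_left_cancel₀ hβ0
    linear_combination hE1 - h6
  · left
    linear_combination h6

/-- A zero of `a` at the zero of `l'` would make all four coefficients of the relation vanish in
turn. This permits normalizing `a` to have coefficient 1 at `t`. -/
theorem ne_zero_of_common_member [Infinite K] (h3 : (3 : K) ≠ 0)
    {p q p' q' r k r' k' x y z w : K} (hq : q ≠ 0) (hpq : p * q' - q * p' ≠ 0) (hr : r ≠ 0)
    (hr' : r' ≠ 0) (hrk : r * k' - k * r' ≠ 0) (hxy : ¬ (x = 0 ∧ y = 0))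
    (h : ∀ s t, t * (x * (q * s + p * t) ^ 3 + y * (q' * s + p' * t) ^ 3) =
      s * (z * (k * s + r * t) ^ 3 + w * (k' * s + r' * t) ^ 3)) : p ≠ 0 := by
  rintro rfl
  have hp' : p' ≠ 0 := by
    rintro rfl
    simp at hpq
  have key := coeffs_eq_zero_of_quartic (e := ![-(k ^ 3 * z + k' ^ 3 * w),
    q ^ 3 * x + q' ^ 3 * y - 3 * (k ^ 2 * r * z + k' ^ 2 * r' * w),
    3 * (q' ^ 2 * p' * y - (k * r ^ 2 * z + k' * r' ^ 2 * w)),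
    3 * (q' * p' ^ 2 * y) - (r ^ 3 * z + r' ^ 3 * w), p' ^ 3 * y]) fun t => by
      have := h 1 t
      simp only [Matrix.cons_val]
      linear_combination this
  have e1 := key 1
  have e2 := (mul_eq_zero.mp (key 2)).resolve_left h3
  have e3 := key 3
  have y0 : y = 0 := (mul_eq_zero.mp (key 4)).resolve_left (pow_ne_zero 3 hp')
  simp only [Matrix.cons_val] at e1 e3
  have z0 : z = 0 := by
    apply mul_left_cancel₀ (mul_ne_zero (pow_ne_zero 2 hr) hrk)
    rw [y0] at e2 e3
    linear_combination -k' * e3 + r' * e2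
  have w0 : w = 0 := by
    apply mul_left_cancel₀ (pow_ne_zero 3 hr')
    rw [y0, z0] at e3
    linear_combination -e3
  refine hxy ⟨?_, y0⟩
  apply mul_left_cancel₀ (pow_ne_zero 3 hq)
  rw [y0, z0, w0] at e1
  linear_combination e1

namespace PLineMorphism

variable {φ : PLineMorphism K} {P P' : PPlane K} {l a b l' a' b' : Fin 2 → K}

theorem eval_pull_smul (x : K) (c : Fin 3 → K) (v : Fin 2 → K) :
    eval v (φ.pull (x • c)) = x * eval v (φ.pull c) := by
  rw [pull_smul, map_mul, eval_C]

theorem eval_lin_smul (x : K) (l v : Fin 2 → K) : eval v (lin (x • l)) = x * eval v (lin l) := by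
  simp only [eval_lin, Pi.smul_apply, smul_eq_mul]
  ring

theorem projectivelyEquivalent_of_pull_rows {ψ : PLineMorphism K} {m n : Fin 2 → K}
    (hmn : wedge m n ≠ 0)
    (hψ : ∀ x : Fin 3 → K, (∀ s t, ∑ i, x i * ψ.evalVec ![s, t] i = 0) → x = 0)
    {c₀ c₁ c₂ : Fin 3 → K}
    (h₀ : ∀ v, eval v (φ.pull c₀) = eval ![eval v (lin m), eval v (lin n)] (ψ.form 0))
    (h₁ : ∀ v, eval v (φ.pull c₁) = eval ![eval v (lin m), eval v (lin n)] (ψ.form 1))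
    (h₂ : ∀ v, eval v (φ.pull c₂) = eval ![eval v (lin m), eval v (lin n)] (ψ.form 2)) :
    ProjectivelyEquivalent φ.image ψ.image := by
  refine projectivelyEquivalent_of_pull hmn (Matrix.of ![c₀, c₁, c₂]) (fun i v => ?_) hψ
  fin_cases i
  exacts [h₀ v, h₁ v, h₂ v]

/-- In coordinates `t = l` and `s` a multiple of `l'` chosen so that `b` becomes `t + s` up to a
scalar, the first pencil gives two forms of the family. The relation between the pencils shows that
`a'` or `b'` gives the third. -/
theorem exists_family_of_pencils [Infinite K] (h3 : (3 : K) ≠ 0)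
    (hpen : φ.HasCubicPencil P l a b) (hpen' : φ.HasCubicPencil P' l' a' b')
    (hll' : wedge l' l ≠ 0) (ha : wedge l a ≠ 0) (hb : wedge l b ≠ 0) (ha' : wedge l' a' ≠ 0)
    (hb' : wedge l' b' ≠ 0) :
    ∃ (β : K) (hβ : β * (β - 1) * (β ^ 2 + β + 1) ≠ 0),
      ProjectivelyEquivalent φ.image (familyMorphism h3 β hβ).image := by
  obtain ⟨x, y, z, w, hxy, hrel⟩ := hpen.exists_relation hpen'
  obtain ⟨-, hab, c, d, -, -, -, hpc, hpd⟩ := hpen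
  obtain ⟨-, hab', c', d', -, -, -, hpc', hpd'⟩ := hpen'
  have coord := eval_lin_eq_of_wedge_ne_zero hll'
  have surj := exists_eval_lin_eq hll'
  have hwedge : ∀ m n : Fin 2 → K, wedge l' m / wedge l' l * (wedge n l / wedge l' l) -
      wedge m l / wedge l' l * (wedge l' n / wedge l' l) = - (wedge m n / wedge l' l) := by
    intro m n
    field_simp
    simp only [wedge]
    ring
  have hq : ∀ {m : Fin 2 → K}, wedge l m ≠ 0 → wedge m l / wedge l' l ≠ 0 := fun h =>
    div_ne_zero (by rw [wedge_comm]; exact neg_ne_zero.mpr h) hll'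
  have hqa := hq ha
  have hqb := hq hb
  have hra := div_ne_zero ha' hll'
  have hrb := div_ne_zero hb' hll'
  have hwab := (hwedge a b).trans_ne (neg_ne_zero.mpr (div_ne_zero hab hll'))
  have hwab' := (hwedge a' b').trans_ne (neg_ne_zero.mpr (div_ne_zero hab' hll'))
  have ca := coord a
  have cb := coord b
  have ca' := coord a'
  have cb' := coord b'
  generalize wedge a l / wedge l' l = q at *
  generalize wedge b l / wedge l' l = q' at *
  generalize wedge l' a / wedge l' l = p at *
  generalize wedge l' b / wedge l' l = p' at *
  generalize wedge a' l / wedge l' l = k at *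
  generalize wedge b' l / wedge l' l = k' at *
  generalize wedge l' a' / wedge l' l = r at *
  generalize wedge l' b' / wedge l' l = r' at *
  have hrel' : ∀ s t, t * (x * (q * s + p * t) ^ 3 + y * (q' * s + p' * t) ^ 3) =
      s * (z * (k * s + r * t) ^ 3 + w * (k' * s + r' * t) ^ 3) := by
    intro s t
    obtain ⟨v, rfl, rfl⟩ := surj s t
    rw [← ca, ← cb, ← ca', ← cb']
    exact hrel v
  have hp : p ≠ 0 := ne_zero_of_common_member h3 hqa hwab hra hrb hwab' hxy hrel'
  have hp' : p' ≠ 0 := by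
    refine ne_zero_of_common_member h3 (p' := p) (q' := q) (x := y) (y := x)
      (z := z) (w := w) hqb ?_ hra hrb
      hwab' (fun h => hxy h.symm) fun s t => ?_
    · intro h0
      apply hwab
      linear_combination -h0
    · rw [← hrel']
      ring
  -- The coefficient of `s` in `a`, once `a` is scaled to `t + β s` and `s = (q' / p') l'`.
  set β := q * p' / (p * q') with hβ
  have hβ0 : β ≠ 0 := div_ne_zero (mul_ne_zero hqa hp') (mul_ne_zero hp hqb)
  have hβ1 : β ≠ 1 := by
    rw [hβ, Ne, div_eq_one_iff_eq (mul_ne_zero hp hqb)]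
    intro h0
    apply hwab
    linear_combination -h0
  have hγδ : k / r * (p' / q') ≠ k' / r' * (p' / q') := by
    intro h0
    have h1 := mul_right_cancel₀ (div_ne_zero hp' hqb) h0
    rw [div_eq_div_iff hra hrb] at h1
    apply hwab'
    linear_combination -h1
  obtain ⟨hα, hγ⟩ := eq_of_common_member h3 (x := x * p ^ 3) (y := y * p' ^ 3)
    (z := z * r ^ 3 * (p' / q')) (w := w * r' ^ 3 * (p' / q')) hβ0 hβ1 hγδ
    (by simpa [hp, hp'] using hxy) fun s t => by
      have h1 := hrel' (p' / q' * s) t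
      have h2 : q' * (p' / q' * s) = p' * s := by field_simp
      have h4 : q * (p' / q' * s) = p * (β * s) := by rw [hβ]; field_simp
      have h5 : k * (p' / q' * s) = r * (k / r * (p' / q') * s) := by field_simp
      have h6 : k' * (p' / q' * s) = r' * (k' / r' * (p' / q') * s) := by field_simp
      rw [h2, h4, h5, h6] at h1
      linear_combination h1
  have hβ' : β * (β - 1) * (β ^ 2 + β + 1) ≠ 0 :=
    mul_ne_zero (mul_ne_zero hβ0 (sub_ne_zero.mpr hβ1)) hα
  refine ⟨β, hβ', ?_⟩
  set α := (β ^ 2 + β + 1) / 3 with hαdef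
  have hthird : ∃ e, ∀ v, eval v (φ.pull e) = eval v (lin ((q' / p') • l')) *
      (eval v (lin l) + α * eval v (lin ((q' / p') • l'))) ^ 3 := by
    rcases hγ with h0 | h0
    · refine ⟨(q' / p' / r ^ 3) • c', fun v => ?_⟩
      rw [eval_pull_smul, hpc', map_mul, map_pow, ca', ← h0, eval_lin_smul]
      field_simp
      ring
    · refine ⟨(q' / p' / r' ^ 3) • d', fun v => ?_⟩
      rw [eval_pull_smul, hpd', map_mul, map_pow, cb', ← h0, eval_lin_smul]
      field_simp
      ring
  obtain ⟨e, he⟩ := hthird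
  refine projectivelyEquivalent_of_pull_rows (m := (q' / p') • l') (n := l) ?_
    (familyMorphism_independent h3 hβ') (c₀ := e) (c₁ := (1 / p ^ 3) • c)
    (c₂ := (1 / p' ^ 3) • d) (fun v => ?_) (fun v => ?_) (fun v => ?_)
  · have : wedge ((q' / p') • l') l = q' / p' * wedge l' l := by
      simp only [wedge, Pi.smul_apply, smul_eq_mul]; ring
    rw [this]
    exact mul_ne_zero (div_ne_zero hqb hp') hll'
  · rw [eval_familyMorphism, he, hαdef]
    simp only [Matrix.cons_val]
  · rw [eval_familyMorphism]
    simp only [Matrix.cons_val]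
    rw [eval_pull_smul, hpc, map_mul, map_pow, ca, eval_lin_smul, hβ]
    field_simp
    ring
  · rw [eval_familyMorphism]
    simp only [Matrix.cons_val]
    rw [eval_pull_smul, hpd, map_mul, map_pow, cb, eval_lin_smul]
    field_simp
    ring

/-- The Jacobian at `Q` takes values in the line spanned by `φ(Q)`, so at `Q` all members of the net
have the same logarithmic derivative `k`. -/
theorem exists_of_differentialVanishesAt {Q : PLine K} (hQ : φ.DifferentialVanishesAt Q) :
    ∃ k : Fin 2 → K, ∀ c j, eval Q.rep (pderiv j (φ.pull c)) = k j * eval Q.rep (φ.pull c) := by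
  have hmem : ∀ u, φ.jacobian Q.rep u ∈ Submodule.span K {φ.evalVec Q.rep} := by
    intro u
    have h := LinearMap.congr_fun hQ (Submodule.Quotient.mk u)
    rw [differential, Submodule.mapQ_apply, LinearMap.zero_apply,
      Submodule.Quotient.mk_eq_zero] at h
    exact h
  choose k hk using fun j => Submodule.mem_span_singleton.mp (hmem (Pi.single j 1))
  refine ⟨k, fun c j => ?_⟩
  have hj : ∀ i, eval Q.rep (pderiv j (φ.form i)) = k j * φ.evalVec Q.rep i := by
    intro i
    have := congrFun (hk j) i
    rw [Pi.smul_apply, smul_eq_mul] at this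
    rw [this]
    simp [jacobian]
  rw [φ.eval_pull, pull, map_sum, map_sum, Finset.mul_sum]
  refine Finset.sum_congr rfl fun i _ => ?_
  rw [pderiv_C_mul, map_mul, eval_C, hj]
  ring

/-- If neither vanished at `Q`, equal logarithmic derivatives of `l a³` and `l b³` would give `3
l(Q) · wedge a b = 0`, so `l(Q) = 0`. The condition for `a` then leaves `l = 0`. -/
theorem HasCubicPencil.eval_lin_eq_zero_or (h3 : (3 : K) ≠ 0) (hpen : φ.HasCubicPencil P l a b)
    {Q : PLine K} (hQ : φ.DifferentialVanishesAt Q) :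
    eval Q.rep (lin a) = 0 ∨ eval Q.rep (lin b) = 0 := by
  obtain ⟨k, hk⟩ := exists_of_differentialVanishesAt hQ
  obtain ⟨hl, hab, c, d, -, -, -, hpc, hpd⟩ := hpen
  by_contra! hcon
  obtain ⟨ha, hb⟩ := hcon
  have hpd' : ∀ (m : Fin 2 → K) j, pderiv j (lin m) = C (m j) := by
    intro m j
    fin_cases j <;> simp [lin, pderiv_X]
  have key : ∀ (m : Fin 2 → K), eval Q.rep (lin m) ≠ 0 → (∃ c, φ.pull c = lin l * lin m ^ 3) →
      ∀ j, l j * eval Q.rep (lin m) + 3 * eval Q.rep (lin l) * m j =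
        k j * eval Q.rep (lin l) * eval Q.rep (lin m) := by
    rintro m hm ⟨c, hc⟩ j
    have h1 := hk c j
    rw [hc, Derivation.leibniz, Derivation.leibniz_pow, hpd', hpd'] at h1
    simp only [smul_eq_mul, nsmul_eq_mul, map_add, map_mul, map_pow, eval_C, map_natCast] at h1
    apply mul_left_cancel₀ (pow_ne_zero 2 hm)
    push_cast at h1
    linear_combination h1
  have ea := key a ha ⟨c, hpc⟩
  have eb := key b hb ⟨d, hpd⟩
  have hl0 : eval Q.rep (lin l) = 0 := by
    obtain ⟨i, hi⟩ := Function.ne_iff.mp Q.rep_nonzero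
    apply mul_left_cancel₀ (mul_ne_zero h3 (mul_ne_zero hab hi))
    rw [mul_zero]
    simp only [eval_lin, wedge] at ea eb ⊢
    fin_cases i
    · have a1 := ea 1
      have b1 := eb 1
      simp only [Fin.zero_eta]
      linear_combination (a 0 * Q.rep 0 + a 1 * Q.rep 1) * b1 -
        (b 0 * Q.rep 0 + b 1 * Q.rep 1) * a1
    · have a1 := ea 0
      have b1 := eb 0
      simp only [Fin.mk_one]
      linear_combination -(a 0 * Q.rep 0 + a 1 * Q.rep 1) * b1 +
        (b 0 * Q.rep 0 + b 1 * Q.rep 1) * a1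
  apply hl
  funext j
  have := ea j
  rw [hl0, mul_zero, zero_mul, add_zero, mul_zero, zero_mul] at this
  exact (mul_eq_zero.mp this).resolve_right ha

/-- When `a'` is proportional to `a`, both `l a³` and `l' a³` lie in the net. As `a` is a
combination of `l` and `l'`, so does `a⁴`. The coordinates are `t = l` and `s` the multiple of `a`
for which `b` becomes `t + s` up to a scalar. -/
theorem projectivelyEquivalent_cusp_of_pencils [Infinite K]
    (hpen : φ.HasCubicPencil P l a b) (hpen' : φ.HasCubicPencil P' l' a' b')
    (hll' : wedge l' l ≠ 0) (ha : wedge l a ≠ 0) (hb : wedge l b ≠ 0) (haa' : wedge a a' = 0) :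
    ProjectivelyEquivalent φ.image (cuspMorphism K).image := by
  obtain ⟨-, hab, c, d, -, -, -, hpc, hpd⟩ := hpen
  obtain ⟨-, hab', c', d', -, -, -, hpc', hpd'⟩ := hpen'
  obtain ⟨r, hr⟩ := exists_eq_smul_of_wedge (left_ne_zero_of_wedge hab) haa'
  have hr0 : r ≠ 0 := by
    rintro rfl
    exact left_ne_zero_of_wedge hab' (by rw [hr, zero_smul])
  have hal : wedge a l ≠ 0 := by rw [wedge_comm]; exact neg_ne_zero.mpr ha
  have cb := eval_lin_eq_of_wedge_ne_zero hal b
  have ca := eval_lin_eq_of_wedge_ne_zero hll' a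
  have hy : wedge b l / wedge a l ≠ 0 :=
    div_ne_zero (by rw [wedge_comm]; exact neg_ne_zero.mpr hb) hal
  have hx : wedge a b / wedge a l ≠ 0 := div_ne_zero hab hal
  generalize wedge b l / wedge a l = y at *
  generalize wedge a b / wedge a l = x at *
  generalize wedge a l / wedge l' l = q at *
  generalize wedge l' a / wedge l' l = p at *
  refine projectivelyEquivalent_of_pull_rows (m := (y / x) • a) (n := l) ?_
    cuspMorphism_independent (c₀ := (y / x) ^ 4 • ((q / r ^ 3) • c' + p • c))
    (c₁ := (y / x) ^ 3 • c) (c₂ := (1 / x ^ 3) • d) (fun v => ?_) (fun v => ?_) (fun v => ?_)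
  · have : wedge ((y / x) • a) l = y / x * wedge a l := by
      simp only [wedge, Pi.smul_apply, smul_eq_mul]; ring
    rw [this]
    exact mul_ne_zero (div_ne_zero hy hx) hal
  · rw [eval_cuspMorphism]
    simp only [Matrix.cons_val]
    rw [eval_pull_smul, pull_add, map_add, eval_pull_smul, eval_pull_smul, hpc, hpc', hr,
      eval_lin_smul, map_mul, map_mul, map_pow, map_pow, eval_lin_smul]
    have h1 := ca v
    generalize eval v (lin a) = A at *
    generalize eval v (lin l) = L at *
    generalize eval v (lin l') = L' at *
    have h2 : q / r ^ 3 * (L' * (r * A) ^ 3) = q * L' * A ^ 3 := by field_simp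
    rw [h2]
    linear_combination -(y / x) ^ 4 * A ^ 3 * h1
  · rw [eval_cuspMorphism]
    simp only [Matrix.cons_val]
    rw [eval_pull_smul, hpc, eval_lin_smul, map_mul, map_pow]
    ring
  · rw [eval_cuspMorphism]
    simp only [Matrix.cons_val]
    rw [eval_pull_smul, hpd, map_mul, map_pow, cb, eval_lin_smul]
    field_simp
    ring

end PLineMorphism

end

/-! ### The pencils of the family and of the cuspidal quartic -/

open scoped LinearAlgebra.Projectivization

noncomputable section

open MvPolynomial BinaryForm

variable {K : Type*} [Field K]

namespace PLineMorphism

theorem eval_pull_family (h3 : (3 : K) ≠ 0) {β : K}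
    (hβ : β * (β - 1) * (β ^ 2 + β + 1) ≠ 0) (c : Fin 3 → K) (v : Fin 2 → K) :
    eval v ((familyMorphism h3 β hβ).pull c) =
      c 0 * (v 0 * (v 1 + (β ^ 2 + β + 1) / 3 * v 0) ^ 3) + c 1 * (v 1 * (v 1 + β * v 0) ^ 3) +
        c 2 * (v 1 * (v 1 + v 0) ^ 3) := by
  rw [PLineMorphism.eval_pull, Fin.sum_univ_three]
  simp only [evalVec, eval_familyMorphism, Matrix.cons_val]

theorem eval_pull_cusp (c : Fin 3 → K) (v : Fin 2 → K) :
    eval v ((cuspMorphism K).pull c) =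
      c 0 * v 0 ^ 4 + c 1 * (v 1 * v 0 ^ 3) + c 2 * (v 1 * (v 1 + v 0) ^ 3) := by
  rw [PLineMorphism.eval_pull, Fin.sum_univ_three]
  simp only [evalVec, eval_cuspMorphism, Matrix.cons_val]

/-- A morphism with the linear system of the family has two pencils of cubes. -/
theorem exists_pencils_of_family [Infinite K] (h3 : (3 : K) ≠ 0) {β : K}
    (hβ : β * (β - 1) * (β ^ 2 + β + 1) ≠ 0) {φ : PLineMorphism K}
    (hφ : ∀ c, ∃ c', φ.pull c' = (familyMorphism h3 β hβ).pull c) :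
    ∃ (P P' : PPlane K) (l a b l' a' b' : Fin 2 → K), φ.HasCubicPencil P l a b ∧
      φ.HasCubicPencil P' l' a' b' ∧ wedge l l' ≠ 0 ∧ wedge l a ≠ 0 ∧ wedge l b ≠ 0 ∧
        wedge l' a' ≠ 0 ∧ wedge l' b' ≠ 0 := by
  obtain ⟨h12, hq⟩ := mul_ne_zero_iff.mp hβ
  obtain ⟨hβ0, h1⟩ := mul_ne_zero_iff.mp h12
  obtain ⟨c₁, hc₁⟩ := hφ ![0, 1, 0]
  obtain ⟨c₂, hc₂⟩ := hφ ![0, 0, 1]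
  obtain ⟨c₃, hc₃⟩ := hφ ![1, 0, 0]
  -- The root `α / β` of the quadratic: `β³ s (t + (α/β) s)³ = s (t + α s)³ + α t ((t + β s)³ - (t +
  -- s)³)`.
  obtain ⟨c₄, hc₄⟩ := hφ ![1 / β ^ 3, (β ^ 2 + β + 1) / 3 / β ^ 3, -((β ^ 2 + β + 1) / 3 / β ^ 3)]
  have hα : (β ^ 2 + β + 1) / 3 ≠ 0 := div_ne_zero hq h3
  have w1 : (![1, 0] : Fin 2 → K) ≠ 0 := fun h => by simpa using congrFun h 0
  have w2 : (![0, 1] : Fin 2 → K) ≠ 0 := fun h => by simpa using congrFun h 1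
  refine ⟨_, _, ![0, 1], ![β, 1], ![1, 1], ![1, 0], ![(β ^ 2 + β + 1) / 3, 1],
    ![(β ^ 2 + β + 1) / 3 / β, 1],
    hasCubicPencil_mk (v := ![1, 0]) (c := c₁) (d := c₂) w1 w2 ?_ (by simp)
      (MvPolynomial.funext fun v => ?_) (MvPolynomial.funext fun v => ?_),
    hasCubicPencil_mk (v := ![0, 1]) (c := c₃) (d := c₄) w2 w1 ?_ (by simp)
      (MvPolynomial.funext fun v => ?_) (MvPolynomial.funext fun v => ?_), ?_, ?_, ?_, ?_, ?_⟩
  · simpa [wedge] using h1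
  · rw [hc₁, eval_pull_family]
    simp only [map_mul, map_pow, eval_lin, Matrix.cons_val]
    ring
  · rw [hc₂, eval_pull_family]
    simp only [map_mul, map_pow, eval_lin, Matrix.cons_val]
    ring
  · have : wedge ![(β ^ 2 + β + 1) / 3, 1] ![(β ^ 2 + β + 1) / 3 / β, 1] =
        (β ^ 2 + β + 1) / 3 * (β - 1) / β := by
      simp [wedge]
      field_simp
    rw [this]
    exact div_ne_zero (mul_ne_zero hα h1) hβ0
  · rw [hc₃, eval_pull_family]
    simp only [map_mul, map_pow, eval_lin, Matrix.cons_val]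
    ring
  · rw [hc₄, eval_pull_family]
    simp
    field_simp
    ring
  · simp [wedge]
  · simpa [wedge] using hβ0
  · simp [wedge]
  · simp [wedge]
  · simp [wedge]

/-- A morphism with the linear system of the cuspidal quartic has two pencils of cubes. -/
theorem exists_pencils_of_cusp [Infinite K] (h2 : (2 : K) ≠ 0) {φ : PLineMorphism K}
    (hφ : ∀ c, ∃ c', φ.pull c' = (cuspMorphism K).pull c) :
    ∃ P P' : PPlane K, φ.HasCubicPencil P ![0, 1] ![1, 0] ![1, 1] ∧
      φ.HasCubicPencil P' ![3, 2] ![1, 0] ![1, 2] := by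
  obtain ⟨c₁, hc₁⟩ := hφ ![0, 1, 0]
  obtain ⟨c₂, hc₂⟩ := hφ ![0, 0, 1]
  -- The second pencil is `(3 s + 2 t) s³` and `(3 s + 2 t)(s + 2 t)³ = 3 s⁴ + 4 t s³ + 16 t (t +
  -- s)³`.
  obtain ⟨c₃, hc₃⟩ := hφ ![3, 2, 0]
  obtain ⟨c₄, hc₄⟩ := hφ ![3, 4, 16]
  refine ⟨_, _,
    hasCubicPencil_mk (v := ![1, 0]) (c := c₁) (d := c₂) (fun h => by simpa using congrFun h 0)
      (fun h => by simpa using congrFun h 1) ?_ (by simp)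
      (MvPolynomial.funext fun v => ?_) (MvPolynomial.funext fun v => ?_),
    hasCubicPencil_mk (v := ![2, -3]) (c := c₃) (d := c₄)
      (fun h => h2 (by simpa using congrFun h 0)) (fun h => h2 (by simpa using congrFun h 1)) ?_
      (by simp; ring) (MvPolynomial.funext fun v => ?_) (MvPolynomial.funext fun v => ?_)⟩
  · simp [wedge]
  · rw [hc₁, eval_pull_cusp]
    simp
  · rw [hc₂, eval_pull_cusp]
    simp only [map_mul, map_pow, eval_lin, Matrix.cons_val]
    ring
  · simpa [wedge] using h2
  · rw [hc₃, eval_pull_cusp]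
    simp only [map_mul, map_pow, eval_lin, Matrix.cons_val]
    ring
  · rw [hc₄, eval_pull_cusp]
    simp
    ring

/-- In the net the coefficients of `s² t², s t³, t⁴` are in the ratio 3 : 3 : 1. For `l a³` these
two conditions, with `l₀` eliminated, give `(2 a₀ - a₁)(a₀ - a₁) = 0`, and each factor determines
`l` up to a scalar. -/
theorem eq_zero_or_of_pull_cusp_eq [Infinite K] (h3 : (3 : K) ≠ 0) {l a : Fin 2 → K}
    (hl : l ≠ 0) (ha : a 1 ≠ 0) {c : Fin 3 → K}
    (h : (cuspMorphism K).pull c = lin l * lin a ^ 3) : l 0 = 0 ∨ 2 * l 0 = 3 * l 1 := by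
  have key := coeffs_eq_zero_of_quartic (e := ![c 0 - l 0 * a 0 ^ 3,
    c 1 + c 2 - (3 * l 0 * a 0 ^ 2 * a 1 + l 1 * a 0 ^ 3),
    3 * (c 2 - (l 0 * a 0 * a 1 ^ 2 + l 1 * a 0 ^ 2 * a 1)),
    3 * c 2 - (l 0 * a 1 ^ 3 + 3 * l 1 * a 0 * a 1 ^ 2),
    c 2 - l 1 * a 1 ^ 3]) fun t => by
      have := congrArg (eval ![1, t]) h
      rw [eval_pull_cusp] at this
      simp at this ⊢
      linear_combination this
  have e2 := (mul_eq_zero.mp (key 2)).resolve_left h3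
  have e3 := key 3
  have e4 := key 4
  simp only [Matrix.cons_val] at e3 e4
  have r1 : l 0 * a 1 + 3 * l 1 * a 0 = 3 * l 1 * a 1 := by
    apply mul_left_cancel₀ (pow_ne_zero 2 ha)
    linear_combination -e3 + 3 * e4
  have r2 : l 0 * a 0 * a 1 + l 1 * a 0 ^ 2 = l 1 * a 1 ^ 2 := by
    apply mul_left_cancel₀ ha
    linear_combination -e2 + e4
  have hl1 : l 1 ≠ 0 := by
    intro h0
    rw [h0] at r1
    have h4 : l 0 = 0 := by simpa [ha] using r1
    apply hl
    funext i
    fin_cases i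
    exacts [h4, h0]
  have hfac : l 1 * ((2 * a 0 - a 1) * (a 0 - a 1)) = 0 := by
    linear_combination a 0 * r1 - r2
  rcases mul_eq_zero.mp ((mul_eq_zero.mp hfac).resolve_left hl1) with h5 | h5
  · right
    apply mul_left_cancel₀ ha
    linear_combination 2 * r1 - 3 * l 1 * h5
  · left
    apply mul_left_cancel₀ ha
    linear_combination r1 - 3 * l 1 * h5

/-- The cuspidal quartic has no further pencils of cubes. -/
theorem HasCubicPencil.of_cusp [Infinite K] (h3 : (3 : K) ≠ 0) {φ : PLineMorphism K}
    (hφ : ∀ c, ∃ c', φ.pull c = (cuspMorphism K).pull c') {P : PPlane K} {l a b : Fin 2 → K}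
    (h : φ.HasCubicPencil P l a b) : l 0 = 0 ∨ 2 * l 0 = 3 * l 1 := by
  obtain ⟨hl, hab, c, d, -, -, -, hpc, hpd⟩ := h
  obtain ⟨c', hc'⟩ := hφ c
  obtain ⟨d', hd'⟩ := hφ d
  -- At most one of `a, b` is a multiple of `s`, so the other one meets the condition of the
  -- preceding lemma.
  by_cases ha : a 1 = 0
  · refine eq_zero_or_of_pull_cusp_eq h3 hl (a := b) (fun hb => hab ?_) (hd'.symm.trans hpd)
    simp [wedge, ha, hb]
  · exact eq_zero_or_of_pull_cusp_eq h3 hl ha (hc'.symm.trans hpc)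

end PLineMorphism

/-! ### Counting Galois points -/

namespace PlaneCurve

variable {C : PlaneCurve K} {φ : PLineMorphism K}

theorem two_le_deltaZero_iff : 2 ≤ C.deltaZero ↔
    ∃ P P', (C.IsSmoothPoint P ∧ C.IsGaloisPoint P ∧ C.TangentMultiplicityEq P 2) ∧
      (C.IsSmoothPoint P' ∧ C.IsGaloisPoint P' ∧ C.TangentMultiplicityEq P' 2) ∧ P ≠ P' := by
  rw [← one_add_one_eq_two, ENat.add_one_le_iff ENat.one_ne_top]
  exact Set.one_lt_encard_iff

variable [IsAlgClosed K]

theorem exists_pencils_of_two_le_deltaZero (h3 : (3 : K) ≠ 0) (hC : C.degree = 4)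
    (hφ : C.IsNormalization φ) (h : 2 ≤ C.deltaZero) :
    ∃ (P P' : PPlane K) (l a b l' a' b' : Fin 2 → K), φ.HasCubicPencil P l a b ∧
      φ.HasCubicPencil P' l' a' b' ∧ wedge l' l ≠ 0 ∧ wedge l a ≠ 0 ∧ wedge l b ≠ 0 ∧
        wedge l' a' ≠ 0 ∧ wedge l' b' ≠ 0 := by
  obtain ⟨P, P', ⟨hs, hg, ht⟩, ⟨hs', hg', ht'⟩, hne⟩ := two_le_deltaZero_iff.mp h
  obtain ⟨l, a, b, hpen⟩ := exists_hasCubicPencil h3 hC hφ hs hg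
  obtain ⟨l', a', b', hpen'⟩ := exists_hasCubicPencil h3 hC hφ hs' hg'
  obtain ⟨ha, hb⟩ := (tangentMultiplicityEq_two_iff h3 hC hφ.1 hs hpen).mp ht
  obtain ⟨ha', hb'⟩ := (tangentMultiplicityEq_two_iff h3 hC hφ.1 hs' hpen').mp ht'
  exact ⟨P, P', l, a, b, l', a', b', hpen, hpen',
    fun h0 => hne ((hpen'.eq_iff hpen).mpr h0).symm, ha, hb, ha', hb'⟩

theorem mem_of_hasCubicPencil (h3 : (3 : K) ≠ 0) (hC : C.degree = 4)
    (hφ : C.IsNormalization φ) {P : PPlane K} {l a b : Fin 2 → K}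
    (hpen : φ.HasCubicPencil P l a b) (ha : wedge l a ≠ 0) (hb : wedge l b ≠ 0) :
    C.IsSmoothPoint P ∧ C.IsGaloisPoint P ∧ C.TangentMultiplicityEq P 2 := by
  obtain ⟨hs, hg⟩ := smooth_and_galois_of_hasCubicPencil h3 hC hφ hpen
  exact ⟨hs, hg, (tangentMultiplicityEq_two_iff h3 hC hφ.1 hs hpen).mpr ⟨ha, hb⟩⟩

/-- The parametrization is carried to the curve by the projective equivalence. Its own pencils show
that it is a normalization and supply the two points. -/
theorem two_le_deltaZero_of_family (h3 : (3 : K) ≠ 0) (hC : C.degree = 4) {β : K}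
    (hβ : β * (β - 1) * (β ^ 2 + β + 1) ≠ 0)
    (h : ProjectivelyEquivalent C.points (familyMorphism h3 β hβ).image) : 2 ≤ C.deltaZero := by
  have : Infinite K := IsAlgClosed.instInfinite
  obtain ⟨ψ, hd, himg, hψ, -⟩ := PLineMorphism.exists_of_projectivelyEquivalent h
  obtain ⟨P, P', l, a, b, l', a', b', hpen, hpen', hll', ha, hb, ha', hb'⟩ :=
    PLineMorphism.exists_pencils_of_family h3 hβ hψ
  have hN := isNormalization_of_hasCubicPencil hd hC himg hpen
  exact two_le_deltaZero_iff.mpr ⟨P, P', mem_of_hasCubicPencil h3 hC hN hpen ha hb,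
    mem_of_hasCubicPencil h3 hC hN hpen' ha' hb', fun h0 => hll' ((hpen.eq_iff hpen').mp h0)⟩

/-- In each pencil one cube vanishes at `Q`, so the two pencils share a linear form. The four cases
only exchange the roles of `a, b` and of `a', b'`. -/
theorem projectivelyEquivalent_cusp_of_differential (h3 : (3 : K) ≠ 0) (hC : C.degree = 4)
    (hφ : C.IsNormalization φ) (h : 2 ≤ C.deltaZero) {Q : PLine K}
    (hQ : φ.DifferentialVanishesAt Q) :
    ProjectivelyEquivalent C.points (cuspMorphism K).image := by
  have : Infinite K := IsAlgClosed.instInfinite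
  obtain ⟨P, P', l, a, b, l', a', b', hpen, hpen', hll', ha, hb, -, -⟩ :=
    exists_pencils_of_two_le_deltaZero h3 hC hφ h
  have hw : ∀ {m n : Fin 2 → K}, eval Q.rep (lin m) = 0 → eval Q.rep (lin n) = 0 →
      wedge m n = 0 := wedge_eq_zero_of_eval_lin Q.rep_nonzero
  rw [← hφ.1]
  rcases hpen.eval_lin_eq_zero_or h3 hQ with h0 | h0 <;>
    rcases hpen'.eval_lin_eq_zero_or h3 hQ with h1 | h1
  · exact PLineMorphism.projectivelyEquivalent_cusp_of_pencils hpen hpen' hll' ha hb (hw h0 h1)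
  · exact PLineMorphism.projectivelyEquivalent_cusp_of_pencils hpen hpen'.symm hll' ha hb
      (hw h0 h1)
  · exact PLineMorphism.projectivelyEquivalent_cusp_of_pencils hpen.symm hpen' hll' hb ha
      (hw h0 h1)
  · exact PLineMorphism.projectivelyEquivalent_cusp_of_pencils hpen.symm hpen'.symm hll' hb ha
      (hw h0 h1)

/-- Both explicit pencils satisfy the contact condition. Any smooth Galois point has a pencil whose
`l` is proportional to `t` or to `3 s + 2 t`, hence is one of the two points. -/
theorem delta_eq_two_of_cusp (h2 : (2 : K) ≠ 0) (h3 : (3 : K) ≠ 0) (hC : C.degree = 4)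
    (h : ProjectivelyEquivalent C.points (cuspMorphism K).image) :
    C.delta = 2 ∧ C.deltaZero = 2 := by
  have : Infinite K := IsAlgClosed.instInfinite
  obtain ⟨ψ, hd, himg, hψ, hψ'⟩ := PLineMorphism.exists_of_projectivelyEquivalent h
  obtain ⟨P, P', hpen, hpen'⟩ := PLineMorphism.exists_pencils_of_cusp h2 hψ
  have hN := isNormalization_of_hasCubicPencil hd hC himg hpen
  have hP := mem_of_hasCubicPencil h3 hC hN hpen (by simp [wedge]) (by simp [wedge])
  have hP' := mem_of_hasCubicPencil h3 hC hN hpen' (by simpa [wedge] using h2) (by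
    have : wedge ![3, 2] ![1, 2] = (2 * 2 : K) := by simp [wedge]; ring
    rw [this]
    exact mul_ne_zero h2 h2)
  have hne : P ≠ P' := fun h0 => h3 (by simpa [wedge] using (hpen.eq_iff hpen').mp h0)
  have hsub : ∀ R, C.IsSmoothPoint R → C.IsGaloisPoint R → R = P ∨ R = P' := by
    intro R hs hg
    obtain ⟨l, a, b, hR⟩ := exists_hasCubicPencil h3 hC hN hs hg
    rcases hR.of_cusp h3 hψ' with h0 | h0
    · left
      rw [hR.eq_iff hpen]
      simp [wedge, h0]
    · right
      rw [hR.eq_iff hpen']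
      simp only [wedge, Matrix.cons_val]
      linear_combination h0
  have hpair : ({P, P'} : Set (PPlane K)).encard = 2 := Set.encard_pair hne
  constructor
  · rw [← hpair, delta]
    congr 1
    ext R
    constructor
    · rintro ⟨hs, hg⟩
      exact hsub R hs hg
    · rintro (rfl | rfl)
      exacts [⟨hP.1, hP.2.1⟩, ⟨hP'.1, hP'.2.1⟩]
  · rw [← hpair, deltaZero]
    congr 1
    ext R
    constructor
    · rintro ⟨hs, hg, -⟩
      exact hsub R hs hg
    · rintro (rfl | rfl)
      exacts [hP, hP']

end PlaneCurve

end

theorem proposition3 {K : Type*} [Field K] [IsAlgClosed K]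
    (h2 : (2 : K) ≠ 0) (h3 : (3 : K) ≠ 0)
    (C : PlaneCurve K) (hC : C.degree = 4)
    (φ : PLineMorphism K) (hφ : C.IsNormalization φ) :
    (2 ≤ C.deltaZero ↔
      ∃ (β : K) (hβ : β * (β - 1) * (β ^ 2 + β + 1) ≠ 0),
        ProjectivelyEquivalent C.points (familyMorphism h3 β hβ).image) ∧
    (2 ≤ C.deltaZero → (∃ Q : PLine K, φ.DifferentialVanishesAt Q) →
      ProjectivelyEquivalent C.points (cuspMorphism K).image) ∧
    (ProjectivelyEquivalent C.points (cuspMorphism K).image →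
      C.delta = 2 ∧ C.deltaZero = 2) := by
  have : Infinite K := IsAlgClosed.instInfinite
  refine ⟨⟨fun h => ?_, fun ⟨β, hβ, h⟩ => PlaneCurve.two_le_deltaZero_of_family h3 hC hβ h⟩,
    fun h ⟨Q, hQ⟩ => PlaneCurve.projectivelyEquivalent_cusp_of_differential h3 hC hφ h hQ,
    fun h => PlaneCurve.delta_eq_two_of_cusp h2 h3 hC h⟩
  obtain ⟨P, P', l, a, b, l', a', b', hpen, hpen', hll', ha, hb, ha', hb'⟩ :=
    PlaneCurve.exists_pencils_of_two_le_deltaZero h3 hC hφ h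
  rw [← hφ.1]
  exact PLineMorphism.exists_family_of_pencils h3 hpen hpen' hll' ha hb ha' hb'
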